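/- **Model (2-D CCNTC).** Fix a set of basic one- and two-qubit gates that is universal, i.e. every one-qubit (two-qubit) unitary is, up to a global phase, a finite product of basic gates on that qubit (pair of qubits); measurement of a single qubit in the computational basis is also a basic operation. Let $q_{i,j}$ denote the qubit in column $i$ and row $j$ of an $n\times n$ grid, $0\le i,j\le n-1$. In each timestep a set of disjoint basic operations is applied to the grid, where two-qubit operations act only on nearest neighbours. The operations of each timestep (or the decision to stop) are computed by a deterministic polynomial-time machine from the classical input and all measurement outcomes of the earlier timesteps; the machine names gates from a fixed finite list of basic gates. The *depth* is the number of timesteps and the *size* is the total number of operations, both maximized over all measurement outcomes. The *width* is the number of qubits that are acted on for at least one sequence of measurement outcomes. **Theorem.** For every universal set of basic gates there are a 2-D CCNTC circuit (one polynomial-time machine for all inputs) and constants $c,d$ such that the following holds for every $n$, every $T\subseteq\{0,\dots,n-1\}$ and every injection $\pi:T\to\{0,\dots,n-1\}$ such that for all $j\in T$ with $\pi(j)=0$ every $k<j$ lies in $T$. Let $m=|\{j\in T:\pi(j)\neq 0\}|$. On input $(n,T,\pi)$, and with the qubits $q_{0,0},\dots,q_{0,n-1}$ of the first column (the data qubits)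 in an arbitrary joint state and all other qubits in the state $|0\rangle$, the circuit moves the qubit at $(0,j)$ to $(\pi(j),0)$ for all $j\in T$ and keeps the data qubits of all rows $j\notin T$ in place: for every sequence of measurement outcomes there is a vector $\chi$, independent of the joint state $\varphi$ of the data qubits, such that the final (unnormalized) state is $\varphi$ on the new places of the data qubits, tensored with $\chi$ on the remaining qubits. The circuit has depth at most $d$, size at most $c\,mn$ and width at most $(m+1)n$, where $(m+1)n\le n^2$. In particular all qubits acted on lie in a square of $n^2$ grid points. -/

import Mathlib

open scoped BigOperators Kronecker

namespace CCNTC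

/-! ### Classical polynomial time

The data of the classical machine are binary trees. A program is built from the elementary tree
operations, sequencing, branching and while loops. Every elementary operation is charged the size
of the tree that it reads, so each run takes at least as many steps as its input and its output
are large, and the functions computed in polynomial time are exactly those computed by
polynomial-time Turing machines. -/

/-- Binary trees. -/
inductive Data : Type
  | nil : Data
  | pair : Data → Data → Data

namespace Data

/-- The number of nodes, leaves included. -/
def size : Data → ℕ
  | nil => 1
  | pair a b => a.size + b.size + 1

def fst : Data → Data
  | nil => nil
  | pair a _ => a

def snd : Data → Data
  | nil => nil
  | pair _ b => b

def ofBool : Bool → Data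
  | false => nil
  | true => pair nil nil

/-- Numbers are written in unary. -/
def ofNat : ℕ → Data
  | 0 => nil
  | k + 1 => pair nil (ofNat k)

def ofOption {α : Type} (e : α → Data) : Option α → Data
  | none => nil
  | some a => pair nil (e a)

def ofList {α : Type} (e : α → Data) : List α → Data
  | [] => nil
  | a :: l => pair (e a) (ofList e l)

theorem ofBool_injective : Function.Injective ofBool := by
  intro a b h
  cases a <;> cases b <;> simp_all [ofBool]

theorem ofNat_injective : Function.Injective ofNat := by
  intro a
  induction a with
  | zero => intro b h; cases b <;> simp_all [ofNat]
  | succ k ih =>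
    intro b h
    cases b with
    | zero => simp [ofNat] at h
    | succ l => simp only [ofNat, pair.injEq, true_and] at h; rw [ih h]

theorem ofOption_injective {α : Type} {e : α → Data} (he : Function.Injective e) :
    Function.Injective (ofOption e) := by
  intro a b h
  cases a <;> cases b <;> simp_all [ofOption]
  exact he h

theorem ofList_injective {α : Type} {e : α → Data} (he : Function.Injective e) :
    Function.Injective (ofList e) := by
  intro l
  induction l with
  | nil => intro l' h; cases l' <;> simp_all [ofList]
  | cons a l ih =>
    intro l' h
    cases l' with
    | nil => simp [ofList] at h
    | cons b l' =>
      simp only [ofList, pair.injEq] at h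
      rw [he h.1, ih h.2]

end Data

/-- Programs of the classical machine. -/
inductive Prog : Type
  | nil : Prog
  | id : Prog
  | fst : Prog
  | snd : Prog
  | pair : Prog → Prog → Prog
  | comp : Prog → Prog → Prog
  | cond : Prog → Prog → Prog → Prog
  | loop : Prog → Prog → Prog

/-- `Run M x y t`: on input `x` the program `M` halts with output `y` after `t` steps.
`comp f g` runs `g` first; `cond c f g` runs `f` if `c` yields a non-empty tree and `g` otherwise;
`loop c f` repeats `f` as long as `c` yields a non-empty tree. -/
inductive Run : Prog → Data → Data → ℕ → Prop
  | nil (x : Data) : Run Prog.nil x Data.nil (x.size + 1)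
  | id (x : Data) : Run Prog.id x x (x.size + 1)
  | fst (x : Data) : Run Prog.fst x x.fst (x.size + 1)
  | snd (x : Data) : Run Prog.snd x x.snd (x.size + 1)
  | pair {f g : Prog} {x a b : Data} {s t : ℕ} :
      Run f x a s → Run g x b t → Run (Prog.pair f g) x (Data.pair a b) (s + t + 1)
  | comp {f g : Prog} {x y z : Data} {s t : ℕ} :
      Run g x y s → Run f y z t → Run (Prog.comp f g) x z (s + t + 1)
  | condTrue {c f g : Prog} {x a b y : Data} {s t : ℕ} :
      Run c x (Data.pair a b) s → Run f x y t → Run (Prog.cond c f g) x y (s + t + 1)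
  | condFalse {c f g : Prog} {x y : Data} {s t : ℕ} :
      Run c x Data.nil s → Run g x y t → Run (Prog.cond c f g) x y (s + t + 1)
  | loopStop {c f : Prog} {x : Data} {s : ℕ} :
      Run c x Data.nil s → Run (Prog.loop c f) x x (s + 1)
  | loopStep {c f : Prog} {x a b y z : Data} {s t u : ℕ} :
      Run c x (Data.pair a b) s → Run f x y t → Run (Prog.loop c f) y z u →
      Run (Prog.loop c f) x z (s + t + u + 1)

/-- The map `inp i ↦ out i` is computable in time polynomial in the size of `inp i`, by one
program for all `i`. -/
def PolyTime {ι : Type} (inp out : ι → Data) : Prop :=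
  ∃ (M : Prog) (p : Polynomial ℕ), ∀ i, ∃ t, t ≤ p.eval (inp i).size ∧ Run M (inp i) (out i) t

/-! ### Basic operations -/

abbrev Unitary₁ : Type := Matrix.unitaryGroup Bool ℂ
abbrev Unitary₂ : Type := Matrix.unitaryGroup (Bool × Bool) ℂ

/-- The one- and two-qubit gates that the hardware can perform. Measurement of a qubit in the
computational basis is always available in addition. -/
structure GateSet : Type where
  one : Set Unitary₁
  two : Set Unitary₂

/-- The operations on two qubits obtained from a single basic gate: a one-qubit gate on either
of them, or a two-qubit gate with its arguments in either order. -/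
def GateSet.onPair (B : GateSet) : Set (Matrix (Bool × Bool) (Bool × Bool) ℂ) :=
  {M | (∃ U ∈ B.one, M = (U : Matrix Bool Bool ℂ) ⊗ₖ (1 : Matrix Bool Bool ℂ)) ∨
       (∃ U ∈ B.one, M = (1 : Matrix Bool Bool ℂ) ⊗ₖ (U : Matrix Bool Bool ℂ)) ∨
       (∃ W ∈ B.two, M = (W : Matrix (Bool × Bool) (Bool × Bool) ℂ)) ∨
       (∃ W ∈ B.two,
         M = (W : Matrix (Bool × Bool) (Bool × Bool) ℂ).submatrix Prod.swap Prod.swap)}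

/-- Every one- or two-qubit unitary is, up to a global phase, a finite product of basic gates. -/
structure GateSet.Universal (B : GateSet) : Prop where
  one : ∀ U : Unitary₁, ∃ (c : ℂ) (l : List Unitary₁), ‖c‖ = 1 ∧ (∀ V ∈ l, V ∈ B.one) ∧
    (U : Matrix Bool Bool ℂ) = c • ((l.prod : Unitary₁) : Matrix Bool Bool ℂ)
  two : ∀ U : Unitary₂, ∃ (c : ℂ) (l : List (Matrix (Bool × Bool) (Bool × Bool) ℂ)),
    ‖c‖ = 1 ∧ (∀ M ∈ l, M ∈ B.onPair) ∧
    (U : Matrix (Bool × Bool) (Bool × Bool) ℂ) = c • l.prod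

/-- A finite selection of basic gates, by whose numbers the classical machine refers to them. -/
structure Palette (B : GateSet) : Type where
  k₁ : ℕ
  k₂ : ℕ
  one : Fin k₁ → B.one
  two : Fin k₂ → B.two

/-! ### The grid -/

/-- The qubits of an `n × n` grid; `(i, j)` is the qubit in column `i` and row `j`. -/
abbrev Qubit (n : ℕ) : Type := Fin n × Fin n

/-- Nearest neighbours in the grid. -/
def Neighbors {n : ℕ} (q r : Qubit n) : Prop :=
  (q.1 = r.1 ∧ ((q.2 : ℕ) + 1 = r.2 ∨ (r.2 : ℕ) + 1 = q.2)) ∨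
  (q.2 = r.2 ∧ ((q.1 : ℕ) + 1 = r.1 ∨ (r.1 : ℕ) + 1 = q.1))

/-- State vectors (not necessarily normalized) of the qubits indexed by `Q`. -/
abbrev State (Q : Type) : Type := (Q → Bool) → ℂ

def applyOne {n : ℕ} (U : Unitary₁) (q : Qubit n) (ψ : State (Qubit n)) : State (Qubit n) :=
  fun x => ∑ b : Bool, (U : Matrix Bool Bool ℂ) (x q) b * ψ (Function.update x q b)

def applyTwo {n : ℕ} (U : Unitary₂) (q r : Qubit n) (ψ : State (Qubit n)) :
    State (Qubit n) :=
  fun x => ∑ b : Bool × Bool, (U : Matrix (Bool × Bool) (Bool × Bool) ℂ) (x q, x r) b *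
    ψ (Function.update (Function.update x q b.1) r b.2)

/-- Projection onto the outcome `b` of a measurement of the qubit `q`. -/
def project {n : ℕ} (q : Qubit n) (b : Bool) (ψ : State (Qubit n)) : State (Qubit n) :=
  fun x => if x q = b then ψ x else 0

/-! ### Circuits with a classical controller -/

/-- A basic operation applied at a place of the grid. -/
inductive Op {B : GateSet} (P : Palette B) (n : ℕ) : Type
  | one (g : Fin P.k₁) (q : Qubit n) : Op P n
  | two (g : Fin P.k₂) (q r : Qubit n) : Op P n
  | measure (q : Qubit n) : Op P n

namespace Op

variable {B : GateSet} {P : Palette B} {n : ℕ}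

/-- The qubits acted on. -/
def support : Op P n → Finset (Qubit n)
  | one _ q => {q}
  | two _ q r => {q, r}
  | measure q => {q}

/-- Two-qubit operations act on neighbours only. -/
def Local : Op P n → Prop
  | one _ _ => True
  | two _ q r => Neighbors q r
  | measure _ => True

def encodeQubit (q : Qubit n) : Data :=
  Data.pair (Data.ofNat q.1) (Data.ofNat q.2)

def encode : Op P n → Data
  | measure q => Data.pair (Data.ofNat 0) (encodeQubit q)
  | one g q => Data.pair (Data.ofNat 1) (Data.pair (Data.ofNat g) (encodeQubit q))
  | two g q r => Data.pair (Data.ofNat 2)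
      (Data.pair (Data.ofNat g) (Data.pair (encodeQubit q) (encodeQubit r)))

theorem encodeQubit_injective : Function.Injective (encodeQubit (n := n)) := by
  intro q r h
  simp only [encodeQubit, Data.pair.injEq] at h
  exact Prod.ext (Fin.ext (Data.ofNat_injective h.1)) (Fin.ext (Data.ofNat_injective h.2))

theorem encode_injective : Function.Injective (encode (P := P) (n := n)) := by
  intro a b h
  cases a <;> cases b <;>
    simp only [encode, Data.pair.injEq, Data.ofNat_injective.eq_iff,
      encodeQubit_injective.eq_iff, Fin.val_inj] at h <;> simp_all

/-- The number of measurements in a list of operations. -/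
def measurements : List (Op P n) → ℕ
  | [] => 0
  | measure _ :: l => measurements l + 1
  | one _ _ :: l => measurements l
  | two _ _ _ :: l => measurements l

/-- The unnormalized state after the operations of one timestep, when the successive measurements
in the list have the outcomes given by the list of bits. The squared norm of the result is the
joint probability of these outcomes and the earlier ones. -/
def applyAll : List (Op P n) → List Bool → State (Qubit n) → State (Qubit n)
  | [], _, ψ => ψ
  | one g q :: l, o, ψ => applyAll l o (applyOne (P.one g : Unitary₁) q ψ)
  | two g q r :: l, o, ψ => applyAll l o (applyTwo (P.two g : Unitary₂) q r ψ)
  | measure q :: l, b :: o, ψ => applyAll l o (project q b ψ)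
  | measure _ :: _, [], _ => 0

end Op

/-- The measurement outcomes of the timesteps performed so far, one list of bits per timestep. -/
abbrev History : Type := List (List Bool)

def History.encode (h : History) : Data := Data.ofList (Data.ofList Data.ofBool) h

/-- What the controller does for a fixed input: given the outcomes so far, it either stops
(`none`) or names the operations of the next timestep. -/
abbrev Controller {B : GateSet} (P : Palette B) (n : ℕ) : Type :=
  History → Option (List (Op P n))

namespace Controller

variable {B : GateSet} {P : Palette B} {n : ℕ}

/-- `Reaches C h s`: the controller may perform the timesteps `s` and see the outcomes `h`. -/
inductive Reaches (C : Controller P n) : History → List (List (Op P n)) → Prop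
  | start : Reaches C [] []
  | step {h : History} {s : List (List (Op P n))} {ops : List (Op P n)} {o : List Bool} :
      Reaches C h s → C h = some ops → o.length = Op.measurements ops →
      Reaches C (h ++ [o]) (s ++ [ops])

/-- A completed computation: the controller stops after it. -/
def Completes (C : Controller P n) (h : History) (s : List (List (Op P n))) : Prop :=
  C.Reaches h s ∧ C h = none

/-- In every timestep the operations are disjoint, and two-qubit operations are performed between
neighbours only. -/
def Admissible (C : Controller P n) : Prop :=
  ∀ h s, C.Reaches h s → ∀ ops, C h = some ops →
    ops.Pairwise (fun a b => Disjoint a.support b.support) ∧ ∀ a ∈ ops, a.Local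

/-- The largest number of timesteps over all measurement outcomes. -/
noncomputable def depth (C : Controller P n) : ℕ∞ :=
  ⨆ (h : History) (s : List (List (Op P n))) (_ : C.Reaches h s), (s.length : ℕ∞)

/-- The largest total number of operations over all measurement outcomes. -/
noncomputable def size (C : Controller P n) : ℕ∞ :=
  ⨆ (h : History) (s : List (List (Op P n))) (_ : C.Reaches h s),
    (((s.map List.length).sum : ℕ) : ℕ∞)

/-- The qubits that are acted on for some measurement outcomes. -/
def acted (C : Controller P n) : Set (Qubit n) :=
  {q | ∃ h s, C.Reaches h s ∧ ∃ ops ∈ s, ∃ a ∈ ops, q ∈ a.support}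

/-- The number of qubits acted on. -/
noncomputable def width (C : Controller P n) : ℕ∞ := C.acted.encard

/-- The number of points of the smallest axis-parallel square of lattice points that contains all
qubits acted on. -/
noncomputable def squareWidth (C : Controller P n) : ℕ :=
  sInf {w : ℕ | ∃ (k : ℕ) (a b : ℤ), w = k ^ 2 ∧ ∀ q ∈ C.acted,
    a ≤ (q.1 : ℕ) ∧ ((q.1 : ℕ) : ℤ) < a + k ∧ b ≤ (q.2 : ℕ) ∧ ((q.2 : ℕ) : ℤ) < b + k}

end Controller

/-- The unnormalized state after the timesteps `s` with outcomes `h`. -/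
def evolve {B : GateSet} {P : Palette B} {n : ℕ} :
    List (List (Op P n)) → History → State (Qubit n) → State (Qubit n)
  | ops :: s, o :: h, ψ => evolve s h (Op.applyAll ops o ψ)
  | _, _, ψ => ψ

/-- A circuit in the two-dimensional nearest-neighbour model with a classical controller: for
each input `i` from `ι` a controller of a square grid of side `side i`. The controllers for all
inputs are one deterministic polynomial-time machine, which reads the input and the outcomes so
far and writes the operations of the next timestep, or the stop symbol. -/
structure Circuit (B : GateSet) (ι : Type) (side : ι → ℕ) (encode : ι → Data) : Type where
  palette : Palette B
  controller : ∀ i, Controller palette (side i)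
  admissible : ∀ i, (controller i).Admissible
  polyTime : PolyTime
    (fun a : ι × History => Data.pair (encode a.1) (History.encode a.2))
    (fun a : ι × History =>
      Data.ofOption (Data.ofList Op.encode) (controller a.1 a.2))

/-! ### Reordering the data qubits -/

/-- A set `T` of rows and an injection `π` of `T` into the columns; a row `j` is sent to column
`0` only if `T` contains all rows below `j`. -/
structure Reordering (n : ℕ) : Type where
  T : Finset (Fin n)
  π : {j // j ∈ T} → Fin n
  injective : Function.Injective π
  below : ∀ j : {j // j ∈ T}, (π j : ℕ) = 0 → ∀ k : Fin n, k < j.1 → k ∈ T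

namespace Reordering

variable {n : ℕ}

/-- The number of rows in `T` that are not sent to column `0`. -/
def m (R : Reordering n) : ℕ := (Finset.univ.filter fun j => (R.π j : ℕ) ≠ 0).card

/-- The list of length `n` with entry `π j` at place `j` if `j ∈ T`, and a blank otherwise. -/
def encode (R : Reordering n) : Data :=
  Data.ofList (Data.ofOption Data.ofNat)
    (List.ofFn fun j => if h : j ∈ R.T then some (R.π ⟨j, h⟩ : ℕ) else none)

/-- The place of the data qubit of row `j` after the reordering: `(π j, 0)` if `j ∈ T`, and its
old place `(0, j)` otherwise. -/
def dest (R : Reordering n) (j : Fin n) : Qubit n :=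
  if h : j ∈ R.T then (R.π ⟨j, h⟩, ⟨0, j.pos⟩) else (⟨0, j.pos⟩, j)

end Reordering

/-- The data qubits in the first column are in the joint state `φ`, all others in state `|0⟩`. -/
def initial {n : ℕ} (φ : State (Fin n)) : State (Qubit n) :=
  fun x => if ∀ q : Qubit n, (q.1 : ℕ) ≠ 0 → x q = false then
    φ (fun j => x (⟨0, j.pos⟩, j)) else 0

/-- The data qubits are in the joint state `φ` at their new places, and the remaining qubits are
in the state `χ`, in tensor product with it. -/
def relocated {n : ℕ} (R : Reordering n) (φ : State (Fin n))
    (χ : State {q : Qubit n // q ∉ Set.range R.dest}) : State (Qubit n) :=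
  fun x => φ (fun j => x (R.dest j)) * χ (fun q => x q.1)

/-- The controller moves the qubit at `(0, j)` to `(π j, 0)` for all `j ∈ T` and keeps the other
data qubits: whatever the measurement outcomes are, the joint state of the data qubits reappears
at the new places, up to a factor that does not depend on it. -/
def Moves {B : GateSet} {P : Palette B} {n : ℕ} (C : Controller P n) (R : Reordering n) : Prop :=
  ∀ h s, C.Completes h s → ∃ χ : State {q : Qubit n // q ∉ Set.range R.dest},
    ∀ φ : State (Fin n), evolve s h (initial φ) = relocated R φ χ

end CCNTC

namespace CCNTC

/-! ### Polynomial-time combinators -/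

/-! A qubit can be sent along a path of any length in constant depth with measurements and classical
corrections, and every reordering splits into eight rounds of such moves along disjoint paths.

Transport. Let `p` carry a data qubit and let its neighbour `q` be in state |0⟩. H on `q`, CZ, H on
`p`, measurement of `p` with outcome o and the flip X^o leave |0⟩ on `p` and the datum, acted on by
H Z^o, on `q`, with the factor 1/√2 for either outcome (`Compiled.ideal_std` iterates `cell_std`).
Since H exchanges X and Z, the effect accumulated along a path stays of the form ± X^u Z^v H^w
(`hMat_mul_zPow_mul_frame`), and one correction at the end of the path undoes it. The cells of a
path can be regrouped into layers (`Compiled.body_cons`): CZ gates commute, and the other operations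
pulled forward act on qubits that the passed ones do not touch. So all Hadamard gates of one kind,
the CZ gates of every second edge, and all measurements are simultaneous, and the depth does not
depend on the length. Disjoint paths run in parallel because operators with disjoint supports
commute (`localOps_commute`, `Compiled.tprod_rounds`). Universality supplies fixed words for H, X, Z
and CZ up to scalars (`GateSet.Universal.compiled`).

Routing. Number the qubits that leave column 0 from below, r = 0, …, m − 1. The one from row j with
target column b travels (0, j) → (⌊r/2⌋ + 1, j) → (⌊r/2⌋ + 1, ⌈r/2⌉) → (b, ⌈r/2⌉) → (b, 0); even r
move in the first four rounds, odd r in the last four. Inside a batch the intermediate rows and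
columns are distinct. The odd batch stays in rows ≥ 1, away from the even qubits already parked in
row 0, until each descends in its own target column. In the last round the qubit bound for (0, 0)
descends column 0, which the hypothesis `below` guarantees to be empty beneath it
(`place_disjoint`). Using two batches halves the number of intermediate rows and columns, which
gives the width (`Reordering.encard_le`).

Control. The number of timesteps is a constant of the gate set, so the machine distinguishes
finitely many cases, each handled by list transducers and unary arithmetic
(`Compiled.polyTime_reorder`). -/

theorem eval_mono (p : Polynomial ℕ) {m n : ℕ} (h : m ≤ n) : p.eval m ≤ p.eval n := by
  rw [Polynomial.eval_eq_sum, Polynomial.eval_eq_sum]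
  exact Finset.sum_le_sum fun i _ => Nat.mul_le_mul_left _ (Nat.pow_le_pow_left h i)

theorem Data.size_pos (x : Data) : 1 ≤ x.size := by
  cases x <;> simp [Data.size]

theorem Data.size_fst_le (x : Data) : x.fst.size ≤ x.size := by
  cases x <;> simp [Data.fst, Data.size]; omega

theorem Data.size_snd_le (x : Data) : x.snd.size ≤ x.size := by
  cases x <;> simp [Data.snd, Data.size]; omega

theorem Run.size_input_le {M : Prog} {x y : Data} {t : ℕ} (h : Run M x y t) : x.size ≤ t := by
  induction h <;> omega

/-- Elementary operations are charged the size of what they read, so the running time also bounds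
the output. This keeps the second time bound of a composition polynomial in the original input. -/
theorem Run.size_le {M : Prog} {x y : Data} {t : ℕ} (h : Run M x y t) : y.size ≤ t := by
  induction h with
  | nil x => simp [Data.size]
  | id x => omega
  | fst x => have := x.size_fst_le; omega
  | snd x => have := x.size_snd_le; omega
  | pair _ _ h₁ h₂ => simp only [Data.size]; omega
  | comp _ _ _ h => omega
  | condTrue _ _ _ h => omega
  | condFalse _ _ _ h => omega
  | loopStop h => have := h.size_input_le; omega
  | loopStep _ _ _ _ _ h => omega

namespace PolyTime

variable {ι κ : Type} {inp out mid a b c : ι → Data}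

theorem size_le (h : PolyTime inp out) :
    ∃ p : Polynomial ℕ, ∀ i, (out i).size ≤ p.eval (inp i).size := by
  obtain ⟨M, p, h⟩ := h
  refine ⟨p, fun i => ?_⟩
  obtain ⟨t, ht, hr⟩ := h i
  exact hr.size_le.trans ht

theorem of_elementary (M : Prog) (h : ∀ i, Run M (inp i) (out i) ((inp i).size + 1)) :
    PolyTime inp out :=
  ⟨M, Polynomial.X + 1, fun i => ⟨_, by simp, h i⟩⟩

theorem id : PolyTime inp inp := of_elementary Prog.id fun _ => Run.id _

theorem nil : PolyTime inp (fun _ => Data.nil) := of_elementary Prog.nil fun _ => Run.nil _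

theorem comp (hf : PolyTime inp mid) (hg : PolyTime mid out) : PolyTime inp out := by
  obtain ⟨M, p, hM⟩ := hf
  obtain ⟨N, q, hN⟩ := hg
  refine ⟨Prog.comp N M, p + q.comp p + 1, fun i => ?_⟩
  obtain ⟨s, hs, hr⟩ := hM i
  obtain ⟨t, ht, hr'⟩ := hN i
  refine ⟨s + t + 1, ?_, Run.comp hr hr'⟩
  have := eval_mono q (hr.size_le.trans hs)
  simp only [Polynomial.eval_add, Polynomial.eval_comp, Polynomial.eval_one]
  omega

theorem fst (h : PolyTime inp a) : PolyTime inp (fun i => (a i).fst) :=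
  h.comp (of_elementary Prog.fst fun _ => Run.fst _)

theorem snd (h : PolyTime inp a) : PolyTime inp (fun i => (a i).snd) :=
  h.comp (of_elementary Prog.snd fun _ => Run.snd _)

theorem pair (ha : PolyTime inp a) (hb : PolyTime inp b) :
    PolyTime inp (fun i => Data.pair (a i) (b i)) := by
  obtain ⟨M, p, hM⟩ := ha
  obtain ⟨N, q, hN⟩ := hb
  refine ⟨Prog.pair M N, p + q + 1, fun i => ?_⟩
  obtain ⟨s, hs, hr⟩ := hM i
  obtain ⟨t, ht, hr'⟩ := hN i
  refine ⟨s + t + 1, ?_, Run.pair hr hr'⟩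
  simp only [Polynomial.eval_add, Polynomial.eval_one]
  omega

theorem const (x : Data) : PolyTime inp (fun _ => x) := by
  induction x with
  | nil => exact nil
  | pair x y hx hy => exact hx.pair hy

theorem congr {out' : ι → Data} (h : PolyTime inp out) (he : ∀ i, out i = out' i) :
    PolyTime inp out' := funext he ▸ h

theorem reindex (h : PolyTime inp out) (f : κ → ι) :
    PolyTime (fun k => inp (f k)) (fun k => out (f k)) := by
  obtain ⟨M, p, h⟩ := h
  exact ⟨M, p, fun k => h (f k)⟩

/-- Both branches are bounded on every input, but each has to agree with `out` only where the test
selects it. -/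
theorem cond (hc : PolyTime inp c) (ha : PolyTime inp a) (hb : PolyTime inp b)
    (h₁ : ∀ i, c i ≠ Data.nil → out i = a i) (h₂ : ∀ i, c i = Data.nil → out i = b i) :
    PolyTime inp out := by
  obtain ⟨K, p, hK⟩ := hc
  obtain ⟨M, q, hM⟩ := ha
  obtain ⟨N, r, hN⟩ := hb
  refine ⟨Prog.cond K M N, p + q + r + 1, fun i => ?_⟩
  obtain ⟨s, hs, hr⟩ := hK i
  obtain ⟨t, ht, hr₁⟩ := hM i
  obtain ⟨u, hu, hr₂⟩ := hN i
  simp only [Polynomial.eval_add, Polynomial.eval_one]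
  cases h : c i with
  | nil =>
    rw [h₂ i h]
    exact ⟨s + u + 1, by omega, Run.condFalse (h ▸ hr) hr₂⟩
  | pair x y =>
    rw [h₁ i (by simp [h])]
    exact ⟨s + t + 1, by omega, Run.condTrue (h ▸ hr) hr₁⟩

end PolyTime

/-- Types whose elements are presented to the classical machine as trees. -/
class Enc (α : Type) where
  enc : α → Data

open Enc

instance : Enc Data := ⟨fun x => x⟩
instance : Enc Unit := ⟨fun _ => Data.nil⟩
instance : Enc Bool := ⟨Data.ofBool⟩
instance : Enc ℕ := ⟨Data.ofNat⟩
instance {α : Type} [Enc α] : Enc (Option α) := ⟨Data.ofOption enc⟩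
instance {α : Type} [Enc α] : Enc (List α) := ⟨Data.ofList enc⟩
instance {α β : Type} [Enc α] [Enc β] : Enc (α × β) := ⟨fun x => Data.pair (enc x.1) (enc x.2)⟩

/-- The size of the tree that presents `a`. -/
def sz {α : Type} [Enc α] (a : α) : ℕ := (enc a).size

/-! ### Sizes of encoded data -/

section
variable {α β γ : Type} [Enc α] [Enc β] [Enc γ]

theorem sz_pos (a : α) : 1 ≤ sz a := Data.size_pos _
theorem sz_prod (a : α) (b : β) : sz (a, b) = sz a + sz b + 1 := rfl
theorem sz_cons (a : α) (l : List α) : sz (a :: l) = sz a + sz l + 1 := rfl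
theorem sz_nil : sz ([] : List α) = 1 := rfl
theorem sz_succ (n : ℕ) : sz (n + 1) = sz n + 2 := by
  change 1 + sz n + 1 = _
  omega
theorem sz_bool_le (b : Bool) : sz b ≤ 3 := by cases b <;> decide

theorem sz_append (l l' : List α) : sz (l ++ l') + 1 = sz l + sz l' := by
  induction l with
  | nil => simp [sz_nil]; omega
  | cons a l ih => simp only [List.cons_append, sz_cons]; omega

theorem sz_reverse (l : List α) : sz l.reverse = sz l := by
  induction l with
  | nil => rfl
  | cons a l ih =>
    have := sz_append l.reverse [a]
    rw [sz_cons, sz_nil] at this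
    rw [List.reverse_cons, sz_cons]
    omega

theorem length_le_sz (l : List α) : l.length ≤ sz l := by
  induction l with
  | nil => simp
  | cons a l ih => simp only [List.length_cons, sz_cons]; omega

theorem sz_le_of_mem {a : α} {l : List α} (h : a ∈ l) : sz a ≤ sz l := by
  induction l with
  | nil => simp at h
  | cons b l ih =>
    rw [sz_cons]
    rcases List.mem_cons.1 h with rfl | h
    · omega
    · have := ih h; omega

theorem sz_prefix {l l' : List α} (h : l <+: l') : sz l ≤ sz l' := by
  obtain ⟨t, rfl⟩ := h
  have := sz_append l t
  have := sz_pos t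
  omega

end

/-- `f` is computable in polynomial time. -/
def PF {α β : Type} [Enc α] [Enc β] (f : α → β) : Prop :=
  PolyTime (fun a : α => enc a) (fun a => enc (f a))

/-! ### Closure properties of polynomial-time functions -/

namespace PF

variable {α β γ δ σ ι : Type} [Enc α] [Enc β] [Enc γ] [Enc δ] [Enc σ] [Enc ι]

theorem id : PF (fun a : α => a) := PolyTime.id
theorem const (b : β) : PF (fun _ : α => b) := PolyTime.const _
theorem comp {f : β → γ} {g : α → β} (hf : PF f) (hg : PF g) : PF (fun a => f (g a)) :=
  PolyTime.comp hg (hf.reindex g)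
theorem pair {f : α → β} {g : α → γ} (hf : PF f) (hg : PF g) : PF (fun a => (f a, g a)) :=
  PolyTime.pair hf hg
theorem fst {f : α → β × γ} (hf : PF f) : PF (fun a => (f a).1) := PolyTime.fst hf
theorem snd {f : α → β × γ} (hf : PF f) : PF (fun a => (f a).2) := PolyTime.snd hf
theorem cons {f : α → β} {g : α → List β} (hf : PF f) (hg : PF g) : PF (fun a => f a :: g a) :=
  PolyTime.pair hf hg
theorem some {f : α → β} (hf : PF f) : PF (fun a => some (f a)) :=
  PolyTime.pair (PolyTime.const Data.nil) hf
theorem succ {f : α → ℕ} (hf : PF f) : PF (fun a => f a + 1) :=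
  PolyTime.pair (PolyTime.const Data.nil) hf

theorem sz_le {f : α → β} (hf : PF f) : ∃ p : Polynomial ℕ, ∀ a, sz (f a) ≤ p.eval (sz a) :=
  hf.size_le

theorem cond {c : α → Bool} {f g : α → β} (hc : PF c) (hf : PF f) (hg : PF g) :
    PF (fun a => bif c a then f a else g a) := by
  refine PolyTime.cond hc hf hg (fun a h => ?_) fun a h => ?_
  · cases hb : c a
    · simp [hb, enc, Data.ofBool] at h
    · simp [hb]
  · cases hb : c a
    · simp [hb]
    · simp [hb, enc, Data.ofBool] at h

theorem tail {f : α → List β} (hf : PF f) : PF (fun a => (f a).tail) := by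
  refine (PolyTime.snd hf).congr fun a => ?_
  beta_reduce
  cases f a <;> rfl

/-- Projections of the empty tree are empty, so the default must be a value that the empty tree
encodes. -/
theorem headD {f : α → List β} {d : β} (hd : enc d = Data.nil) (hf : PF f) :
    PF (fun a => (f a).headD d) := by
  refine (PolyTime.fst hf).congr fun a => ?_
  beta_reduce
  cases f a
  · exact hd.symm
  · rfl

theorem pred {f : α → ℕ} (hf : PF f) : PF (fun a => f a - 1) := by
  refine (PolyTime.snd hf).congr fun a => ?_
  beta_reduce
  cases f a <;> rfl

theorem isSome {f : α → Option β} (hf : PF f) : PF (fun a => (f a).isSome) := by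
  refine PolyTime.cond hf (PolyTime.const (enc true)) (PolyTime.const (enc false))
    (fun a h => ?_) fun a h => ?_ <;>
  · cases hb : f a <;> simp_all [enc, Data.ofOption]

theorem getD {f : α → Option β} {d : β} (hd : enc d = Data.nil) (hf : PF f) :
    PF (fun a => (f a).getD d) := by
  refine (PolyTime.snd hf).congr fun a => ?_
  beta_reduce
  cases f a
  · exact hd.symm
  · rfl

theorem ne_zero {f : α → ℕ} (hf : PF f) : PF (fun a => !(f a == 0)) := by
  refine PolyTime.cond hf (PolyTime.const (enc true)) (PolyTime.const (enc false))
    (fun a h => ?_) fun a h => ?_ <;>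
  · cases hb : f a <;> simp_all [enc, Data.ofNat]

theorem not {f : α → Bool} (hf : PF f) : PF (fun a => !f a) := by
  have := hf.cond (const false) (const true)
  convert this using 2 with a
  cases f a <;> rfl

theorem and {f g : α → Bool} (hf : PF f) (hg : PF g) : PF (fun a => f a && g a) := by
  have := hf.cond hg (const false)
  convert this using 2 with a
  cases f a <;> rfl

theorem xor {f g : α → Bool} (hf : PF f) (hg : PF g) : PF (fun a => Bool.xor (f a) (g a)) := by
  have := hf.cond hg.not hg
  convert this using 2 with a
  cases f a <;> simp

/-- Any function of a bit can be applied. -/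
theorem ofBool {f : α → Bool} (φ : Bool → α → β) (hf : PF f) (h₁ : PF (φ true))
    (h₂ : PF (φ false)) : PF (fun a => φ (f a) a) := by
  have := hf.cond h₁ h₂
  convert this using 2 with a
  cases f a <;> rfl

/-- Iteration over a list, as long as all intermediate results are of polynomial size. -/
theorem foldl {step : α → σ → ι → σ} {init : α → σ} {l : α → List ι}
    (hstep : PF (fun x : α × σ × ι => step x.1 x.2.1 x.2.2)) (hinit : PF init) (hl : PF l)
    (hb : ∃ b : Polynomial ℕ, ∀ a l', l' <+: l a →
      sz (l'.foldl (step a) (init a)) ≤ b.eval (sz a)) :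
    PF (fun a => (l a).foldl (step a) (init a)) := by
  have hbody : PolyTime (fun x : (ι × List ι) × σ × α => enc (x.1.1 :: x.1.2, x.2))
      (fun x => enc (x.1.2, step x.2.2 x.2.1 x.1.1, x.2.2)) := by
    have h₀ : PolyTime (fun x : (ι × List ι) × σ × α => enc (x.1.1 :: x.1.2, x.2))
      (fun x => enc (x.1.1 :: x.1.2, x.2)) := PolyTime.id
    refine h₀.fst.snd.pair (PolyTime.pair ?_ h₀.snd.snd)
    have h₁ : PolyTime (fun x : (ι × List ι) × σ × α => enc (x.1.1 :: x.1.2, x.2))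
      (fun x => enc (x.2.2, x.2.1, x.1.1)) :=
      h₀.snd.snd.pair (h₀.snd.fst.pair h₀.fst.fst)
    exact h₁.comp (hstep.reindex fun x : (ι × List ι) × σ × α => (x.2.2, x.2.1, x.1.1))
  obtain ⟨M, p, hM⟩ := hbody
  obtain ⟨b, hb⟩ := hb
  obtain ⟨q, hq⟩ := hl.sz_le
  have hloop : PolyTime (fun a : α => enc (l a, init a, a))
      (fun a => enc (([] : List ι), (l a).foldl (step a) (init a), a)) := by
    let S : Polynomial ℕ := q + b + Polynomial.X + 4
    have hS : ∀ a : α, S.eval (sz a) = q.eval (sz a) + b.eval (sz a) + sz a + 4 := by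
      intro a; simp [S]
    -- The loop runs on triples (rest of the list, accumulator, parameter) and its test `fst` asks
    -- whether the rest is non-empty. `S` bounds the size of every such triple; a pass costs at most
    -- `S + 1` for the test, `p(S)` for the body and 1 for the loop, and there are at most `q + 1`
    -- tests.
    refine ⟨Prog.loop Prog.fst M, ((q + 1) * (S + p.comp S + 2)).comp Polynomial.X, fun a => ?_⟩
    have key : ∀ (l₂ l₁ : List ι), l₁ ++ l₂ = l a →
        ∃ t, t ≤ (l₂.length + 1) * (S.eval (sz a) + p.eval (S.eval (sz a)) + 2) ∧
        Run (Prog.loop Prog.fst M) (enc (l₂, l₁.foldl (step a) (init a), a))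
          (enc (([] : List ι), (l a).foldl (step a) (init a), a)) t := by
      intro l₂
      induction l₂ with
      | nil =>
        intro l₁ h
        rw [List.append_nil] at h
        subst h
        refine ⟨_, ?_, Run.loopStop (Run.fst _)⟩
        have h₁ := hb a _ (List.prefix_refl _)
        have h₂ : (enc (([] : List ι), (l a).foldl (step a) (init a), a)).size
          = sz ([] : List ι) + (sz ((l a).foldl (step a) (init a)) + sz a + 1) + 1 := rfl
        rw [h₂, sz_nil, hS]
        simp only [List.length_nil, zero_add, one_mul]
        omega
      | cons x l₂ ih =>
        intro l₁ h
        obtain ⟨t, ht, hr⟩ := ih (l₁ ++ [x]) (by simpa using h)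
        obtain ⟨u, hu, hr'⟩ := hM ((x, l₂), l₁.foldl (step a) (init a), a)
        rw [List.foldl_append] at hr
        refine ⟨_, ?_, Run.loopStep (Run.fst _) hr' hr⟩
        have h₁ := hb a l₁ ⟨_, h⟩
        have h₂ : (enc (x :: l₂, l₁.foldl (step a) (init a), a)).size
          = sz (x :: l₂) + (sz (l₁.foldl (step a) (init a)) + sz a + 1) + 1 := rfl
        have h₃ := sz_append l₁ (x :: l₂)
        rw [h] at h₃
        have h₄ := hq a
        have h₅ := sz_pos l₁
        have h₇ : (enc (x :: l₂, l₁.foldl (step a) (init a), a)).size ≤ S.eval (sz a) := by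
          rw [h₂, hS]
          omega
        have h₆ := hu.trans (eval_mono p h₇)
        rw [List.length_cons]
        have : (l₂.length + 1 + 1) * (S.eval (sz a) + p.eval (S.eval (sz a)) + 2) =
          (l₂.length + 1) * (S.eval (sz a) + p.eval (S.eval (sz a)) + 2) +
          (S.eval (sz a) + p.eval (S.eval (sz a)) + 2) := by ring
        omega
    obtain ⟨t, ht, hr⟩ := key (l a) [] rfl
    refine ⟨t, ht.trans ?_, hr⟩
    rw [Polynomial.eval_comp, Polynomial.eval_X]
    have h₁ : sz a ≤ (enc (l a, init a, a)).size := by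
      change _ ≤ sz (l a, init a, a)
      rw [sz_prod, sz_prod]
      omega
    refine le_trans ?_ (eval_mono _ h₁)
    simp only [Polynomial.eval_mul, Polynomial.eval_add, Polynomial.eval_one, Polynomial.eval_comp,
      Polynomial.eval_ofNat]
    exact Nat.mul_le_mul_right _ (Nat.add_le_add_right ((length_le_sz _).trans (hq a)) _)
  exact ((PolyTime.pair hl (PolyTime.pair hinit PF.id)).comp hloop).snd.fst

theorem foldl_le {σ ι : Type} [Enc σ] [Enc ι] {step : σ → ι → σ} (c : ℕ)
    (hsz : ∀ s i, sz (step s i) ≤ sz s + sz i + c) (l : List ι) (s : σ) :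
    sz (l.foldl step s) ≤ sz s + (c + 1) * sz l := by
  induction l generalizing s with
  | nil => simp
  | cons x l ih =>
    have h₁ := ih (step s x)
    have h₂ := hsz s x
    rw [List.foldl_cons, sz_cons]
    have : (c + 1) * (sz x + sz l + 1) = (c + 1) * sz l + c * sz x + sz x + c + 1 := by ring
    omega

theorem foldl_bound {step : α → σ → ι → σ} {init : α → σ} {l : α → List ι} (c : ℕ)
    (hinit : PF init) (hl : PF l) (hsz : ∀ a s i, sz (step a s i) ≤ sz s + sz i + c) :
    ∃ b : Polynomial ℕ, ∀ a l', l' <+: l a →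
      sz (l'.foldl (step a) (init a)) ≤ b.eval (sz a) := by
  obtain ⟨p, hp⟩ := hinit.sz_le
  obtain ⟨q, hq⟩ := hl.sz_le
  refine ⟨p + Polynomial.C (c + 1) * q, fun a l' h => (foldl_le c (hsz a) l' _).trans ?_⟩
  simp only [Polynomial.eval_add, Polynomial.eval_mul, Polynomial.eval_C]
  exact Nat.add_le_add (hp a) (Nat.mul_le_mul_left _ ((sz_prefix h).trans (hq a)))

/-- Iteration over a list with results growing by a bounded amount. -/
theorem foldl_of_le {step : α → σ → ι → σ} {init : α → σ} {l : α → List ι} (c : ℕ)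
    (hstep : PF (fun x : α × σ × ι => step x.1 x.2.1 x.2.2)) (hinit : PF init) (hl : PF l)
    (hsz : ∀ a s i, sz (step a s i) ≤ sz s + sz i + c) :
    PF (fun a => (l a).foldl (step a) (init a)) :=
  foldl hstep hinit hl (foldl_bound c hinit hl hsz)

theorem reverseAux {f g : α → List β} (hf : PF f) (hg : PF g) :
    PF (fun a => (f a).reverseAux (g a)) := by
  have := foldl_of_le (step := fun (_ : α) (s : List β) i => i :: s) 1
    (id.snd.snd.cons id.snd.fst) hg hf (fun a s i => by rw [sz_cons]; omega)
  convert this using 2 with a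
  generalize g a = m
  generalize f a = l
  induction l generalizing m with
  | nil => rfl
  | cons x l ih => exact ih _

theorem reverse {f : α → List β} (hf : PF f) : PF (fun a => (f a).reverse) :=
  hf.reverseAux (const [])

theorem append {f g : α → List β} (hf : PF f) (hg : PF g) : PF (fun a => f a ++ g a) := by
  have := hf.reverse.reverseAux hg
  convert this using 2 with a
  rw [List.reverseAux_eq, List.reverse_reverse]

end PF

/-- The output of a transducer with transitions `d` and emissions `e` that reads a list. -/
def scan {σ ι ω : Type} (d : σ → ι → σ) (e : σ → ι → List ω) : σ → List ι → List ω
  | _, [] => []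
  | s, i :: l => e s i ++ scan d e (d s i) l

theorem scan_append {σ ι ω : Type} (d : σ → ι → σ) (e : σ → ι → List ω) (s : σ) (l l' : List ι) :
    scan d e s (l ++ l') = scan d e s l ++ scan d e (l.foldl d s) l' := by
  induction l generalizing s with
  | nil => rfl
  | cons i l ih => simp [scan, ih]

/-- Emissions are stacked in reverse on an accumulator, so a transducer becomes an ordinary fold
followed by a single reversal. -/
theorem foldl_scan {σ ι ω : Type} (d : σ → ι → σ) (e : σ → ι → List ω) (l : List ι) (s : σ)
    (o : List ω) : l.foldl (fun (x : σ × List ω) i => (d x.1 i, (e x.1 i).reverseAux x.2)) (s, o) =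
      (l.foldl d s, (scan d e s l).reverse ++ o) := by
  induction l generalizing s o with
  | nil => rfl
  | cons i l ih => rw [List.foldl_cons, ih]; simp [scan, List.reverseAux_eq]

namespace PF

variable {α β γ δ σ ι ω : Type} [Enc α] [Enc β] [Enc γ] [Enc δ] [Enc σ] [Enc ι] [Enc ω]

/-- Only the growth of the state needs a hypothesis: each emission is polynomial in the size of a
reachable state, and the number of emissions is the length of the list. -/
theorem scan {d : α → σ → ι → σ} {e : α → σ → ι → List ω} {init : α → σ} {l : α → List ι} (c : ℕ)
    (hd : PF (fun x : α × σ × ι => d x.1 x.2.1 x.2.2))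
    (he : PF (fun x : α × σ × ι => e x.1 x.2.1 x.2.2))
    (hinit : PF init) (hl : PF l) (hsz : ∀ a s i, sz (d a s i) ≤ sz s + sz i + c) :
    PF (fun a => scan (d a) (e a) (init a) (l a)) := by
  obtain ⟨b, hb⟩ := foldl_bound c hinit hl hsz
  obtain ⟨q, hq⟩ := hl.sz_le
  obtain ⟨r, hr⟩ := he.sz_le
  have hout : ∀ a l₂ l₁, l₁ ++ l₂ <+: l a →
      sz (CCNTC.scan (d a) (e a) (l₁.foldl (d a) (init a)) l₂) ≤
        l₂.length * r.eval (sz a + b.eval (sz a) + q.eval (sz a) + 2) + 1 := by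
    intro a l₂
    induction l₂ with
    | nil => intro l₁ h; simp [CCNTC.scan, sz_nil]
    | cons i l₂ ih =>
      intro l₁ h
      have h₁ := ih (l₁ ++ [i]) (by simpa using h)
      rw [List.foldl_append] at h₁
      have h₂ := hr (a, l₁.foldl (d a) (init a), i)
      have h₃ := hb a l₁ ((List.prefix_append _ _).trans h)
      have h₄ : sz i ≤ q.eval (sz a) :=
        (sz_le_of_mem (List.IsPrefix.mem (by simp) h)).trans (hq a)
      have h₅ := h₂.trans (eval_mono r (n := sz a + b.eval (sz a) + q.eval (sz a) + 2)
        (by rw [sz_prod, sz_prod]; omega))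
      have h₆ := sz_append (e a (l₁.foldl (d a) (init a)) i)
        (CCNTC.scan (d a) (e a) (d a (l₁.foldl (d a) (init a)) i) l₂)
      simp only [List.foldl_cons, List.foldl_nil] at h₁ h₅
      rw [CCNTC.scan, List.length_cons, Nat.succ_mul]
      omega
  have hfold : PF (fun a => (l a).foldl
      (fun (x : σ × List ω) i => (d a x.1 i, (e a x.1 i).reverseAux x.2)) (init a, [])) := by
    refine foldl (step := fun a (x : σ × List ω) i => (d a x.1 i, (e a x.1 i).reverseAux x.2))
      ?_ (hinit.pair (const [])) hl
      ⟨b + q * r.comp (Polynomial.X + b + q + 2) + 2, fun a l' h => ?_⟩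
    · have h₀ : PF (fun x : α × (σ × List ω) × ι => (x.1, x.2.1.1, x.2.2)) :=
        id.fst.pair (id.snd.fst.fst.pair id.snd.snd)
      exact (hd.comp h₀).pair ((he.comp h₀).reverseAux id.snd.fst.snd)
    · rw [foldl_scan, List.append_nil, sz_prod, sz_reverse]
      have h₁ := hout a l' [] h
      have h₂ := hb a l' h
      have h₃ : l'.length ≤ q.eval (sz a) :=
        (length_le_sz l').trans ((sz_prefix h).trans (hq a))
      have h₄ := Nat.mul_le_mul_right (r.eval (sz a + b.eval (sz a) + q.eval (sz a) + 2)) h₃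
      simp only [Polynomial.eval_add, Polynomial.eval_mul, Polynomial.eval_comp, Polynomial.eval_X,
        Polynomial.eval_ofNat]
      simp only [List.foldl_nil] at h₁
      omega
  have := hfold.snd.reverse
  convert this using 2 with a
  rw [foldl_scan, List.append_nil, List.reverse_reverse]

theorem flatMap {f : α → ι → List ω} {l : α → List ι} (hf : PF (fun x : α × ι => f x.1 x.2))
    (hl : PF l) : PF (fun a => (l a).flatMap (f a)) := by
  have := scan (d := fun (_ : α) (s : Unit) (_ : ι) => s) (e := fun a _ i => f a i) 0
    (const ()) (hf.comp (id.fst.pair id.snd.snd)) (const ()) hl (fun a s i => by omega)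
  convert this using 2 with a
  generalize l a = l
  induction l with
  | nil => rfl
  | cons i l ih => simp only [List.flatMap_cons, ih, CCNTC.scan]

/-! Unary arithmetic -/

/-- In unary, a number and the list of that many units are the same tree. This turns iteration over
a number into iteration over a list. -/
theorem replicate {f : α → ℕ} (hf : PF f) : PF (fun a => List.replicate (f a) ()) := by
  refine PolyTime.congr hf fun a => ?_
  beta_reduce
  induction f a with
  | zero => rfl
  | succ n ih => exact congrArg (Data.pair Data.nil) ih

theorem length {f : α → List β} (hf : PF f) : PF (fun a => (f a).length) := by
  have := foldl_of_le (step := fun (_ : α) (s : ℕ) (_ : β) => s + 1) 2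
    id.snd.fst.succ (const 0) hf (fun a s i => by rw [sz_succ]; omega)
  convert this using 2 with a
  simp

theorem sub {f g : α → ℕ} (hf : PF f) (hg : PF g) : PF (fun a => f a - g a) := by
  have := foldl_of_le (step := fun (_ : α) (s : ℕ) (_ : Unit) => s - 1) 0
    id.snd.fst.pred hf hg.replicate (fun a s i => by
      cases s
      · simp
      · rw [sz_succ, Nat.add_sub_cancel]; omega)
  convert this using 2 with a
  generalize f a = k
  induction g a generalizing k with
  | zero => rfl
  | succ n ih => rw [List.replicate_succ, List.foldl_cons, ← ih]; omega

theorem lt {f g : α → ℕ} (hf : PF f) (hg : PF g) : PF (fun a => decide (f a < g a)) := by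
  have := (hg.sub hf).ne_zero
  convert this using 2 with a
  rw [Bool.eq_iff_iff]
  simp
  omega

theorem beq {f g : α → ℕ} (hf : PF f) (hg : PF g) : PF (fun a => f a == g a) := by
  have := (hf.lt hg).not.and (hg.lt hf).not
  convert this using 2 with a
  rw [Bool.eq_iff_iff]
  simp
  omega

theorem divMod {f : α → ℕ} (hf : PF f) : PF (fun a => (f a / 2, decide (f a % 2 = 1))) := by
  have := foldl_of_le (step := fun (_ : α) (s : ℕ × Bool) (_ : Unit) =>
      (bif s.2 then s.1 + 1 else s.1, !s.2)) 5
    ((id.snd.fst.snd.cond id.snd.fst.fst.succ id.snd.fst.fst).pair id.snd.fst.snd.not)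
    (const (0, false)) hf.replicate (fun a s i => by
      obtain ⟨k, b⟩ := s
      rw [sz_prod, sz_prod]
      have := sz_bool_le (!b)
      cases b
      · simp only [cond_false]; omega
      · simp only [cond_true, sz_succ]; omega)
  convert this using 2 with a
  induction f a with
  | zero => rfl
  | succ n ih =>
    rw [List.replicate_succ', List.foldl_append, ← ih]
    by_cases h : n % 2 = 1
    · simp [h]; omega
    · simp [h]; omega

theorem half {f : α → ℕ} (hf : PF f) : PF (fun a => f a / 2) := hf.divMod.fst

theorem odd {f : α → ℕ} (hf : PF f) : PF (fun a => decide (f a % 2 = 1)) := hf.divMod.snd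

theorem list_getD {f : α → List (List β)} (hf : PF f) (k : ℕ) : PF (fun a => (f a).getD k []) := by
  induction k generalizing f with
  | zero =>
    have := hf.headD (d := []) rfl
    convert this using 2 with a
    cases f a <;> rfl
  | succ k ih =>
    have := ih hf.tail
    convert this using 2 with a
    cases f a <;> rfl

/-- Choice between finitely many functions according to the length of a list. -/
theorem getElem?_length {f : α → List β} (hf : PF f) (F : κ → α → γ) (l : List κ)
    (hF : ∀ k ∈ l, PF (F k)) : PF (fun a => (l[(f a).length]?).map fun k => F k a) := by
  induction l generalizing f with
  | nil => exact const none
  | cons k l ih =>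
    have h₁ := (hF k (by simp)).some
    have h₂ := ih hf.tail fun k hk => hF k (by simp [hk])
    refine PolyTime.cond hf h₂ h₁ (fun a h => ?_) fun a h => ?_
    · cases hb : f a <;> simp_all [enc, Data.ofList]
    · cases hb : f a <;> simp_all [enc, Data.ofList]

end PF

end CCNTC

namespace CCNTC

/-! ### Local operators -/

section Operators

variable {V : Type} [DecidableEq V]

/-- Linear operators on state vectors. -/
abbrev Oper (V : Type) : Type := Module.End ℂ (State V)

/-- The operator with matrix `M` on the qubit `q`. -/
def one (q : V) (M : Matrix Bool Bool ℂ) : Oper V where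
  toFun ψ := fun x => ∑ b : Bool, M (x q) b * ψ (Function.update x q b)
  map_add' ψ ψ' := by
    ext x
    simp only [Pi.add_apply, mul_add, Finset.sum_add_distrib]
  map_smul' c ψ := by
    ext x
    simp only [Pi.smul_apply, smul_eq_mul, RingHom.id_apply, Finset.mul_sum]
    exact Finset.sum_congr rfl fun b _ => by ring

/-- The operator with matrix `M` on the qubits `q` and `r`. -/
def two (q r : V) (M : Matrix (Bool × Bool) (Bool × Bool) ℂ) : Oper V where
  toFun ψ := fun x => ∑ b : Bool × Bool, M (x q, x r) b *
    ψ (Function.update (Function.update x q b.1) r b.2)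
  map_add' ψ ψ' := by
    ext x
    simp only [Pi.add_apply, mul_add, Finset.sum_add_distrib]
  map_smul' c ψ := by
    ext x
    simp only [Pi.smul_apply, smul_eq_mul, RingHom.id_apply, Finset.mul_sum]
    exact Finset.sum_congr rfl fun b _ => by ring

theorem one_apply (q : V) (M : Matrix Bool Bool ℂ) (ψ : State V) (x : V → Bool) :
    one q M ψ x = ∑ b : Bool, M (x q) b * ψ (Function.update x q b) := rfl

theorem two_apply (q r : V) (M : Matrix (Bool × Bool) (Bool × Bool) ℂ) (ψ : State V)
    (x : V → Bool) : two q r M ψ x = ∑ b : Bool × Bool, M (x q, x r) b *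
      ψ (Function.update (Function.update x q b.1) r b.2) := rfl

theorem one_smul' (q : V) (c : ℂ) (M : Matrix Bool Bool ℂ) : one q (c • M) = c • one q M := by
  ext ψ x
  simp only [one_apply, LinearMap.smul_apply, Pi.smul_apply, Matrix.smul_apply, smul_eq_mul,
    Finset.mul_sum, mul_assoc]

theorem one_mul' (q : V) (M N : Matrix Bool Bool ℂ) : one q (M * N) = one q M * one q N := by
  ext ψ x
  simp only [one_apply, Module.End.mul_apply, Matrix.mul_apply, Function.update_self,
    Function.update_idem, Finset.sum_mul, Finset.mul_sum, mul_assoc]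
  exact Finset.sum_comm

theorem one_one' (q : V) : one q (1 : Matrix Bool Bool ℂ) = 1 := by
  ext ψ x
  simp only [one_apply, Matrix.one_apply, ite_mul, one_mul, zero_mul, Finset.sum_ite_eq,
    Finset.mem_univ, if_true, Function.update_eq_self, Module.End.one_apply]

theorem one_commute {q r : V} (h : q ≠ r) (M N : Matrix Bool Bool ℂ) :
    Commute (one q M) (one r N) := by
  change one q M * one r N = one r N * one q M
  ext ψ x
  simp only [one_apply, Module.End.mul_apply, Finset.mul_sum]
  rw [Finset.sum_comm]
  refine Finset.sum_congr rfl fun a _ => Finset.sum_congr rfl fun b _ => ?_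
  rw [Function.update_of_ne h, Function.update_of_ne h.symm, Function.update_comm h]
  ring

theorem two_smul' (q r : V) (c : ℂ) (M : Matrix (Bool × Bool) (Bool × Bool) ℂ) :
    two q r (c • M) = c • two q r M := by
  ext ψ x
  simp only [two_apply, LinearMap.smul_apply, Pi.smul_apply, Matrix.smul_apply, smul_eq_mul,
    Finset.mul_sum, mul_assoc]

theorem two_add' (q r : V) (M N : Matrix (Bool × Bool) (Bool × Bool) ℂ) :
    two q r (M + N) = two q r M + two q r N := by
  ext ψ x
  simp only [two_apply, LinearMap.add_apply, Pi.add_apply, Matrix.add_apply, add_mul,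
    Finset.sum_add_distrib]

theorem two_kronecker {q r : V} (h : q ≠ r) (M N : Matrix Bool Bool ℂ) :
    two q r (M ⊗ₖ N) = one q M * one r N := by
  ext ψ x
  simp only [two_apply, one_apply, Module.End.mul_apply, Matrix.kroneckerMap_apply,
    Fintype.sum_prod_type, Finset.mul_sum, Function.update_of_ne h.symm, mul_assoc]

theorem two_mul' {q r : V} (h : q ≠ r) (M N : Matrix (Bool × Bool) (Bool × Bool) ℂ) :
    two q r (M * N) = two q r M * two q r N := by
  ext ψ x
  have h₁ : ∀ b c : Bool × Bool, Function.update (Function.update (Function.update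
      (Function.update x q b.1) r b.2) q c.1) r c.2 =
      Function.update (Function.update x q c.1) r c.2 := by
    intro b c
    rw [Function.update_comm h.symm, Function.update_idem, Function.update_idem]
  simp only [two_apply, Module.End.mul_apply, Matrix.mul_apply, Function.update_self,
    Function.update_of_ne h, h₁, Finset.sum_mul, Finset.mul_sum, mul_assoc]
  exact Finset.sum_comm

theorem two_one' {q r : V} (h : q ≠ r) :
    two q r (1 : Matrix (Bool × Bool) (Bool × Bool) ℂ) = 1 := by
  rw [← Matrix.one_kronecker_one, two_kronecker h, one_one', one_one', one_mul]

theorem two_swap {q r : V} (h : q ≠ r) (M : Matrix (Bool × Bool) (Bool × Bool) ℂ) :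
    two q r (M.submatrix Prod.swap Prod.swap) = two r q M := by
  ext ψ x
  rw [two_apply, two_apply, ← (Equiv.prodComm Bool Bool).sum_comp]
  refine Finset.sum_congr rfl fun b _ => ?_
  rw [Function.update_comm h]
  rfl

/-- The algebra of operators that act on the qubits in `S`. -/
def localOps (S : Set V) : Subalgebra ℂ (Oper V) :=
  Algebra.adjoin ℂ {K | ∃ q ∈ S, ∃ M, K = one q M}

theorem localOps_mono {S S' : Set V} (h : S ⊆ S') : localOps S ≤ localOps S' :=
  Algebra.adjoin_mono fun _ ⟨q, hq, M, hM⟩ => ⟨q, h hq, M, hM⟩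

theorem one_mem_localOps {S : Set V} {q : V} (h : q ∈ S) (M : Matrix Bool Bool ℂ) :
    one q M ∈ localOps S := Algebra.subset_adjoin ⟨q, h, M, rfl⟩

/-- A two-qubit matrix is a sum of Kronecker products of matrix units, so its operator is a sum of
products of one-qubit operators. -/
theorem two_mem_localOps {S : Set V} {q r : V} (hq : q ∈ S) (hr : r ∈ S) (h : q ≠ r)
    (M : Matrix (Bool × Bool) (Bool × Bool) ℂ) : two q r M ∈ localOps S := by
  induction M using Matrix.induction_on' with
  | h_zero =>
    have := two_smul' q r 0 0
    rw [zero_smul, zero_smul] at this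
    exact this ▸ (localOps S).zero_mem
  | h_add M N hM hN => exact two_add' q r M N ▸ (localOps S).add_mem hM hN
  | h_std_basis a b c =>
    have : Matrix.single a b c = Matrix.single a.1 b.1 c ⊗ₖ Matrix.single a.2 b.2 (1 : ℂ) := by
      rw [Matrix.single_kronecker_single, mul_one]
    rw [this, two_kronecker h]
    exact (localOps S).mul_mem (one_mem_localOps hq _) (one_mem_localOps hr _)

/-- Commutation passes from generators to the algebras they generate, and the generators on the two
sides act on different single qubits. All parallel execution rests on this. -/
theorem localOps_commute {S S' : Set V} (h : Disjoint S S') {K L : Oper V}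
    (hK : K ∈ localOps S) (hL : L ∈ localOps S') : Commute K L := by
  refine Algebra.commute_of_mem_adjoin_of_forall_mem_commute hL ?_
  rintro _ ⟨r, hr, N, rfl⟩
  refine (Algebra.commute_of_mem_adjoin_of_forall_mem_commute hK ?_).symm
  rintro _ ⟨q, hq, M, rfl⟩
  exact one_commute (fun e => Set.disjoint_left.1 h (e ▸ hq) hr) N M

end Operators

end CCNTC

namespace CCNTC

/-! ### The gates of a wire -/

/-- The normalization `1 / √2` of the Hadamard gate. -/
noncomputable def invSqrtTwo : ℂ := ((√2)⁻¹ : ℝ)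

theorem invSqrtTwo_mul_self : invSqrtTwo * invSqrtTwo = 1 / 2 := by
  rw [invSqrtTwo, ← Complex.ofReal_mul, ← mul_inv, Real.mul_self_sqrt (by norm_num)]
  norm_num

/-- The sign `-1` if `b` holds. -/
def sign (b : Bool) : ℂ := bif b then -1 else 1

/-- The Hadamard gate. -/
noncomputable def hMat : Matrix Bool Bool ℂ := fun a b => invSqrtTwo * sign (a && b)

/-- The power `X ^ u` of the bit flip. -/
def xPow (u : Bool) : Matrix Bool Bool ℂ := fun a b => if Bool.xor a b = u then 1 else 0

/-- The power `Z ^ v` of the phase flip. -/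
def zPow (v : Bool) : Matrix Bool Bool ℂ := fun a b => if a = b then sign (a && v) else 0

/-- The power `H ^ w` of the Hadamard gate. -/
noncomputable def hPow (w : Bool) : Matrix Bool Bool ℂ := bif w then hMat else 1

/-- The controlled phase flip. -/
def czMat : Matrix (Bool × Bool) (Bool × Bool) ℂ :=
  fun a b => if a = b then sign (a.1 && a.2) else 0

/-- The projection onto the outcome `o`. -/
def proj (o : Bool) : Matrix Bool Bool ℂ := fun a b => if a = b ∧ a = o then 1 else 0

theorem hMat_mul_hMat : hMat * hMat = 1 := by
  ext a b
  have := invSqrtTwo_mul_self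
  cases a <;> cases b <;> simp [Matrix.mul_apply, hMat, sign, this]
  all_goals norm_num

theorem xPow_mul_xPow (u : Bool) : xPow u * xPow u = 1 := by
  ext a b
  cases u <;> cases a <;> cases b <;> simp [Matrix.mul_apply, xPow]

theorem zPow_mul_zPow (v : Bool) : zPow v * zPow v = 1 := by
  ext a b
  cases v <;> cases a <;> cases b <;> simp [Matrix.mul_apply, zPow, sign]

theorem hPow_mul_hPow (w : Bool) : hPow w * hPow w = 1 := by
  cases w <;> simp [hPow, hMat_mul_hMat]

theorem czMat_mul_czMat : czMat * czMat = 1 := by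
  ext a b
  obtain ⟨a₁, a₂⟩ := a
  obtain ⟨b₁, b₂⟩ := b
  cases a₁ <;> cases a₂ <;> cases b₁ <;> cases b₂ <;>
    simp [Matrix.mul_apply, czMat, sign]

theorem hMat_mem : hMat ∈ Matrix.unitaryGroup Bool ℂ := by
  rw [Matrix.mem_unitaryGroup_iff]
  convert hMat_mul_hMat
  ext a b
  cases a <;> cases b <;> simp [Matrix.star_apply, hMat, sign, invSqrtTwo]

theorem xPow_mem (u : Bool) : xPow u ∈ Matrix.unitaryGroup Bool ℂ := by
  rw [Matrix.mem_unitaryGroup_iff]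
  convert xPow_mul_xPow u
  ext a b
  cases u <;> cases a <;> cases b <;> simp [Matrix.star_apply, xPow]

theorem zPow_mem (v : Bool) : zPow v ∈ Matrix.unitaryGroup Bool ℂ := by
  rw [Matrix.mem_unitaryGroup_iff]
  convert zPow_mul_zPow v
  ext a b
  cases v <;> cases a <;> cases b <;> simp [Matrix.star_apply, zPow, sign]

theorem czMat_mem : czMat ∈ Matrix.unitaryGroup (Bool × Bool) ℂ := by
  rw [Matrix.mem_unitaryGroup_iff]
  convert czMat_mul_czMat
  ext a b
  obtain ⟨a₁, a₂⟩ := a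
  obtain ⟨b₁, b₂⟩ := b
  cases a₁ <;> cases a₂ <;> cases b₁ <;> cases b₂ <;> simp [Matrix.star_apply, czMat, sign]

/-- The operators `X ^ u * Z ^ v * H ^ w`, which a wire leaves behind. -/
noncomputable def frame (u v w : Bool) : Matrix Bool Bool ℂ := xPow u * zPow v * hPow w

/-- H exchanges X and Z, hence H Z^o X^u Z^v = X^o Z^u X^v H, and moving Z^u past X^v gives the
sign. The frame therefore keeps its shape when the datum passes one cell, with new bits (v + o, u, w
+ 1). -/
theorem hMat_mul_zPow_mul_frame (o u v w : Bool) :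
    hMat * zPow o * frame u v w = sign (u && v) • frame (Bool.xor v o) u (!w) := by
  have key : hMat * zPow o * (xPow u * zPow v) =
      sign (u && v) • (xPow (Bool.xor v o) * zPow u * hMat) := by
    ext a b
    cases o <;> cases u <;> cases v <;> cases a <;> cases b <;>
      simp [Matrix.mul_apply, xPow, zPow, hMat, sign]
  rw [frame, ← mul_assoc, key, frame, Matrix.smul_mul, mul_assoc _ hMat]
  cases w <;> simp [hPow, hMat_mul_hMat]

theorem corrections_mul_frame (u v w : Bool) :
    hPow w * zPow v * xPow u * frame u v w = 1 := by
  have : hPow w * zPow v * xPow u * frame u v w =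
      hPow w * (zPow v * (xPow u * xPow u) * zPow v) * hPow w := by
    simp only [frame, mul_assoc]
  rw [this, xPow_mul_xPow, mul_one, zPow_mul_zPow, mul_one, hPow_mul_hPow]

/-! ### One-bit teleportation of a data qubit -/

section Standard

variable {V J : Type}

open Classical in
/-- The data qubits are in the joint state `φ` at the places `p`, all others in state `|0⟩`. -/
noncomputable def std (p : J → V) (φ : State J) : State V :=
  fun x => if ∀ v, v ∉ Set.range p → x v = false then φ (fun j => x (p j)) else 0

theorem std_apply_of_iff {p : J → V} {φ : State J} {x : V → Bool} {C : Prop} [Decidable C]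
    (h : (∀ v, v ∉ Set.range p → x v = false) ↔ C) :
    std p φ x = if C then φ (fun j => x (p j)) else 0 := by
  by_cases hC : C
  · rw [std, if_pos (h.2 hC), if_pos hC]
  · rw [std, if_neg fun h' => hC (h.1 h'), if_neg hC]

theorem std_smul (p : J → V) (c : ℂ) (φ : State J) : std p (c • φ) = c • std p φ := by
  classical
  ext x
  rw [Pi.smul_apply, std_apply_of_iff Iff.rfl, std_apply_of_iff Iff.rfl]
  by_cases h : ∀ v, v ∉ Set.range p → x v = false
  · rw [if_pos h, if_pos h]; rfl
  · rw [if_neg h, if_neg h, smul_zero]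

variable [DecidableEq V] [DecidableEq J]

theorem one_std {p : J → V} (hp : Function.Injective p) (j : J) (M : Matrix Bool Bool ℂ)
    (φ : State J) : one (p j) M (std p φ) = std p (one j M φ) := by
  classical
  ext x
  have h₁ : ∀ b, (∀ v, v ∉ Set.range p → Function.update x (p j) b v = false) ↔
      ∀ v, v ∉ Set.range p → x v = false := by
    refine fun b => forall₂_congr fun v hv => ?_
    rw [Function.update_of_ne]
    rintro rfl
    exact hv ⟨j, rfl⟩
  have h₂ : ∀ b, (fun i => Function.update x (p j) b (p i)) =
      Function.update (fun i => x (p i)) j b :=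
    fun b => Function.update_comp_eq_of_injective x hp j b
  rw [one_apply]
  simp only [std_apply_of_iff (h₁ _), std_apply_of_iff Iff.rfl, h₂]
  by_cases h : ∀ v, v ∉ Set.range p → x v = false
  · simp only [if_pos h, one_apply]
  · simp only [if_neg h, mul_zero, Finset.sum_const_zero]

/-- One step of a wire: the contents of `p` move to `q`, and `p` is reset. -/
noncomputable def cell (o : Bool) (p q : V) : Oper V :=
  one p (xPow o) * (one p (proj o) * (one p hMat * (two p q czMat * one q hMat)))

theorem two_czMat_apply (p q : V) (ψ : State V) (x : V → Bool) :
    two p q czMat ψ x = sign (x p && x q) * ψ x := by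
  rw [two_apply, Finset.sum_eq_single (x p, x q)]
  · simp [czMat]
  · intro b _ hb
    simp [czMat, hb.symm]
  · simp

/-- Both operators are diagonal, so they commute even when they share a qubit. This allows the CZ
gates of a wire to be taken out of path order. -/
theorem two_czMat_commute (p q p' q' : V) :
    Commute (two p q czMat) (two p' q' czMat) := by
  change _ * _ = _ * _
  ext ψ x
  simp only [Module.End.mul_apply, two_czMat_apply]
  ring

/-- With b the old value at `p j` and d the new one at `q`, the gates and the projection produce the
amplitude ½ ∑ (−1)^(b(o + d)) φ(b), which is 1/√2 times H Z^o φ at d. The factor is the same for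
both outcomes, and X^o returns the measured qubit to |0⟩, so that later wires can use it. -/
theorem cell_std {p : J → V} (hp : Function.Injective p) (j : J) {q : V} (hq : q ∉ Set.range p)
    (o : Bool) (φ : State J) : cell o (p j) q (std p φ) =
      invSqrtTwo • std (Function.update p j q) (one j (hMat * zPow o) φ) := by
  classical
  have hne : p j ≠ q := fun h => hq ⟨j, h⟩
  -- The operators on `p j` that follow the CZ merge into one matrix, whose `false` row is row `o`
  -- of H and whose other row vanishes.
  have hmerge : cell o (p j) q = one (p j) (xPow o * proj o * hMat) *
      (two (p j) q czMat * one q hMat) := by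
    simp only [cell, one_mul', mul_assoc]
  have hk : ∀ a b, (xPow o * proj o * hMat) a b = if a = false then hMat o b else 0 := by
    intro a b
    cases o <;> cases a <;> cases b <;> simp [Matrix.mul_apply, xPow, proj]
  ext x
  let C : Prop := ∀ v, v ∉ Set.range p → v ≠ q → x v = false
  have h₁ : ∀ b d, std p φ (Function.update (Function.update x (p j) b) q d) =
      if d = false then (if C then
        φ (Function.update (fun i => x (p i)) j b) else 0) else 0 := by
    intro b d
    have e₁ : (∀ v, v ∉ Set.range p → Function.update (Function.update x (p j) b) q d v = false) ↔
        d = false ∧ C := by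
      constructor
      · refine fun h => ⟨by simpa using h q hq, fun v hv hvq => ?_⟩
        have := h v hv
        rwa [Function.update_of_ne hvq, Function.update_of_ne] at this
        rintro rfl
        exact hv ⟨j, rfl⟩
      · rintro ⟨rfl, h⟩ v hv
        by_cases hvq : v = q
        · simp [hvq]
        · rw [Function.update_of_ne hvq, Function.update_of_ne]
          · exact h v hv hvq
          · rintro rfl
            exact hv ⟨j, rfl⟩
    have e₂ : (fun i => Function.update (Function.update x (p j) b) q d (p i)) =
        Function.update (fun i => x (p i)) j b := by
      refine Eq.trans (funext fun i => ?_) (Function.update_comp_eq_of_injective x hp j b)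
      exact Function.update_of_ne (fun h => hq ⟨i, h⟩) _ _
    rw [std_apply_of_iff e₁, e₂, ite_and]
  have h₂ : ∀ ψ : State J, std (Function.update p j q) ψ x =
      if x (p j) = false then (if C then
        ψ (Function.update (fun i => x (p i)) j (x q)) else 0) else 0 := by
    intro ψ
    have e₁ : (∀ v, v ∉ Set.range (Function.update p j q) → x v = false) ↔
        x (p j) = false ∧ C := by
      have hmem : ∀ v, v ∈ Set.range (Function.update p j q) ↔
          v = q ∨ (v ∈ Set.range p ∧ v ≠ p j) := by
        intro v
        constructor
        · rintro ⟨i, rfl⟩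
          by_cases hi : i = j
          · left; simp [hi]
          · right
            rw [Function.update_of_ne hi]
            exact ⟨⟨i, rfl⟩, fun h => hi (hp h)⟩
        · rintro (rfl | ⟨⟨i, rfl⟩, hi⟩)
          · exact ⟨j, by simp⟩
          · exact ⟨i, Function.update_of_ne (fun h => hi (by rw [h])) _ _⟩
      constructor
      · intro h
        refine ⟨h _ fun hm => ?_, fun v hv hvq => h v fun hm => ?_⟩
        · rcases (hmem _).1 hm with h' | h'
          · exact hne h'
          · exact h'.2 rfl
        · rcases (hmem _).1 hm with h' | h'
          · exact hvq h'
          · exact hv h'.1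
      · rintro ⟨h, hC⟩ v hv
        rw [hmem] at hv
        push Not at hv
        by_cases hvp : v ∈ Set.range p
        · rw [hv.2 hvp, h]
        · exact hC v hvp hv.1
    have e₂ : (fun i => x (Function.update p j q i)) =
        Function.update (fun i => x (p i)) j (x q) := by
      funext i
      by_cases hi : i = j
      · subst hi; simp
      · simp [Function.update_of_ne hi]
    rw [std_apply_of_iff e₁, e₂, ite_and]
  rw [hmerge, Module.End.mul_apply, Module.End.mul_apply, Pi.smul_apply, h₂]
  simp only [one_apply, two_czMat_apply, h₁, hk, Function.update_of_ne hne.symm,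
    Function.update_self, Function.update_idem]
  by_cases hC : C
  · have e : ∀ b, (hMat * zPow o) (x q) b = hMat (x q) b * sign (b && o) := by
      intro b
      cases b <;> simp [Matrix.mul_apply, zPow]
    simp only [if_pos hC, e]
    cases x (p j) <;> cases x q <;> cases o <;>
      simp [hMat, sign] <;> ring
  · simp [if_neg hC]

end Standard

/-! ### Time-ordered products -/

section TProd

variable {M : Type*} [Monoid M]

/-- The product of a list of operators, the first one of which is applied first. -/
def tprod : List M → M
  | [] => 1
  | a :: l => tprod l * a

theorem tprod_append (l l' : List M) : tprod (l ++ l') = tprod l' * tprod l := by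
  induction l with
  | nil => simp [tprod]
  | cons a l ih => simp [tprod, ih, mul_assoc]

theorem tprod_flatMap {α : Type*} (l : List α) (f : α → List M) :
    tprod (l.flatMap f) = tprod (l.map fun a => tprod (f a)) := by
  induction l with
  | nil => rfl
  | cons a l ih => simp [tprod, tprod_append, ih]

theorem tprod_commute {l : List M} {a : M} (h : ∀ b ∈ l, Commute a b) : Commute a (tprod l) := by
  induction l with
  | nil => exact Commute.one_right a
  | cons b l ih =>
    exact (ih fun c hc => h c (by simp [hc])).mul_right (h b (by simp))

theorem tprod_mem {A : Type*} [SetLike A M] [SubmonoidClass A M] {S : A} {l : List M}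
    (h : ∀ a ∈ l, a ∈ S) : tprod l ∈ S := by
  induction l with
  | nil => exact one_mem S
  | cons a l ih => exact mul_mem (ih fun b hb => h b (by simp [hb])) (h a (by simp))

theorem tprod_map_mul {α : Type*} {l : List α} {f g : α → M}
    (h : ∀ a ∈ l, ∀ b ∈ l, Commute (f a) (g b)) :
    tprod (l.map fun a => g a * f a) = tprod (l.map g) * tprod (l.map f) := by
  induction l with
  | nil => simp [tprod]
  | cons a l ih =>
    have h₁ : Commute (g a) (tprod (l.map f)) := tprod_commute fun b hb => by
      obtain ⟨c, hc, rfl⟩ := List.mem_map.1 hb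
      exact (h c (by simp [hc]) a (by simp)).symm
    simp only [List.map_cons, tprod, ih fun b hb c hc => h b (by simp [hb]) c (by simp [hc])]
    rw [mul_assoc, mul_assoc, ← mul_assoc _ (g a), ← h₁.eq, mul_assoc]

/-- Exchange of two time orders. -/
theorem tprod_comm {α β : Type*} (l : List α) {l' : List β} {F : α → β → M}
    (h : l'.Pairwise fun b b' => ∀ a ∈ l, ∀ a' ∈ l, Commute (F a b) (F a' b')) :
    tprod (l.map fun a => tprod (l'.map (F a))) =
      tprod (l'.map fun b => tprod (l.map fun a => F a b)) := by
  induction l' with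
  | nil =>
    simp only [List.map_nil, tprod]
    induction l with
    | nil => rfl
    | cons a l ih => simpa [tprod] using ih
  | cons b l' ih =>
    rw [List.pairwise_cons] at h
    simp only [List.map_cons, tprod]
    rw [← ih h.2, tprod_map_mul]
    intro a ha a' ha'
    refine tprod_commute fun c hc => ?_
    obtain ⟨b', hb', rfl⟩ := List.mem_map.1 hc
    exact h.1 b' hb' a ha a' ha'

end TProd

theorem tprod_smul {α V : Type} (l : List α) (c : ℂ) (F : α → Oper V) :
    tprod (l.map fun a => c • F a) = c ^ l.length • tprod (l.map F) := by
  induction l with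
  | nil => simp [tprod]
  | cons a l ih =>
    simp only [List.map_cons, tprod, ih, List.length_cons, smul_mul_assoc, mul_smul_comm, smul_smul,
      pow_succ]
    rw [mul_comm]

end CCNTC

namespace CCNTC

/-! ### Wires -/

/-- A step `(true, p, q)` of a wire from `p` to `q`, or the end `(false, p, p)` of a wire. -/
abbrev Item (V : Type) : Type := Bool × V × V

/-- The flags `(e, o, u, v, w)` of an item: it is a step, the outcome at its first qubit is `o`,
and `X ^ u * Z ^ v * H ^ w` is the effect of the wire so far. -/
abbrev Flags : Type := Bool × Bool × Bool × Bool × Bool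

/-- Items with flags. -/
abbrev Ann (V : Type) : Type := Flags × V × V

/-- The unread measurement outcomes and the effect of the wire so far. -/
abbrev Track : Type := List Bool × Bool × Bool × Bool

/-- A step consumes one outcome and updates (u, v, w) as in `hMat_mul_zPow_mul_frame`. An end item
consumes none and clears the frame, so that the unread outcomes pass to the next wire. The default
`false` stands in for an outcome that is not yet known. -/
def Track.next {V : Type} (s : Track) (i : Item V) : Track :=
  bif i.1 then (s.1.tail, Bool.xor s.2.2.1 (s.1.headD false), s.2.1, !s.2.2.2)
  else (s.1, false, false, false)

def Track.flag {V : Type} (s : Track) (i : Item V) : List (Ann V) :=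
  [((i.1, s.1.headD false, s.2.1, s.2.2.1, s.2.2.2), i.2)]

def annotate {V : Type} (s : Track) (l : List (Item V)) : List (Ann V) :=
  scan Track.next Track.flag s l

/-- The items of the wire that starts at `p` and then visits `l`. -/
def wireItems {V : Type} : V → List V → List (Item V)
  | p, [] => [(false, p, p)]
  | p, q :: l => (true, p, q) :: wireItems q l

/-- The annotated items of a wire. -/
def wire {V : Type} (s : Track) (p : V) (l : List V) : List (Ann V) := annotate s (wireItems p l)

section
variable {V : Type} (s : Track) (p q : V) (l : List V)

theorem wire_nil : wire s p [] = [((false, s.1.headD false, s.2.1, s.2.2.1, s.2.2.2), p, p)] := rfl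

theorem wire_cons : wire s p (q :: l) =
    ((true, s.1.headD false, s.2.1, s.2.2.1, s.2.2.2), p, q) ::
      wire (s.1.tail, Bool.xor s.2.2.1 (s.1.headD false), s.2.1, !s.2.2.2) q l := rfl

theorem wire_map_fst : (wire s p l).map (fun a => a.2.1) = p :: l := by
  induction l generalizing s p with
  | nil => rfl
  | cons q l ih => rw [wire_cons, List.map_cons, ih]

variable {s p q l}

theorem fst_mem_of_mem_wire {a : Ann V} (h : a ∈ wire s p l) : a.2.1 ∈ p :: l := by
  rw [← wire_map_fst s p l]
  exact List.mem_map_of_mem h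

theorem snd_mem_of_mem_wire {a : Ann V} (h : a ∈ wire s p l) : a.2.2 ∈ p :: l := by
  induction l generalizing s p with
  | nil => simp_all [wire_nil]
  | cons q l ih =>
    rw [wire_cons, List.mem_cons] at h
    rcases h with rfl | h
    · simp
    · exact List.mem_cons_of_mem _ (ih h)

theorem snd_mem_tail_of_mem_wire {a : Ann V} (h : a ∈ wire s p l) (he : a.1.1 = true) :
    a.2.2 ∈ l := by
  induction l generalizing s p with
  | nil => simp_all [wire_nil]
  | cons q l ih =>
    rw [wire_cons, List.mem_cons] at h
    rcases h with rfl | h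
    · simp
    · exact List.mem_cons_of_mem _ (ih h)

theorem rel_of_mem_wire {R : V → V → Prop} (hR : (p :: l).IsChain R) {a : Ann V}
    (h : a ∈ wire s p l) (he : a.1.1 = true) : R a.2.1 a.2.2 := by
  induction l generalizing s p with
  | nil => simp_all [wire_nil]
  | cons q l ih =>
    rw [wire_cons, List.mem_cons] at h
    rw [List.isChain_cons_cons] at hR
    rcases h with rfl | h
    · exact hR.1
    · exact ih hR.2 h

theorem ne_of_mem_wire (hn : (p :: l).Nodup) {a : Ann V} (h : a ∈ wire s p l)
    (he : a.1.1 = true) : a.2.1 ≠ a.2.2 :=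
  rel_of_mem_wire (List.Pairwise.isChain hn) h he

theorem fst_pairwise_wire (hn : (p :: l).Nodup) :
    (wire s p l).Pairwise (fun a b => a.2.1 ≠ b.2.1) := by
  rw [← wire_map_fst s p l] at hn
  exact List.pairwise_map.1 hn

theorem snd_pairwise_wire (hn : (p :: l).Nodup) :
    (wire s p l).Pairwise (fun a b => a.1.1 = true → b.1.1 = true → a.2.2 ≠ b.2.2) := by
  induction l generalizing s p with
  | nil => simp [wire_nil]
  | cons q l ih =>
    rw [wire_cons, List.pairwise_cons]
    rw [List.nodup_cons] at hn
    refine ⟨fun b hb _ he h => ?_, ih hn.2⟩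
    have := snd_mem_tail_of_mem_wire hb he
    rw [← h] at this
    exact (List.nodup_cons.1 hn.2).1 this

theorem mem_tail_of_parity {a : Ann V} (h : a ∈ wire s p l) (he : a.1.1 = true)
    (hw : a.1.2.2.2.2 ≠ s.2.2.2) : a.2.1 ∈ l ∧ a.2.2 ∈ l := by
  cases l with
  | nil => simp_all [wire_nil]
  | cons q l =>
    rw [wire_cons, List.mem_cons] at h
    rcases h with rfl | h
    · simp at hw
    · exact ⟨fst_mem_of_mem_wire h, snd_mem_of_mem_wire h⟩

/-- The exponent w of H flips at every step, so it also records the parity of the position. Distinct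
steps of equal parity are not consecutive and share no qubit, hence all CZ gates of one parity fit
into one timestep. -/
theorem both_pairwise_wire (hn : (p :: l).Nodup) :
    (wire s p l).Pairwise (fun a b => a.1.1 = true → b.1.1 = true →
      a.1.2.2.2.2 = b.1.2.2.2.2 → a.2.1 ≠ b.2.1 ∧ a.2.1 ≠ b.2.2 ∧ a.2.2 ≠ b.2.1 ∧
        a.2.2 ≠ b.2.2) := by
  induction l generalizing s p with
  | nil => simp [wire_nil]
  | cons q l ih =>
    rw [wire_cons, List.pairwise_cons]
    rw [List.nodup_cons] at hn
    refine ⟨fun b hb _ he h => ?_, ih hn.2⟩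
    obtain ⟨h₁, h₂⟩ := mem_tail_of_parity hb he (by rw [← h]; simp)
    have h₃ := (List.nodup_cons.1 hn.2).1
    have h₄ := fun h' => hn.1 (List.mem_cons_of_mem q h')
    refine ⟨?_, ?_, ?_, ?_⟩ <;> rintro e <;> simp_all

end

/-! ### Layers of a wire -/

/-- The ways of applying a basic operation to a step `(p, q)` of a wire. -/
inductive Gen {B : GateSet} (P : Palette B) : Type
  | fst (g : Fin P.k₁)
  | snd (g : Fin P.k₁)
  | both (g : Fin P.k₂)
  | swap (g : Fin P.k₂)
  | measure

/-- The qubits of a step that are acted on. -/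
inductive Foot : Type
  | fst
  | snd
  | both

def Foot.sites {V : Type} [DecidableEq V] : Foot → V → V → Finset V
  | fst, p, _ => {p}
  | snd, _, q => {q}
  | both, p, q => {p, q}

namespace Gen

variable {B : GateSet} {P : Palette B}

def foot : Gen P → Foot
  | fst _ => Foot.fst
  | snd _ => Foot.snd
  | both _ => Foot.both
  | swap _ => Foot.both
  | measure => Foot.fst

def op {n : ℕ} (p q : Qubit n) : Gen P → Op P n
  | fst g => Op.one g p
  | snd g => Op.one g q
  | both g => Op.two g p q
  | swap g => Op.two g q p
  | measure => Op.measure p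

/-- The operator of a basic operation at an annotated step. -/
noncomputable def kraus {V : Type} [DecidableEq V] (a : Ann V) : Gen P → Oper V
  | fst g => one a.2.1 (P.one g : Unitary₁)
  | snd g => one a.2.2 (P.one g : Unitary₁)
  | both g => two a.2.1 a.2.2 (P.two g : Unitary₂)
  | swap g => two a.2.2 a.2.1 (P.two g : Unitary₂)
  | measure => one a.2.1 (proj a.1.2.1)

/-- The matrix of a gate on the two qubits of a step. -/
noncomputable def mat : Gen P → Matrix (Bool × Bool) (Bool × Bool) ℂ
  | fst g => ((P.one g : Unitary₁) : Matrix Bool Bool ℂ) ⊗ₖ (1 : Matrix Bool Bool ℂ)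
  | snd g => (1 : Matrix Bool Bool ℂ) ⊗ₖ ((P.one g : Unitary₁) : Matrix Bool Bool ℂ)
  | both g => ((P.two g : Unitary₂) : Matrix (Bool × Bool) (Bool × Bool) ℂ)
  | swap g => ((P.two g : Unitary₂) : Matrix (Bool × Bool) (Bool × Bool) ℂ).submatrix
      Prod.swap Prod.swap
  | measure => 1

theorem support_op {n : ℕ} (p q : Qubit n) (g : Gen P) :
    (g.op p q).support = g.foot.sites p q := by
  cases g <;> simp [op, Op.support, foot, Foot.sites, Finset.pair_comm]

theorem kraus_mem {V : Type} [DecidableEq V] {a : Ann V} {g : Gen P}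
    (h : g.foot = Foot.both → a.2.1 ≠ a.2.2) :
    g.kraus a ∈ localOps (↑(g.foot.sites a.2.1 a.2.2) : Set V) := by
  cases g with
  | fst g => exact one_mem_localOps (by simp [foot, Foot.sites]) _
  | snd g => exact one_mem_localOps (by simp [foot, Foot.sites]) _
  | both g =>
    exact two_mem_localOps (by simp [foot, Foot.sites]) (by simp [foot, Foot.sites]) (h rfl) _
  | swap g =>
    exact two_mem_localOps (by simp [foot, Foot.sites]) (by simp [foot, Foot.sites]) (h rfl).symm _
  | measure => exact one_mem_localOps (by simp [foot, Foot.sites]) _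

theorem kraus_eq_two {V : Type} [DecidableEq V] {a : Ann V} {g : Gen P} (hg : g ≠ measure)
    (h : a.2.1 ≠ a.2.2) : g.kraus a = two a.2.1 a.2.2 g.mat := by
  cases g with
  | fst g => rw [kraus, mat, two_kronecker h, one_one', mul_one]
  | snd g => rw [kraus, mat, two_kronecker h, one_one', one_mul]
  | both g => rfl
  | swap g => rw [kraus, mat, two_swap h]
  | measure => exact absurd rfl hg

end Gen

/-- The gates of a wire as products of basic gates, up to scalars. -/
structure Compiled {B : GateSet} (P : Palette B) : Type where
  h : List (Fin P.k₁)
  x : List (Fin P.k₁)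
  z : List (Fin P.k₁)
  cz : List (Gen P)
  h_spec : ∃ c : ℂ, tprod (h.map fun g => ((P.one g : Unitary₁) : Matrix Bool Bool ℂ)) = c • hMat
  x_spec : ∃ c : ℂ,
    tprod (x.map fun g => ((P.one g : Unitary₁) : Matrix Bool Bool ℂ)) = c • xPow true
  z_spec : ∃ c : ℂ,
    tprod (z.map fun g => ((P.one g : Unitary₁) : Matrix Bool Bool ℂ)) = c • zPow true
  cz_spec : ∃ c : ℂ, tprod (cz.map Gen.mat) = c • czMat
  cz_ne : ∀ g ∈ cz, g ≠ Gen.measure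

theorem one_tprod {V : Type} [DecidableEq V] (q : V) (l : List (Matrix Bool Bool ℂ)) :
    tprod (l.map (one q)) = one q (tprod l) := by
  induction l with
  | nil => exact (one_one' q).symm
  | cons M l ih => simp only [List.map_cons, tprod, ih, one_mul']

theorem two_tprod {V : Type} [DecidableEq V] {q r : V} (h : q ≠ r)
    (l : List (Matrix (Bool × Bool) (Bool × Bool) ℂ)) :
    tprod (l.map (two q r)) = two q r (tprod l) := by
  induction l with
  | nil => exact (two_one' h).symm
  | cons M l ih => simp only [List.map_cons, tprod, ih, two_mul' h]

/-- A set of operations to be performed at all items that satisfy a predicate. -/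
structure Layer {B : GateSet} (P : Palette B) : Type where
  pred : Flags → Bool
  foot : Foot
  gens : List (Gen P)

namespace Layer

variable {B : GateSet} {P : Palette B}

/-- The operations of the layer can be performed at the same time at all items of a wire. -/
structure Good (L : Layer P) : Prop where
  foot : ∀ g ∈ L.gens, ∀ (V : Type) [DecidableEq V] (p q : V),
    g.foot.sites p q ⊆ L.foot.sites p q
  both_of : ∀ g ∈ L.gens, g.foot = Foot.both → L.foot = Foot.both
  snd : L.foot = Foot.snd → ∀ f, L.pred f = true → f.1 = true
  both : L.foot = Foot.both → ∃ c : Bool, ∀ f, L.pred f = true → f.1 = true ∧ f.2.2.2.2 = c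

/-- The first qubits of all items differ. The second qubits of steps differ, while the end item
would repeat the last of them and is excluded by `snd`. Pairs are disjoint among steps of one
parity, which `both` prescribes. -/
theorem Good.pairwise {L : Layer P} (hL : L.Good) {V : Type} [DecidableEq V] {s : Track} {p : V}
    {l : List V} (hn : (p :: l).Nodup) :
    ((wire s p l).filter fun a => L.pred a.1).Pairwise fun a b =>
      Disjoint (L.foot.sites a.2.1 a.2.2) (L.foot.sites b.2.1 b.2.2) := by
  rw [List.pairwise_filter]
  cases hf : L.foot with
  | fst =>
    refine (fst_pairwise_wire hn).imp fun {a b} h _ _ => ?_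
    simpa [Foot.sites] using h
  | snd =>
    refine (snd_pairwise_wire hn).imp fun {a b} h ha hb => ?_
    have := h (hL.snd hf _ ha) (hL.snd hf _ hb)
    simpa [Foot.sites] using this
  | both =>
    obtain ⟨c, hc⟩ := hL.both hf
    refine (both_pairwise_wire hn).imp fun {a b} h ha hb => ?_
    have := h (hc _ ha).1 (hc _ hb).1 ((hc _ ha).2.trans (hc _ hb).2.symm)
    simp [Foot.sites]
    tauto

theorem Good.kraus_mem {L : Layer P} (hL : L.Good) {V : Type} [DecidableEq V] {s : Track} {p : V}
    {l : List V} (hn : (p :: l).Nodup) {a : Ann V} (ha : a ∈ wire s p l) (hp : L.pred a.1 = true)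
    {g : Gen P} (hg : g ∈ L.gens) :
    g.kraus a ∈ localOps (↑(L.foot.sites a.2.1 a.2.2) : Set V) := by
  refine localOps_mono (by exact_mod_cast hL.foot g hg V _ _) (Gen.kraus_mem fun h => ?_)
  obtain ⟨c, hc⟩ := hL.both (hL.both_of g hg h)
  exact ne_of_mem_wire hn ha (hc _ hp).1

/-- Performing the operations of a layer one after the other, each at all items of a wire. -/
theorem Good.tprod_eq {L : Layer P} (hL : L.Good) {V : Type} [DecidableEq V] {s : Track} {p : V}
    {l : List V} (hn : (p :: l).Nodup) {c : ℂ} {G : Ann V → Oper V}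
    (hG : ∀ a ∈ wire s p l, L.pred a.1 = true →
      tprod (L.gens.map fun g => g.kraus a) = c • G a) :
    ∃ c' : ℂ, tprod (L.gens.map fun g =>
        tprod (((wire s p l).filter fun a => L.pred a.1).map fun a => g.kraus a)) =
      c' • tprod (((wire s p l).filter fun a => L.pred a.1).map G) := by
  refine ⟨c ^ ((wire s p l).filter fun a => L.pred a.1).length, ?_⟩
  -- Operations at different items have disjoint footprints, so "each gate at all items" may be
  -- reordered into "the whole gate word at each item".
  rw [tprod_comm L.gens (F := fun g a => g.kraus a)]
  rotate_left
  · refine List.Pairwise.imp_of_mem ?_ (hL.pairwise hn)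
    intro a b ha hb h g hg g' hg'
    rw [List.mem_filter] at ha hb
    exact localOps_commute (by exact_mod_cast h) (hL.kraus_mem hn ha.1 ha.2 hg)
      (hL.kraus_mem hn hb.1 hb.2 hg')
  · rw [← tprod_smul]
    congr 1
    refine List.map_congr_left fun a ha => ?_
    rw [List.mem_filter] at ha
    exact hG a ha.1 ha.2

end Layer

end CCNTC

namespace CCNTC

/-! ### The operator of a single wire -/

section Ideal

variable {V : Type}

/-- The operators `G a` for all items `a` of a wire that satisfy a predicate. -/
def ideal (pred : Flags → Bool) (G : Ann V → Oper V) (s : Track) (p : V) (l : List V) : Oper V :=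
  tprod (((wire s p l).filter fun a => pred a.1).map G)

variable (pred : Flags → Bool) (G : Ann V → Oper V) (o u v w : Bool) (β : List Bool) (p q : V)
  (l : List V)

theorem ideal_nil (s : Track) : ideal pred G s p [] =
    if pred (false, s.1.headD false, s.2.1, s.2.2.1, s.2.2.2) then
      G ((false, s.1.headD false, s.2.1, s.2.2.1, s.2.2.2), p, p) else 1 := by
  rw [ideal, wire_nil, List.filter_cons]
  split_ifs <;> simp [tprod]

theorem ideal_cons (s : Track) : ideal pred G s p (q :: l) =
    ideal pred G (s.1.tail, Bool.xor s.2.2.1 (s.1.headD false), s.2.1, !s.2.2.2) q l *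
    if pred (true, s.1.headD false, s.2.1, s.2.2.1, s.2.2.2) then
      G ((true, s.1.headD false, s.2.1, s.2.2.1, s.2.2.2), p, q) else 1 := by
  rw [ideal, wire_cons, List.filter_cons]
  split_ifs <;> simp [tprod, ideal]

variable {pred G p l}

theorem ideal_mem [DecidableEq V] {S : Set V} {s : Track}
    (h : ∀ a ∈ wire s p l, pred a.1 = true → G a ∈ localOps S) :
    ideal pred G s p l ∈ localOps S := by
  refine tprod_mem fun K hK => ?_
  obtain ⟨a, ha, rfl⟩ := List.mem_map.1 hK
  rw [List.mem_filter] at ha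
  exact h a ha.1 ha.2

end Ideal

namespace Compiled

variable {B : GateSet} {P : Palette B} (W : Compiled P)

/-- The layers of a wire before the measurement. -/
def before : List (Layer P) :=
  [⟨fun f => f.1, Foot.snd, W.h.map Gen.snd⟩,
   ⟨fun f => f.1 && !f.2.2.2.2, Foot.both, W.cz⟩,
   ⟨fun f => f.1 && f.2.2.2.2, Foot.both, W.cz⟩,
   ⟨fun f => f.1, Foot.fst, W.h.map Gen.fst⟩]

/-- The measurement of a wire. -/
def measuring (P : Palette B) : Layer P := ⟨fun f => f.1, Foot.fst, [Gen.measure]⟩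

/-- The layers of a wire after the measurement. -/
def after : List (Layer P) :=
  [⟨fun f => f.1 && f.2.1, Foot.fst, W.x.map Gen.fst⟩,
   ⟨fun f => !f.1 && f.2.2.1, Foot.fst, W.x.map Gen.fst⟩,
   ⟨fun f => !f.1 && f.2.2.2.1, Foot.fst, W.z.map Gen.fst⟩,
   ⟨fun f => !f.1 && f.2.2.2.2, Foot.fst, W.h.map Gen.fst⟩]

/-- All layers of a wire. -/
def layers : List (Layer P) := W.before ++ measuring P :: W.after

theorem good_fst (pred : Flags → Bool) (l : List (Fin P.k₁)) :
    (⟨pred, Foot.fst, l.map Gen.fst⟩ : Layer P).Good where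
  foot g hg V _ p q := by
    obtain ⟨i, _, rfl⟩ := List.mem_map.1 hg
    exact subset_rfl
  both_of g hg h := by
    obtain ⟨i, _, rfl⟩ := List.mem_map.1 hg
    simp [Gen.foot] at h
  snd h := by simp at h
  both h := by simp at h

theorem good_snd {pred : Flags → Bool} (hp : ∀ f, pred f = true → f.1 = true)
    (l : List (Fin P.k₁)) : (⟨pred, Foot.snd, l.map Gen.snd⟩ : Layer P).Good where
  foot g hg V _ p q := by
    obtain ⟨i, _, rfl⟩ := List.mem_map.1 hg
    exact subset_rfl
  both_of g hg h := by
    obtain ⟨i, _, rfl⟩ := List.mem_map.1 hg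
    simp [Gen.foot] at h
  snd _ := hp
  both h := by simp at h

theorem good_both {pred : Flags → Bool} {c : Bool}
    (hp : ∀ f, pred f = true → f.1 = true ∧ f.2.2.2.2 = c) (l : List (Gen P)) :
    (⟨pred, Foot.both, l⟩ : Layer P).Good where
  foot g hg V _ p q := by
    cases g <;> simp [Gen.foot, Foot.sites]
  both_of g hg h := rfl
  snd h := by simp at h
  both h := ⟨c, hp⟩

theorem good_measuring : (measuring P).Good where
  foot g hg V _ p q := by
    rw [measuring, List.mem_singleton] at hg
    subst hg
    exact subset_rfl
  both_of g hg h := by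
    rw [measuring, List.mem_singleton] at hg
    subst hg
    simp [Gen.foot] at h
  snd h := by simp [measuring] at h
  both h := by simp [measuring] at h

theorem good_of_mem {L : Layer P} (h : L ∈ W.layers) : L.Good := by
  simp only [layers, before, after, List.mem_append, List.mem_cons, List.not_mem_nil,
    or_false] at h
  rcases h with (rfl | rfl | rfl | rfl) | rfl | rfl | rfl | rfl | rfl
  · exact good_snd (fun f h => h) _
  · exact good_both (c := false) (fun f h => by simpa using h) _
  · exact good_both (c := true) (fun f h => by simpa using h) _
  · exact good_fst _ _
  · exact good_measuring
  all_goals exact good_fst _ _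

/-- The timesteps of a wire: an operation, and the items at which it is performed. -/
def rounds (L : List (Layer P)) : List ((Flags → Bool) × Gen P) :=
  L.flatMap fun L => L.gens.map fun g => (L.pred, g)

section Op

variable {V : Type} [DecidableEq V]

/-- The operator of a wire. -/
noncomputable def wireOp (s : Track) (p : V) (l : List V) : Oper V :=
  tprod ((rounds W.layers).map fun r =>
    tprod (((wire s p l).filter fun a => r.1 a.1).map fun a => r.2.kraus a))

/-- The operator of a wire without its corrections, for ideal gates. -/
noncomputable def body (s : Track) (p : V) (l : List V) : Oper V :=
  ideal (fun f => f.1 && f.2.1) (fun a => one a.2.1 (xPow true)) s p l *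
  (ideal (fun f => f.1) (fun a => one a.2.1 (proj a.1.2.1)) s p l *
  (ideal (fun f => f.1) (fun a => one a.2.1 hMat) s p l *
  (ideal (fun f => f.1 && f.2.2.2.2) (fun a => two a.2.1 a.2.2 czMat) s p l *
  (ideal (fun f => f.1 && !f.2.2.2.2) (fun a => two a.2.1 a.2.2 czMat) s p l *
  ideal (fun f => f.1) (fun a => one a.2.2 hMat) s p l))))

/-- The corrections at the end of a wire, for ideal gates. -/
noncomputable def corrections (s : Track) (p : V) (l : List V) : Oper V :=
  ideal (fun f => !f.1 && f.2.2.2.2) (fun a => one a.2.1 hMat) s p l *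
  (ideal (fun f => !f.1 && f.2.2.2.1) (fun a => one a.2.1 (zPow true)) s p l *
  ideal (fun f => !f.1 && f.2.2.1) (fun a => one a.2.1 (xPow true)) s p l)

/-- Layer by layer, `Good.tprod_eq` completes the gate word at each item and replaces it by the
ideal gate. Each of the eight gate layers contributes a scalar; the measurement is already ideal. -/
theorem wireOp_eq (s : Track) {p : V} {l : List V} (hn : (p :: l).Nodup) :
    ∃ c : ℂ, W.wireOp s p l = c • (corrections s p l * body s p l) := by
  have h₀ : W.wireOp s p l = tprod (W.layers.map fun L => tprod (L.gens.map fun g =>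
      tprod (((wire s p l).filter fun a => L.pred a.1).map fun a => g.kraus a))) := by
    rw [wireOp, rounds, List.map_flatMap, tprod_flatMap]
    simp only [List.map_map, Function.comp_def]
  obtain ⟨ch, hh⟩ := W.h_spec
  obtain ⟨cx, hx⟩ := W.x_spec
  obtain ⟨cz, hz⟩ := W.z_spec
  obtain ⟨cc, hc⟩ := W.cz_spec
  have hfst : ∀ (k : List (Fin P.k₁)) (c : ℂ) (M : Matrix Bool Bool ℂ),
      tprod (k.map fun g => ((P.one g : Unitary₁) : Matrix Bool Bool ℂ)) = c • M →
      ∀ a : Ann V, tprod ((k.map Gen.fst).map fun g : Gen P => g.kraus a) = c • one a.2.1 M := by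
    intro k c M h a
    rw [← one_smul', ← h, ← one_tprod, List.map_map, List.map_map]
    rfl
  have hsnd : ∀ (k : List (Fin P.k₁)) (c : ℂ) (M : Matrix Bool Bool ℂ),
      tprod (k.map fun g => ((P.one g : Unitary₁) : Matrix Bool Bool ℂ)) = c • M →
      ∀ a : Ann V, tprod ((k.map Gen.snd).map fun g : Gen P => g.kraus a) = c • one a.2.2 M := by
    intro k c M h a
    rw [← one_smul', ← h, ← one_tprod, List.map_map, List.map_map]
    rfl
  have hcz : ∀ a ∈ wire s p l, a.1.1 = true →
      tprod (W.cz.map fun g => g.kraus a) = cc • two a.2.1 a.2.2 czMat := by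
    intro a ha he
    have hne := ne_of_mem_wire hn ha he
    rw [← two_smul', ← hc, ← two_tprod hne, List.map_map]
    exact congrArg tprod (List.map_congr_left fun g hg => Gen.kraus_eq_two (W.cz_ne g hg) hne)
  have hg : ∀ L ∈ W.layers, L.Good := fun L => W.good_of_mem
  simp only [layers, before, after, List.cons_append, List.nil_append, List.forall_mem_cons] at hg
  obtain ⟨g₁, g₂, g₃, g₄, g₅, g₆, g₇, g₈, g₉, -⟩ := hg
  obtain ⟨c₁, e₁⟩ := g₁.tprod_eq hn (s := s) fun a _ _ => hsnd _ _ _ hh a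
  obtain ⟨c₂, e₂⟩ := g₂.tprod_eq hn (s := s) fun a ha hp => hcz a ha (by simp_all)
  obtain ⟨c₃, e₃⟩ := g₃.tprod_eq hn (s := s) fun a ha hp => hcz a ha (by simp_all)
  obtain ⟨c₄, e₄⟩ := g₄.tprod_eq hn (s := s) fun a _ _ => hfst _ _ _ hh a
  obtain ⟨c₆, e₆⟩ := g₆.tprod_eq hn (s := s) fun a _ _ => hfst _ _ _ hx a
  obtain ⟨c₇, e₇⟩ := g₇.tprod_eq hn (s := s) fun a _ _ => hfst _ _ _ hx a
  obtain ⟨c₈, e₈⟩ := g₈.tprod_eq hn (s := s) fun a _ _ => hfst _ _ _ hz a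
  obtain ⟨c₉, e₉⟩ := g₉.tprod_eq hn (s := s) fun a _ _ => hfst _ _ _ hh a
  refine ⟨c₉ * c₈ * c₇ * c₆ * c₄ * c₃ * c₂ * c₁, ?_⟩
  rw [h₀]
  simp only [layers, before, after, measuring, List.cons_append, List.nil_append, List.map_cons,
    List.map_nil, tprod, one_mul] at e₁ e₂ e₃ e₄ e₆ e₇ e₈ e₉ ⊢
  rw [e₁, e₂, e₃, e₄, e₆, e₇, e₈, e₉]
  simp only [corrections, body, ideal, smul_mul_assoc, mul_smul_comm, smul_smul, Gen.kraus,
    mul_assoc]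
  congr 1
  ring

theorem corrections_nil (s : Track) (p : V) :
    corrections s p [] = one p (hPow s.2.2.2 * zPow s.2.2.1 * xPow s.2.1) := by
  obtain ⟨β, u, v, w⟩ := s
  have hx : xPow false = 1 := by
    ext a b; cases a <;> cases b <;> simp [xPow]
  have hz : zPow false = 1 := by
    ext a b; cases a <;> cases b <;> simp [zPow, sign]
  cases u <;> cases v <;> cases w <;>
    simp [corrections, ideal_nil, hPow, hx, hz, one_mul', one_one', mul_assoc]

theorem corrections_cons (s : Track) (p q : V) (l : List V) : corrections s p (q :: l) =
    corrections (s.1.tail, Bool.xor s.2.2.1 (s.1.headD false), s.2.1, !s.2.2.2) q l := by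
  simp [corrections, ideal_cons]

theorem body_nil (s : Track) (p : V) : body s p [] = 1 := by
  simp [body, ideal_nil]

/-- Each of the six layers performs its share `aᵢ` of the first cell and then its share `bᵢ` of the
rest. To perform all of the first cell beforehand, `aᵢ` only has to pass the `bⱼ` with j < i. -/
theorem interleave {M : Type*} [Monoid M] {a₁ a₂ a₃ a₄ a₅ a₆ b₁ b₂ b₃ b₄ b₅ b₆ : M}
    (h₂ : Commute a₂ b₁) (h₃ : ∀ b ∈ [b₁, b₂], Commute a₃ b) (h₄ : ∀ b ∈ [b₁, b₂, b₃], Commute a₄ b)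
    (h₅ : ∀ b ∈ [b₁, b₂, b₃, b₄], Commute a₅ b) (h₆ : ∀ b ∈ [b₁, b₂, b₃, b₄, b₅], Commute a₆ b) :
    b₆ * a₆ * (b₅ * a₅ * (b₄ * a₄ * (b₃ * a₃ * (b₂ * a₂ * (b₁ * a₁))))) =
      b₆ * (b₅ * (b₄ * (b₃ * (b₂ * b₁)))) * (a₆ * (a₅ * (a₄ * (a₃ * (a₂ * a₁))))) := by
  have key : ∀ {c' c d' d : M}, Commute c d' → c' * c * (d' * d) = c' * d' * (c * d) := by
    intro c' c d' d h
    rw [mul_assoc, ← mul_assoc c, h.eq, mul_assoc, mul_assoc]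
  simp only [List.forall_mem_cons, List.not_mem_nil, false_implies, implies_true, and_true]
    at h₃ h₄ h₅ h₆
  rw [key h₂, key (h₃.2.mul_right h₃.1), key (h₄.2.2.mul_right (h₄.2.1.mul_right h₄.1)),
    key (h₅.2.2.2.mul_right (h₅.2.2.1.mul_right (h₅.2.1.mul_right h₅.1))),
    key (h₆.2.2.2.2.mul_right (h₆.2.2.2.1.mul_right (h₆.2.2.1.mul_right
      (h₆.2.1.mul_right h₆.1))))]

/-- The layered body acts as if the first cell were completed before the rest starts. Its CZ
commutes with the initial Hadamard gates and the CZ gates of the rest; its later operations act on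
`p` alone, which the rest never touches. -/
theorem body_cons (s : Track) {p q : V} {l : List V} (hn : (p :: q :: l).Nodup) :
    body s p (q :: l) =
      body (s.1.tail, Bool.xor s.2.2.1 (s.1.headD false), s.2.1, !s.2.2.2) q l *
      cell (s.1.headD false) p q := by
  obtain ⟨β, u, v, w⟩ := s
  set o := β.headD false
  set s' : Track := (β.tail, Bool.xor v o, u, !w) with hs'
  have hn' := (List.nodup_cons.1 hn).2
  have hpq : p ≠ q := fun h => (List.nodup_cons.1 hn).1 (by simp [h])
  let S : Set V := {r | r ∈ q :: l}
  have hone : ∀ (pred : Flags → Bool) (M : Flags → Matrix Bool Bool ℂ),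
      ideal pred (fun a => one a.2.1 (M a.1)) s' q l ∈ localOps S :=
    fun pred M => ideal_mem fun a ha _ =>
      one_mem_localOps (show a.2.1 ∈ S from fst_mem_of_mem_wire ha) _
  have htwo : ∀ (pred : Flags → Bool), (∀ f, pred f = true → f.1 = true) →
      ideal pred (fun a => two a.2.1 a.2.2 czMat) s' q l ∈ localOps S :=
    fun pred hp => ideal_mem fun a ha h => two_mem_localOps
      (show a.2.1 ∈ S from fst_mem_of_mem_wire ha)
      (show a.2.2 ∈ S from snd_mem_of_mem_wire ha) (ne_of_mem_wire hn' ha (hp _ h)) _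
  -- The initial Hadamard gates of the rest act on `l` and not on `q`; only therefore can the CZ on
  -- `p` and `q` pass them.
  have hsnd : ideal (fun f => f.1) (fun a => one a.2.2 hMat) s' q l ∈
      localOps {r | r ∈ l} :=
    ideal_mem fun a ha h => one_mem_localOps
      (show a.2.2 ∈ {r | r ∈ l} from snd_mem_tail_of_mem_wire ha h) _
  have hsnd' : ideal (fun f => f.1) (fun a => one a.2.2 hMat) s' q l ∈ localOps S :=
    localOps_mono (fun r hr => List.mem_cons_of_mem q hr) hsnd
  have hp : ∀ {K L : Oper V}, K ∈ localOps ({p} : Set V) → L ∈ localOps S → Commute K L :=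
    fun hK hL => localOps_commute (show Disjoint {p} S from
      Set.disjoint_singleton_left.2 (List.nodup_cons.1 hn).1) hK hL
  have h₁ : ∀ M, one p M ∈ localOps ({p} : Set V) := fun M => one_mem_localOps (Set.mem_singleton p) M
  have hif : ∀ (b : Prop) [Decidable b] (K : Oper V), K ∈ localOps ({p} : Set V) →
      (if b then K else 1) ∈ localOps ({p} : Set V) := fun b _ K hK => by
    split_ifs
    exacts [hK, one_mem _]
  have hc₁ : ∀ b : Bool, Commute (if b = true then two p q czMat else 1)
      (ideal (fun f => f.1) (fun a => one a.2.2 hMat) s' q l) := fun b => by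
    split_ifs
    · refine localOps_commute (S := {p, q}) ?_ (two_mem_localOps (by simp) (by simp) hpq _) hsnd
      rw [Set.disjoint_left]
      rintro r (rfl | rfl) hr
      · exact (List.nodup_cons.1 hn).1 (List.mem_cons_of_mem _ hr)
      · exact (List.nodup_cons.1 hn').1 hr
    · exact Commute.one_left _
  have hc₂ : ∀ (b : Bool) (pred : Flags → Bool),
      Commute (if b = true then two p q czMat else 1)
      (ideal pred (fun a => two a.2.1 a.2.2 czMat) s' q l) := fun b pred => by
    split_ifs
    · refine tprod_commute fun K hK => ?_
      obtain ⟨a, -, rfl⟩ := List.mem_map.1 hK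
      exact two_czMat_commute _ _ _ _
    · exact Commute.one_left _
  have hx : (if o = true then one p (xPow true) else 1) = one p (xPow o) := by
    cases o
    · rw [show xPow false = 1 by ext a b; cases a <;> cases b <;> simp [xPow]]
      simp [one_one']
    · rfl
  -- Exactly one of the two parity layers contains the first edge.
  have hz : (if w = true then two p q czMat else 1) * (if (!w) = true then two p q czMat else 1) =
      two p q czMat := by
    cases w <;> simp
  have t₁ : ∀ f : Flags, (f.1 && f.2.2.2.2) = true → f.1 = true := fun f h => by simp_all
  have t₂ : ∀ f : Flags, (f.1 && !f.2.2.2.2) = true → f.1 = true := fun f h => by simp_all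
  have hall : ∀ K ∈ [ideal (fun f => f.1) (fun a => one a.2.2 hMat) s' q l,
      ideal (fun f => f.1 && !f.2.2.2.2) (fun a => two a.2.1 a.2.2 czMat) s' q l,
      ideal (fun f => f.1 && f.2.2.2.2) (fun a => two a.2.1 a.2.2 czMat) s' q l,
      ideal (fun f => f.1) (fun a => one a.2.1 hMat) s' q l,
      ideal (fun f => f.1) (fun a => one a.2.1 (proj a.1.2.1)) s' q l], K ∈ localOps S := by
    simp only [List.forall_mem_cons]
    exact ⟨hsnd', htwo _ t₂, htwo _ t₁, hone (fun f => f.1) (fun _ => hMat),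
      hone (fun f => f.1) (fun f => proj f.2.1), by simp⟩
  simp only [List.forall_mem_cons, List.not_mem_nil, false_implies, implies_true, and_true] at hall
  obtain ⟨i₁, i₂, i₃, i₄, i₅⟩ := hall
  have e : cell o p q = (if o = true then one p (xPow true) else 1) * (one p (proj o) *
      (one p hMat * ((if w = true then two p q czMat else 1) *
      ((if (!w) = true then two p q czMat else 1) * one q hMat)))) := by
    rw [hx, ← mul_assoc (if w = true then _ else _), hz, cell]
  rw [e]
  simp only [body, ideal_cons, Bool.true_and, if_true]
  refine interleave (hc₁ _) ?_ ?_ ?_ ?_ <;>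
    simp only [List.forall_mem_cons, List.not_mem_nil, false_implies, implies_true, and_true]
  · exact ⟨hc₁ _, hc₂ _ _⟩
  · exact ⟨hp (h₁ _) i₁, hp (h₁ _) i₂, hp (h₁ _) i₃⟩
  · exact ⟨hp (h₁ _) i₁, hp (h₁ _) i₂, hp (h₁ _) i₃, hp (h₁ _) i₄⟩
  · have := hif (o = true) _ (h₁ (xPow true))
    exact ⟨hp this i₁, hp this i₂, hp this i₃, hp this i₄, hp this i₅⟩

/-- A wire moves the contents of its first qubit to its last one, for ideal gates. -/
theorem ideal_std {J : Type} [DecidableEq J] (l : List V) (s : Track) (pos : J → V)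
    (hpos : Function.Injective pos) (j : J) (hn : (pos j :: l).Nodup)
    (hl : ∀ q ∈ l, q ∉ Set.range pos) : ∃ c : ℂ, ∀ φ : State J,
      (corrections s (pos j) l * body s (pos j) l)
        (std pos (one j (frame s.2.1 s.2.2.1 s.2.2.2) φ)) =
      c • std (Function.update pos j (l.getLastD (pos j))) φ := by
  -- Invariant: the datum at `pos j` carries the frame recorded in `s`. A cell moves the datum and
  -- updates the frame; at the end of the wire the corrections are the inverse of the frame.
  induction l generalizing s pos with
  | nil =>
    refine ⟨1, fun φ => ?_⟩
    rw [corrections_nil, body_nil, mul_one, one_std hpos, ← Module.End.mul_apply, ← one_mul',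
      corrections_mul_frame, one_one']
    simp
  | cons q l ih =>
    have hq : q ∉ Set.range pos := hl q (by simp)
    have hn' := (List.nodup_cons.1 hn).2
    have hinj : Function.Injective (Function.update pos j q) := by
      intro a b hab
      by_cases ha : a = j <;> by_cases hb : b = j
      · rw [ha, hb]
      · subst ha
        rw [Function.update_self, Function.update_of_ne hb] at hab
        exact absurd ⟨b, hab.symm⟩ hq
      · subst hb
        rw [Function.update_self, Function.update_of_ne ha] at hab
        exact absurd ⟨a, hab⟩ hq
      · rw [Function.update_of_ne ha, Function.update_of_ne hb] at hab
        exact hpos hab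
    have hl' : ∀ r ∈ l, r ∉ Set.range (Function.update pos j q) := by
      rintro r hr ⟨a, ha⟩
      by_cases haj : a = j
      · subst haj
        rw [Function.update_self] at ha
        exact (List.nodup_cons.1 hn').1 (ha ▸ hr)
      · rw [Function.update_of_ne haj] at ha
        exact hl r (by simp [hr]) ⟨a, ha⟩
    obtain ⟨c, hc⟩ := ih
      (s.1.tail, Bool.xor s.2.2.1 (s.1.headD false), s.2.1, !s.2.2.2)
      (Function.update pos j q) hinj (by rwa [Function.update_self]) hl'
    refine ⟨invSqrtTwo * (sign (s.2.1 && s.2.2.1) * c), fun φ => ?_⟩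
    have := hc φ
    rw [Function.update_self, Function.update_idem] at this
    rw [corrections_cons, body_cons s hn, ← mul_assoc, Module.End.mul_apply, cell_std hpos j hq,
      ← Module.End.mul_apply, ← one_mul', hMat_mul_zPow_mul_frame, one_smul', LinearMap.smul_apply,
      std_smul, map_smul, map_smul, List.getLastD_cons]
    dsimp only at this
    rw [this, smul_smul, smul_smul, mul_assoc]

end Op

end Compiled

end CCNTC

namespace CCNTC

/-! ### Many wires at the same time -/

section Paths

variable {V : Type}

/-- The items of several wires, each given by its first qubit and the remaining ones. -/
def pathItems (paths : List (V × List V)) : List (Item V) :=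
  paths.flatMap fun x => wireItems x.1 x.2

/-- The initial track of a wire. -/
def start (β : List Bool) : Track := (β, false, false, false)

/-- The distribution of measurement outcomes to several wires. -/
def deal : List Bool → List (V × List V) → List (List Bool × V × List V)
  | _, [] => []
  | β, x :: l => (β, x) :: deal (β.drop x.2.length) l

theorem deal_map_snd (β : List Bool) (l : List (V × List V)) :
    (deal β l).map Prod.snd = l := by
  induction l generalizing β with
  | nil => rfl
  | cons x l ih => rw [deal, List.map_cons, ih]

theorem foldl_next_wireItems (s : Track) (p : V) (l : List V) :
    (wireItems p l).foldl Track.next s = start (s.1.drop l.length) := by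
  induction l generalizing s p with
  | nil => rfl
  | cons q l ih => rw [wireItems, List.foldl_cons, ih]; simp [Track.next]

theorem annotate_pathItems (β : List Bool) (l : List (V × List V)) :
    annotate (start β) (pathItems l) =
      (deal β l).flatMap fun x => wire (start x.1) x.2.1 x.2.2 := by
  induction l generalizing β with
  | nil => rfl
  | cons x l ih =>
    rw [pathItems, List.flatMap_cons, annotate, scan_append, foldl_next_wireItems, deal,
      List.flatMap_cons, ← ih]
    rfl

end Paths

namespace Compiled

variable {B : GateSet} {P : Palette B} (W : Compiled P)

theorem mem_rounds {L : List (Layer P)} {r : (Flags → Bool) × Gen P} :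
    r ∈ rounds L ↔ ∃ l ∈ L, r.2 ∈ l.gens ∧ r.1 = l.pred := by
  obtain ⟨r₁, r₂⟩ := r
  simp only [rounds, List.mem_flatMap, List.mem_map, Prod.mk.injEq]
  constructor
  · rintro ⟨l, hl, g, hg, rfl, rfl⟩
    exact ⟨l, hl, hg, rfl⟩
  · rintro ⟨l, hl, hg, rfl⟩
    exact ⟨l, hl, _, hg, rfl, rfl⟩

theorem sites_subset {V : Type} [DecidableEq V] {s : Track} {p : V} {l : List V} {a : Ann V}
    (ha : a ∈ wire s p l) (f : Foot) :
    ∀ r ∈ f.sites a.2.1 a.2.2, r ∈ p :: l := by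
  have h₁ := fst_mem_of_mem_wire ha
  have h₂ := snd_mem_of_mem_wire ha
  cases f <;> simp only [Foot.sites, Finset.mem_singleton, Finset.mem_insert] <;>
    rintro r hr <;> aesop

theorem getLastD_mem {V : Type} (p : V) (l : List V) : l.getLastD p ∈ p :: l := by
  rw [List.getLastD_eq_getLast?]
  cases h : l.getLast? with
  | none => simp
  | some q => exact List.mem_cons_of_mem _ (List.mem_of_getLast? h)

section Op

variable {V : Type} [DecidableEq V]

theorem kraus_mem_path {s : Track} {p : V} {l : List V} (hn : (p :: l).Nodup) {a : Ann V}
    (ha : a ∈ wire s p l) {r : (Flags → Bool) × Gen P} (hr : r ∈ rounds W.layers)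
    (hp : r.1 a.1 = true) : r.2.kraus a ∈ localOps {q | q ∈ p :: l} := by
  obtain ⟨L, hL, hg, he⟩ := mem_rounds.1 hr
  rw [he] at hp
  exact localOps_mono (fun q hq => sites_subset ha L.foot q hq)
    ((W.good_of_mem hL).kraus_mem hn ha hp hg)

/-- Performing the timesteps of several disjoint wires at the same time. -/
theorem tprod_rounds (β : List Bool) {paths : List (V × List V)}
    (hn : ∀ x ∈ paths, (x.1 :: x.2).Nodup)
    (hd : paths.Pairwise fun x y => List.Disjoint (x.1 :: x.2) (y.1 :: y.2)) :
    tprod ((rounds W.layers).map fun r => tprod (((annotate (start β) (pathItems paths)).filter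
      fun a => r.1 a.1).map fun a => r.2.kraus a)) =
    tprod ((deal β paths).map fun x => W.wireOp (start x.1) x.2.1 x.2.2) := by
  have h₁ : ∀ r : (Flags → Bool) × Gen P,
      tprod (((annotate (start β) (pathItems paths)).filter
        fun a => r.1 a.1).map fun a => (r.2.kraus a : Oper V)) =
      tprod ((deal β paths).map fun x =>
        tprod (((wire (start x.1) x.2.1 x.2.2).filter fun a => r.1 a.1).map
          fun a => r.2.kraus a)) := by
    intro r
    rw [annotate_pathItems, List.filter_flatMap, List.map_flatMap, tprod_flatMap]
  simp only [h₁]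
  refine tprod_comm _ ?_
  have hn' : ∀ x ∈ deal β paths, (x.2.1 :: x.2.2).Nodup := fun x hx =>
    hn x.2 (deal_map_snd β paths ▸ List.mem_map_of_mem hx)
  rw [← deal_map_snd β paths, List.pairwise_map] at hd
  refine hd.imp_of_mem fun {x y} hx hy hxy r hr r' hr' => ?_
  have hmem : ∀ z ∈ deal β paths, ∀ r ∈ rounds W.layers,
      tprod (((wire (start z.1) z.2.1 z.2.2).filter fun a => r.1 a.1).map
        fun a => (r.2.kraus a : Oper V)) ∈ localOps {q | q ∈ z.2.1 :: z.2.2} := by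
    intro z hz r hr
    refine tprod_mem fun K hK => ?_
    obtain ⟨a, ha, rfl⟩ := List.mem_map.1 hK
    rw [List.mem_filter] at ha
    exact W.kraus_mem_path (hn' z hz) ha.1 hr ha.2
  exact localOps_commute (Set.disjoint_left.2 fun q h h' => hxy h h')
    (hmem x hx r hr) (hmem y hy r' hr')

theorem wireOp_std {J : Type} [DecidableEq J] (l : List V) (β : List Bool) (pos : J → V)
    (hpos : Function.Injective pos) (j : J) (hn : (pos j :: l).Nodup)
    (hl : ∀ q ∈ l, q ∉ Set.range pos) : ∃ c : ℂ, ∀ φ : State J,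
      W.wireOp (start β) (pos j) l (std pos φ) =
      c • std (Function.update pos j (l.getLastD (pos j))) φ := by
  obtain ⟨c, hc⟩ := W.wireOp_eq (start β) hn
  obtain ⟨d, hd⟩ := ideal_std l (start β) pos hpos j hn hl
  refine ⟨c * d, fun φ => ?_⟩
  have h₁ : frame (start β).2.1 (start β).2.2.1 (start β).2.2.2 = 1 := by
    have := corrections_mul_frame false false false
    have h₂ : frame false false false = xPow false * zPow false * hPow false := rfl
    have hx : xPow false = 1 := by
      ext a b; cases a <;> cases b <;> simp [xPow]
    have hz : zPow false = 1 := by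
      ext a b; cases a <;> cases b <;> simp [zPow, sign]
    change frame false false false = 1
    rw [h₂, hx, hz]
    simp [hPow]
  have := hd φ
  rw [h₁, one_one', Module.End.one_apply] at this
  rw [hc, LinearMap.smul_apply, this, smul_smul]

/-- Several disjoint wires move the data qubits to their ends. -/
theorem tprod_wireOp_std {J : Type} [DecidableEq J] (tail : J → List V) (src : J → V)
    (js : List J) (hjs : js.Nodup) (pos : J → V) (hpos : Function.Injective pos)
    (hsrc : ∀ j ∈ js, pos j = src j)
    (hn : ∀ j ∈ js, (src j :: tail j).Nodup)
    (hi : ∀ j ∈ js, ∀ i, i ≠ j → pos i ∉ src j :: tail j)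
    (hd : ∀ i ∈ js, ∀ j ∈ js, i ≠ j → List.Disjoint (src i :: tail i) (src j :: tail j))
    (xs : List (List Bool × V × List V))
    (hxs : xs.map Prod.snd = js.map fun j => (src j, tail j)) :
    ∃ c : ℂ, ∀ φ : State J,
      tprod (xs.map fun x => W.wireOp (start x.1) x.2.1 x.2.2) (std pos φ) =
      c • std (fun j => if j ∈ js then (tail j).getLastD (src j) else pos j) φ := by
  -- The wires are handled one after the other. `hi` keeps the other data qubits off the current
  -- path, and `hd` keeps those that have already arrived off the later paths.
  induction js generalizing pos xs with
  | nil =>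
    rw [List.map_nil, List.map_eq_nil_iff] at hxs
    subst hxs
    exact ⟨1, fun φ => by simp [tprod]⟩
  | cons j js ih =>
    obtain ⟨x, xs, rfl⟩ : ∃ y ys, xs = y :: ys := by
      cases xs with
      | nil => simp at hxs
      | cons y ys => exact ⟨y, ys, rfl⟩
    simp only [List.map_cons, List.cons.injEq] at hxs
    obtain ⟨hx, hxs⟩ := hxs
    obtain ⟨β, p, l⟩ := x
    simp only [Prod.mk.injEq] at hx
    obtain ⟨rfl, rfl⟩ := hx
    rw [List.nodup_cons] at hjs
    have hj := hsrc j (by simp)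
    have hmem : j ∈ j :: js := by simp
    have hlast := getLastD_mem (src j) (tail j)
    have hne : ∀ i ∈ js, i ≠ j := fun i hi h => hjs.1 (h ▸ hi)
    have hinj : Function.Injective (Function.update pos j ((tail j).getLastD (src j))) := by
      intro a b hab
      by_cases ha : a = j <;> by_cases hb : b = j
      · rw [ha, hb]
      · subst ha
        rw [Function.update_self, Function.update_of_ne hb] at hab
        exact absurd (hab ▸ hlast) (hi _ hmem b hb)
      · subst hb
        rw [Function.update_self, Function.update_of_ne ha] at hab
        exact absurd (hab ▸ hlast) (hi _ hmem a ha)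
      · rw [Function.update_of_ne ha, Function.update_of_ne hb] at hab
        exact hpos hab
    obtain ⟨c, hc⟩ := W.wireOp_std (tail j) β pos hpos j (hj ▸ hn j hmem) (by
      rintro q hq ⟨i, rfl⟩
      by_cases hij : i = j
      · subst hij
        exact (List.nodup_cons.1 (hj ▸ hn i hmem)).1 hq
      · exact hi j hmem i hij (List.mem_cons_of_mem _ hq))
    obtain ⟨d, hd'⟩ := ih hjs.2 (Function.update pos j ((tail j).getLastD (src j))) hinj
      (fun i hi' => by rw [Function.update_of_ne (hne i hi'), hsrc i (by simp [hi'])])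
      (fun i hi' => hn i (by simp [hi']))
      (fun i hi' k hk => by
        by_cases hkj : k = j
        · subst hkj
          rw [Function.update_self]
          exact hd k hmem i (by simp [hi']) hk hlast
        · rw [Function.update_of_ne hkj]
          exact hi i (by simp [hi']) k hk)
      (fun i hi' k hk => hd i (by simp [hi']) k (by simp [hk])) xs hxs
    refine ⟨c * d, fun φ => ?_⟩
    rw [List.map_cons, tprod, Module.End.mul_apply]
    rw [hj] at hc
    simp only
    rw [hc, map_smul, hd', smul_smul]
    congr 2
    funext i
    by_cases hij : i = j
    · subst hij
      simp [hjs.1]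
    · simp [hij]

end Op

end Compiled

/-! ### Timesteps -/

section Timesteps

variable {B : GateSet} {P : Palette B} {n : ℕ}

/-- The operations of a timestep. -/
def opsOf (r : (Flags → Bool) × Gen P) (A : List (Ann (Qubit n))) : List (Op P n) :=
  (A.filter fun a => r.1 a.1).map fun a => r.2.op a.2.1 a.2.2

theorem applyAll_op {g : Gen P} (hg : g ≠ Gen.measure) (A : List (Ann (Qubit n))) (o : List Bool)
    (ψ : State (Qubit n)) : Op.applyAll (A.map fun a => g.op a.2.1 a.2.2) o ψ =
      tprod (A.map fun a => g.kraus a) ψ := by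
  induction A generalizing ψ with
  | nil => rfl
  | cons a A ih =>
    rw [List.map_cons, List.map_cons, tprod, Module.End.mul_apply, ← ih]
    cases g with
    | measure => exact absurd rfl hg
    | _ => rfl

theorem project_eq_one (q : Qubit n) (b : Bool) (ψ : State (Qubit n)) :
    project q b ψ = one q (proj b) ψ := by
  ext x
  rw [one_apply, Finset.sum_eq_single (x q)]
  · simp [project, proj]
  · intro c _ hc
    simp [proj, hc.symm]
  · simp

/-- `Op.applyAll` consumes outcomes in the order of the measurements and `annotate` in the order of
the steps; for the measuring layer these orders coincide. The length hypothesis excludes the zero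
state that `Op.applyAll` assigns to a missing outcome. -/
theorem applyAll_measure (l : List (Item (Qubit n))) (s : Track) (ψ : State (Qubit n))
    (h : s.1.length = Op.measurements (opsOf ((fun f => f.1), (Gen.measure : Gen P))
      (annotate s l))) :
    Op.applyAll (opsOf ((fun f => f.1), (Gen.measure : Gen P)) (annotate s l)) s.1 ψ =
      tprod (((annotate s l).filter fun a => a.1.1).map fun a =>
        (Gen.measure : Gen P).kraus a) ψ := by
  induction l generalizing s ψ with
  | nil => rfl
  | cons i l ih =>
    obtain ⟨e, p, q⟩ := i
    obtain ⟨β, u, v, w⟩ := s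
    have h₁ : annotate (β, u, v, w) ((e, p, q) :: l) = ((e, β.headD false, u, v, w), p, q) ::
        annotate (Track.next (β, u, v, w) (e, p, q)) l := rfl
    rw [h₁] at h ⊢
    cases e with
    | false =>
      have := ih (Track.next (β, u, v, w) (false, p, q)) ψ
      simp only [opsOf, List.filter_cons, Bool.false_eq_true, if_false] at this h ⊢
      exact this h
    | true =>
      have := ih (Track.next (β, u, v, w) (true, p, q))
      simp only [opsOf, List.filter_cons, if_true, List.map_cons, Gen.op, Op.measurements,
        tprod] at this h ⊢
      cases β with
      | nil => simp at h
      | cons b β =>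
        rw [Op.applyAll, project_eq_one, Module.End.mul_apply]
        exact this _ (by simpa [Track.next] using h)

/-- The step flag and the parity w do not depend on the outcomes. So up to and including the
measurement, the controller may annotate with default outcomes and still names the operations that
the true outcomes would give. -/
theorem opsOf_congr {r : (Flags → Bool) × Gen P}
    (hr : ∀ f g : Flags, f.1 = g.1 → f.2.2.2.2 = g.2.2.2.2 → r.1 f = r.1 g)
    (l : List (Item (Qubit n))) (s s' : Track) (hs : s.2.2.2 = s'.2.2.2) :
    opsOf r (annotate s l) = opsOf r (annotate s' l) := by
  induction l generalizing s s' with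
  | nil => rfl
  | cons i l ih =>
    have h₁ : ∀ s : Track, annotate s (i :: l) =
      ((i.1, s.1.headD false, s.2.1, s.2.2.1, s.2.2.2), i.2) ::
        annotate (s.next i) l := fun _ => rfl
    have h₂ := ih (s.next i) (s'.next i) (by cases h : i.1 <;> simp [Track.next, h, hs])
    have h₃ := hr (i.1, s.1.headD false, s.2.1, s.2.2.1, s.2.2.2)
      (i.1, s'.1.headD false, s'.2.1, s'.2.2.1, s'.2.2.2) rfl hs
    rw [h₁, h₁]
    simp only [opsOf, List.filter_cons, h₃] at h₂ ⊢
    split_ifs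
    · simp only [List.map_cons, h₂]
    · exact h₂

end Timesteps

end CCNTC

namespace CCNTC

/-! ### The controller of a sequence of routes -/

/-- Unrolls the inductive definition into a description that can be indexed by timesteps. -/
theorem Controller.Reaches.spec {B : GateSet} {P : Palette B} {n : ℕ} {C : Controller P n}
    {h : History} {s : List (List (Op P n))} (hr : C.Reaches h s) :
    s.length = h.length ∧ ∀ t < h.length, ∃ ops o, s[t]? = some ops ∧ h[t]? = some o ∧
      C (h.take t) = some ops ∧ o.length = Op.measurements ops := by
  induction hr with
  | start => simp
  | @step h s ops o hr hC ho ih =>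
    refine ⟨by simp [ih.1], fun t ht => ?_⟩
    rw [List.length_append, List.length_singleton] at ht
    rcases Nat.lt_succ_iff_lt_or_eq.1 ht with h' | rfl
    · obtain ⟨ops', o', h₁, h₂, h₃, h₄⟩ := ih.2 t h'
      refine ⟨ops', o', ?_, ?_, ?_, h₄⟩
      · rw [List.getElem?_append_left (ih.1 ▸ h'), h₁]
      · rw [List.getElem?_append_left h', h₂]
      · rw [List.take_append_of_le_length h'.le, h₃]
    · refine ⟨ops, o, ?_, ?_, ?_, ho⟩
      · rw [← ih.1]; simp
      · simp
      · simpa using hC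

theorem evolve_take_succ {B : GateSet} {P : Palette B} {n : ℕ} {t : ℕ}
    {s : List (List (Op P n))} {h : History} {ops : List (Op P n)} {o : List Bool}
    (hs : s[t]? = some ops) (hh : h[t]? = some o) (ψ : State (Qubit n)) :
    evolve (s.take (t + 1)) (h.take (t + 1)) ψ =
      Op.applyAll ops o (evolve (s.take t) (h.take t) ψ) := by
  induction t generalizing s h ψ with
  | zero =>
    cases s <;> cases h <;> simp_all [evolve]
  | succ t ih =>
    cases s with
    | nil => simp at hs
    | cons a s =>
      cases h with
      | nil => simp at hh
      | cons b h =>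
        simp only [List.getElem?_cons_succ] at hs hh
        rw [List.take_succ_cons, List.take_succ_cons, evolve, ih hs hh]
        rfl

theorem Gen.op_local {B : GateSet} {P : Palette B} {n : ℕ} {p q : Qubit n} {g : Gen P}
    (h : g.foot = Foot.both → Neighbors p q) : (g.op p q).Local := by
  cases g with
  | both g => exact h rfl
  | swap g =>
    have := h rfl
    simp only [Gen.op, Op.Local, Neighbors] at this ⊢
    tauto
  | _ => trivial

namespace Compiled

variable {B : GateSet} {P : Palette B} (W : Compiled P)

/-- The number of timesteps of a wire. -/
def period : ℕ := (rounds W.layers).length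

/-- The timestep in which the wires of route `k` are measured. -/
def measureTime (k : ℕ) : ℕ := k * W.period + (rounds W.before).length

def round (t : ℕ) : (Flags → Bool) × Gen P :=
  (rounds W.layers).getD (t % W.period) (fun _ => false, Gen.measure)

theorem rounds_layers : rounds W.layers =
    rounds W.before ++ (fun f => f.1, Gen.measure) :: rounds W.after := by
  simp only [layers, rounds, List.flatMap_append, List.flatMap_cons]
  rfl

theorem period_eq : W.period = (rounds W.before).length + ((rounds W.after).length + 1) := by
  rw [period, rounds_layers, List.length_append, List.length_cons]

theorem period_pos : 0 < W.period := by
  rw [period_eq]; omega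

theorem round_mem (t : ℕ) : W.round t ∈ rounds W.layers := by
  have : t % W.period < (rounds W.layers).length := Nat.mod_lt _ W.period_pos
  rw [round, List.getD_eq_getElem _ _ this]
  exact List.getElem_mem this

theorem ne_measure_of_mem {r : (Flags → Bool) × Gen P}
    (h : r ∈ rounds W.before ∨ r ∈ rounds W.after) : r.2 ≠ Gen.measure := by
  obtain ⟨L, hL, hg⟩ : ∃ L ∈ W.before ++ W.after, r.2 ∈ L.gens := by
    rcases h with h | h <;> obtain ⟨L, hL, hg, _⟩ := mem_rounds.1 h <;>
      exact ⟨L, by simp [hL], hg⟩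
  simp only [before, after, List.cons_append, List.nil_append, List.mem_cons, List.not_mem_nil,
    or_false] at hL
  have h₁ : ∀ k : List (Fin P.k₁), r.2 ∈ k.map Gen.fst → r.2 ≠ Gen.measure := by
    intro k hk he
    simp [he] at hk
  have h₂ : ∀ k : List (Fin P.k₁), r.2 ∈ k.map Gen.snd → r.2 ≠ Gen.measure := by
    intro k hk he
    simp [he] at hk
  rcases hL with rfl | rfl | rfl | rfl | rfl | rfl | rfl | rfl
  exacts [h₂ _ hg, W.cz_ne _ hg, W.cz_ne _ hg, h₁ _ hg, h₁ _ hg, h₁ _ hg, h₁ _ hg, h₁ _ hg]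

theorem pred_congr {r : (Flags → Bool) × Gen P}
    (h : r ∈ rounds W.before ∨ r = (fun f => f.1, Gen.measure)) (f g : Flags) (h₁ : f.1 = g.1)
    (h₂ : f.2.2.2.2 = g.2.2.2.2) : r.1 f = r.1 g := by
  rcases h with h | rfl
  · obtain ⟨L, hL, _, he⟩ := mem_rounds.1 h
    rw [he]
    simp only [before, List.mem_cons, List.not_mem_nil, or_false] at hL
    rcases hL with rfl | rfl | rfl | rfl <;> simp [h₁, h₂]
  · exact h₁

/-- The single item of a wire of length zero has a clean frame and triggers nothing. Data qubits
that rest during a route thus count neither for the size nor for the width. -/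
theorem pred_trivial {r : (Flags → Bool) × Gen P} (h : r ∈ rounds W.layers) (o : Bool) :
    r.1 (false, o, false, false, false) = false := by
  obtain ⟨L, hL, _, he⟩ := mem_rounds.1 h
  rw [he]
  simp only [layers, before, after, measuring, List.cons_append, List.nil_append, List.mem_cons,
    List.not_mem_nil, or_false] at hL
  rcases hL with rfl | rfl | rfl | rfl | rfl | rfl | rfl | rfl | rfl <;> rfl

theorem step_of_foot_both {r : (Flags → Bool) × Gen P} (h : r ∈ rounds W.layers)
    (hf : r.2.foot = Foot.both) (f : Flags) (hp : r.1 f = true) : f.1 = true := by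
  obtain ⟨L, hL, hg, he⟩ := mem_rounds.1 h
  have hgood := W.good_of_mem hL
  obtain ⟨c, hc⟩ := hgood.both (hgood.both_of _ hg hf)
  exact (hc f (he ▸ hp)).1

variable {n : ℕ}

/-- The operations of timestep `t`. -/
def timestep (paths : ℕ → List (Qubit n × List (Qubit n))) (t : ℕ) (h : History) :
    List (Op P n) :=
  opsOf (W.round t) (annotate (start (h.getD (W.measureTime (t / W.period)) []))
    (pathItems (paths (t / W.period))))

/-- The controller that performs `K` routes one after the other. -/
def control (K : ℕ) (paths : ℕ → List (Qubit n × List (Qubit n))) : Controller P n :=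
  fun h => ((List.range (K * W.period))[h.length]?).map fun t => W.timestep paths t h

theorem control_eq {K : ℕ} {paths : ℕ → List (Qubit n × List (Qubit n))} {h : History}
    (hh : h.length < K * W.period) :
    W.control K paths h = some (W.timestep paths h.length h) := by
  simp [control, hh]

theorem lt_of_control {K : ℕ} {paths : ℕ → List (Qubit n × List (Qubit n))} {h : History}
    {ops : List (Op P n)} (hc : W.control K paths h = some ops) :
    h.length < K * W.period ∧ ops = W.timestep paths h.length h := by
  by_cases hh : h.length < K * W.period
  · rw [W.control_eq hh, Option.some.injEq] at hc
    exact ⟨hh, hc.symm⟩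
  · simp [control, hh] at hc

theorem length_le_of_reaches {K : ℕ} {paths : ℕ → List (Qubit n × List (Qubit n))}
    {h : History} {s : List (List (Op P n))} (hr : (W.control K paths).Reaches h s) :
    h.length ≤ K * W.period := by
  induction hr with
  | start => simp
  | step _ hc _ _ =>
    have := (W.lt_of_control hc).1
    rw [List.length_append, List.length_singleton]
    omega

end Compiled

/-- The paths of the data qubits in a sequence of routes. -/
def pathsOf {n : ℕ} (pos : ℕ → Fin n → Qubit n) (tail : ℕ → Fin n → List (Qubit n)) (k : ℕ) :
    List (Qubit n × List (Qubit n)) :=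
  (List.finRange n).map fun j => (pos k j, tail k j)

/-- `K` routes that move the data qubits from `pos 0` to `pos K` along disjoint paths. -/
structure Routes {n : ℕ} (K : ℕ) (pos : ℕ → Fin n → Qubit n)
    (tail : ℕ → Fin n → List (Qubit n)) : Prop where
  chain : ∀ k < K, ∀ j, (pos k j :: tail k j).IsChain Neighbors
  nodup : ∀ k < K, ∀ j, (pos k j :: tail k j).Nodup
  last : ∀ k < K, ∀ j, (tail k j).getLastD (pos k j) = pos (k + 1) j
  disjoint : ∀ k < K, ∀ i j, i ≠ j → List.Disjoint (pos k i :: tail k i) (pos k j :: tail k j)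

/-! ### Correctness and cost of a sequence of routes -/

namespace Routes

open Compiled

variable {B : GateSet} {P : Palette B} (W : Compiled P) {n K : ℕ} {pos : ℕ → Fin n → Qubit n}
  {tail : ℕ → Fin n → List (Qubit n)}

theorem pos_injective (R : Routes K pos tail) {k : ℕ} (hk : k < K) :
    Function.Injective (pos k) := by
  intro i j h
  by_contra hij
  exact R.disjoint k hk i j hij (a := pos k i) (by simp) (by simp [h])

theorem nodup_of_mem (R : Routes K pos tail) {k : ℕ} (hk : k < K) {x : Qubit n × List (Qubit n)}
    (hx : x ∈ pathsOf pos tail k) : (x.1 :: x.2).Nodup := by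
  obtain ⟨j, _, rfl⟩ := List.mem_map.1 hx
  exact R.nodup k hk j

theorem pairwise (R : Routes K pos tail) {k : ℕ} (hk : k < K) :
    (pathsOf pos tail k).Pairwise fun x y => List.Disjoint (x.1 :: x.2) (y.1 :: y.2) := by
  rw [pathsOf, List.pairwise_map]
  exact (List.nodup_finRange n).imp fun {i j} h => R.disjoint k hk i j h

/-- The effect of one timestep. -/
theorem applyAll_eq {h : History} (hh : h.length = K * W.period) {k i : ℕ}
    {r : (Flags → Bool) × Gen P} (hr : (rounds W.layers)[i]? = some r)
    {ops : List (Op P n)} {o : List Bool} (ho : h[k * W.period + i]? = some o)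
    (hC : W.control K (pathsOf pos tail) (h.take (k * W.period + i)) = some ops)
    (hm : o.length = Op.measurements ops) (ψ : State (Qubit n)) :
    Op.applyAll ops o ψ =
      tprod (((annotate (start (h.getD (W.measureTime k) [])) (pathItems (pathsOf pos tail k))).filter
        fun a => r.1 a.1).map fun a => r.2.kraus a) ψ := by
  have hi : i < W.period := (List.getElem?_eq_some_iff.1 hr).1
  have ht : k * W.period + i < h.length := (List.getElem?_eq_some_iff.1 ho).1
  have hlen : (h.take (k * W.period + i)).length = k * W.period + i := by
    rw [List.length_take]; omega
  have hdiv : (k * W.period + i) / W.period = k := by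
    rw [Nat.add_div_of_dvd_right (dvd_mul_left _ _), Nat.mul_div_cancel _ W.period_pos,
      Nat.div_eq_of_lt hi, add_zero]
  have hround : W.round (k * W.period + i) = r := by
    rw [Compiled.round, Nat.add_comm, Nat.add_mul_mod_self_right, Nat.mod_eq_of_lt hi,
      List.getD_eq_getElem?_getD, hr]
    rfl
  have hops := (W.lt_of_control hC).2
  rw [hlen, timestep, hround, hdiv] at hops
  rw [rounds_layers] at hr
  -- Before the measurement the operations do not depend on outcomes; at the measurement `o` is
  -- itself the entry of the history that annotates the wires; afterwards this entry is contained in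
  -- the truncated history that the controller sees.
  rcases lt_trichotomy i (rounds W.before).length with hlt | heq | hgt
  · rw [List.getElem?_append_left hlt] at hr
    have hmem := List.mem_of_getElem? hr
    rw [hops.trans (opsOf_congr (W.pred_congr (Or.inl hmem)) _ _
      (start (h.getD (W.measureTime k) [])) rfl)]
    exact applyAll_op (W.ne_measure_of_mem (Or.inl hmem)) _ _ _
  · rw [heq, List.getElem?_append_right le_rfl, Nat.sub_self, List.getElem?_cons_zero,
      Option.some.injEq] at hr
    have ho' : h.getD (W.measureTime k) [] = o := by
      rw [measureTime, ← heq, List.getD_eq_getElem?_getD, ho]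
      rfl
    rw [hops.trans (opsOf_congr (W.pred_congr (Or.inr hr.symm)) _ _
      (start (h.getD (W.measureTime k) [])) rfl), ← hr, ho'] at hm
    rw [hops.trans (opsOf_congr (W.pred_congr (Or.inr hr.symm)) _ _
      (start (h.getD (W.measureTime k) [])) rfl), ← hr, ho']
    exact applyAll_measure _ (start o) ψ hm
  · have hmem : r ∈ rounds W.after := by
      rw [List.getElem?_append_right hgt.le] at hr
      obtain ⟨d, hd⟩ : ∃ d, i - (rounds W.before).length = d + 1 := ⟨_, (Nat.succ_pred (by omega)).symm⟩
      rw [hd, List.getElem?_cons_succ] at hr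
      exact List.mem_of_getElem? hr
    have hget : (h.take (k * W.period + i)).getD (W.measureTime k) [] =
        h.getD (W.measureTime k) [] := by
      rw [List.getD_eq_getElem?_getD, List.getElem?_take_of_lt (by rw [measureTime]; omega),
        List.getD_eq_getElem?_getD]
    rw [hget] at hops
    rw [hops]
    exact applyAll_op (W.ne_measure_of_mem (Or.inr hmem)) _ _ _

/-- The data qubits follow the routes. -/
theorem evolve_eq (R : Routes K pos tail) {h : History} {s : List (List (Op P n))}
    (hc : (W.control K (pathsOf pos tail)).Completes h s) :
    ∃ c : ℂ, ∀ φ : State (Fin n), evolve s h (std (pos 0) φ) = c • std (pos K) φ := by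
  obtain ⟨hr, hnone⟩ := hc
  have hlen : h.length = K * W.period := by
    refine le_antisymm (W.length_le_of_reaches hr) (not_lt.1 fun hlt => ?_)
    rw [W.control_eq hlt] at hnone
    simp at hnone
  obtain ⟨hs, hspec⟩ := hr.spec
  -- Within a route all timesteps are expressed with the outcomes from the complete history, so that
  -- the product over a full period is the one in `tprod_rounds`.
  have hstep : ∀ k < K, ∀ i ≤ W.period, ∀ ψ : State (Qubit n),
      evolve (s.take (k * W.period + i)) (h.take (k * W.period + i)) ψ =
      tprod (((rounds W.layers).take i).map fun r => tprod (((annotate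
        (start (h.getD (W.measureTime k) [])) (pathItems (pathsOf pos tail k))).filter
        fun a => r.1 a.1).map fun a => r.2.kraus a))
      (evolve (s.take (k * W.period)) (h.take (k * W.period)) ψ) := by
    intro k hk i
    induction i with
    | zero => intro _ ψ; rfl
    | succ i ih =>
      intro hi ψ
      have hlt : k * W.period + i < h.length := by
        rw [hlen]
        calc k * W.period + i < k * W.period + W.period := by omega
          _ = (k + 1) * W.period := by ring
          _ ≤ K * W.period := Nat.mul_le_mul_right _ hk
      obtain ⟨ops, o, h₁, h₂, h₃, h₄⟩ := hspec _ hlt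
      have hi' : i < (rounds W.layers).length := hi
      have hr : (rounds W.layers)[i]? = some (rounds W.layers)[i] := List.getElem?_eq_getElem hi'
      rw [← add_assoc, evolve_take_succ h₁ h₂, applyAll_eq W hlen hr h₂ h₃ h₄,
        ih (by omega), List.take_add_one, hr, Option.toList_some, List.map_append, tprod_append]
      simp [tprod]
  -- Between routes the qubits off the data places are again in state |0⟩, so the induction proceeds
  -- in whole periods.
  have hroute : ∀ k ≤ K, ∃ c : ℂ, ∀ φ : State (Fin n),
      evolve (s.take (k * W.period)) (h.take (k * W.period)) (std (pos 0) φ) =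
        c • std (pos k) φ := by
    intro k
    induction k with
    | zero => intro _; exact ⟨1, fun φ => by simp [evolve]⟩
    | succ k ih =>
      intro hk
      have hk : k < K := hk
      obtain ⟨c, hc⟩ := ih hk.le
      obtain ⟨d, hd⟩ := W.tprod_wireOp_std (tail k) (pos k) (List.finRange n)
        (List.nodup_finRange n) (pos k) (R.pos_injective hk) (fun _ _ => rfl)
        (fun j _ => R.nodup k hk j)
        (fun j _ i hij hmem => R.disjoint k hk i j hij (a := pos k i) (by simp) hmem)
        (fun i _ j _ hij => R.disjoint k hk i j hij)
        (deal (h.getD (W.measureTime k) []) (pathsOf pos tail k)) (deal_map_snd _ _)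
      refine ⟨c * d, fun φ => ?_⟩
      have := hstep k hk W.period le_rfl (std (pos 0) φ)
      rw [period, List.take_length, W.tprod_rounds _ (fun x => R.nodup_of_mem hk) (R.pairwise hk),
        ← period, hc φ, map_smul, hd, smul_smul] at this
      rw [Nat.succ_mul, this]
      congr 2
      funext j
      rw [if_pos (List.mem_finRange j), R.last k hk j]
  obtain ⟨c, hc⟩ := hroute K le_rfl
  refine ⟨c, fun φ => ?_⟩
  rw [← hc φ, ← hlen, List.take_length, ← hs, List.take_length]

/-- The items at which operations are performed. -/
theorem mem_timestep {t : ℕ} {h : History} {a : Op P n}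
    (ha : a ∈ W.timestep (pathsOf pos tail) t h) :
    ∃ j : Fin n, ∃ x : Ann (Qubit n), ∃ s, tail (t / W.period) j ≠ [] ∧
      x ∈ wire s (pos (t / W.period) j) (tail (t / W.period) j) ∧ (W.round t).1 x.1 = true ∧
      a = (W.round t).2.op x.2.1 x.2.2 := by
  obtain ⟨x, hx, rfl⟩ := List.mem_map.1 ha
  rw [List.mem_filter, annotate_pathItems, List.mem_flatMap] at hx
  obtain ⟨⟨y, hy, hxy⟩, hp⟩ := hx
  have hy' : y.2 ∈ pathsOf pos tail (t / W.period) :=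
    deal_map_snd _ (pathsOf pos tail (t / W.period)) ▸ List.mem_map_of_mem hy
  obtain ⟨j, _, hj⟩ := List.mem_map.1 hy'
  rw [← hj] at hxy
  refine ⟨j, x, _, fun hnil => ?_, hxy, hp, rfl⟩
  rw [hnil, wire_nil, List.mem_singleton] at hxy
  rw [hxy] at hp
  exact absurd hp (by rw [start, W.pred_trivial (W.round_mem t)]; simp)

theorem admissible (R : Routes K pos tail) :
    (W.control K (pathsOf pos tail)).Admissible := by
  intro h s _ ops hC
  obtain ⟨hlt, rfl⟩ := W.lt_of_control hC
  have hk : h.length / W.period < K := Nat.div_lt_of_lt_mul (by rwa [mul_comm])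
  obtain ⟨L, hL, hg, he⟩ := mem_rounds.1 (W.round_mem h.length)
  have hgood := W.good_of_mem hL
  constructor
  · rw [timestep, opsOf, List.pairwise_map, annotate_pathItems, List.filter_flatMap,
      List.pairwise_flatMap]
    constructor
    · intro x hx
      have hn : (x.2.1 :: x.2.2).Nodup := R.nodup_of_mem hk
        (deal_map_snd _ (pathsOf pos tail _) ▸ List.mem_map_of_mem hx)
      rw [he]
      refine (hgood.pairwise hn).imp fun {a b} hab => ?_
      rw [Gen.support_op, Gen.support_op]
      exact hab.mono (hgood.foot _ hg _ _ _) (hgood.foot _ hg _ _ _)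
    · have hd := R.pairwise hk
      rw [← deal_map_snd (h.getD (W.measureTime (h.length / W.period)) [])
        (pathsOf pos tail _), List.pairwise_map] at hd
      refine hd.imp fun {x y} hxy a ha b hb => ?_
      rw [Gen.support_op, Gen.support_op, Finset.disjoint_left]
      intro q hq hq'
      exact hxy (sites_subset (List.mem_filter.1 ha).1 _ q hq)
        (sites_subset (List.mem_filter.1 hb).1 _ q hq')
  · intro a ha
    obtain ⟨j, x, s, _, hx, hp, rfl⟩ := mem_timestep W ha
    have hnb : (W.round h.length).2.foot = Foot.both → Neighbors x.2.1 x.2.2 := fun hf =>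
      rel_of_mem_wire (R.chain _ hk j) hx (W.step_of_foot_both (W.round_mem _) hf _ hp)
    exact Gen.op_local hnb

/-- The qubits acted on lie on the non-trivial paths. -/
theorem acted_subset {q : Qubit n} (hq : q ∈ (W.control K (pathsOf pos tail)).acted) :
    ∃ k < K, ∃ j, tail k j ≠ [] ∧ q ∈ pos k j :: tail k j := by
  obtain ⟨h, s, hr, ops, hops, a, ha, hqa⟩ := hq
  obtain ⟨hs, hspec⟩ := hr.spec
  obtain ⟨t, ht⟩ := List.getElem?_of_mem hops
  obtain ⟨ops', o, h₁, h₂, h₃, -⟩ := hspec t (hs ▸ (List.getElem?_eq_some_iff.1 ht).1)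
  rw [ht, Option.some.injEq] at h₁
  subst h₁
  obtain ⟨hlt, rfl⟩ := W.lt_of_control h₃
  obtain ⟨j, x, s, hne, hx, -, rfl⟩ := mem_timestep W ha
  refine ⟨_, Nat.div_lt_of_lt_mul (by rwa [mul_comm]), j, hne, ?_⟩
  rw [Gen.support_op] at hqa
  exact sites_subset hx _ q hqa

/-- Each item of a wire yields at most one operation per timestep, and a wire has one item per qubit
of its path. Trivial paths yield none by `pred_trivial`. -/
theorem length_timestep_le {c : ℕ} {t : ℕ}
    (hc : ∑ j : Fin n, (if tail (t / W.period) j = [] then 0 else (tail (t / W.period) j).length + 1)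
      ≤ c) (h : History) : (W.timestep (pathsOf pos tail) t h).length ≤ c := by
  have hwire : ∀ (s : Track) (p : Qubit n) (l : List (Qubit n)), (wire s p l).length =
      l.length + 1 := by
    intro s p l
    rw [← List.length_map (f := fun a : Ann (Qubit n) => a.2.1), wire_map_fst, List.length_cons]
  have key : ∀ (β : List Bool) (l : List (Qubit n × List (Qubit n))),
      (((annotate (start β) (pathItems l)).filter fun a => (W.round t).1 a.1)).length ≤
      (l.map fun x => if x.2 = [] then 0 else x.2.length + 1).sum := by
    intro β l
    rw [annotate_pathItems, List.filter_flatMap, List.length_flatMap]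
    nth_rw 2 [← deal_map_snd β l]
    rw [List.map_map]
    refine List.sum_le_sum fun x _ => ?_
    simp only [Function.comp_apply]
    split_ifs with hx
    · rw [hx, wire_nil, List.filter_cons, start, W.pred_trivial (W.round_mem t)]
      simp
    · exact (List.length_filter_le _ _).trans (hwire _ _ _).le
  rw [timestep, opsOf, List.length_map]
  refine (key _ _).trans (le_trans (le_of_eq ?_) hc)
  rw [pathsOf, List.map_map, ← List.ofFn_eq_map, List.sum_ofFn]
  rfl

theorem depth_le : (W.control K (pathsOf pos tail)).depth ≤ ((K * W.period : ℕ) : ℕ∞) := by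
  refine iSup_le fun h => iSup_le fun s => iSup_le fun hr => ?_
  rw [hr.spec.1]
  exact_mod_cast W.length_le_of_reaches hr

theorem size_le {c : ℕ} (hc : ∀ k < K, ∑ j : Fin n,
    (if tail k j = [] then 0 else (tail k j).length + 1) ≤ c) :
    (W.control K (pathsOf pos tail)).size ≤ ((K * W.period * c : ℕ) : ℕ∞) := by
  refine iSup_le fun h => iSup_le fun s => iSup_le fun hr => ?_
  have hsum : (s.map List.length).sum ≤ h.length * c := by
    induction hr with
    | start => simp
    | @step h s ops o hr hC ho ih =>
      obtain ⟨hlt, rfl⟩ := W.lt_of_control hC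
      have := length_timestep_le W (pos := pos) (t := h.length)
        (hc _ (Nat.div_lt_of_lt_mul (by rwa [mul_comm]))) h
      simp only [List.map_append, List.map_cons, List.map_nil, List.sum_append, List.sum_cons,
        List.sum_nil, List.length_append, List.length_singleton]
      rw [Nat.succ_mul]
      omega
  exact_mod_cast hsum.trans (Nat.mul_le_mul_right _ (W.length_le_of_reaches hr))

end Routes

end CCNTC

namespace CCNTC

/-! ### Straight walks in the grid -/

/-- The neighbour of `a` in the direction of `b`. -/
def toward (a b : ℕ) : ℕ := bif decide (a < b) then a + 1 else bif decide (b < a) then a - 1 else a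

def stepTo (t q : ℕ × ℕ) : ℕ × ℕ := (toward q.1 t.1, toward q.2 t.2)

/-- At most `f` steps from `q` to `t`. -/
def walk (f : ℕ) (q t : ℕ × ℕ) : List (ℕ × ℕ) :=
  scan (fun q (_ : Unit) => stepTo t q)
    (fun q _ => bif q.1 == t.1 && q.2 == t.2 then [] else [stepTo t q]) q (List.replicate f ())

def dist (q t : ℕ × ℕ) : ℕ := (q.1 - t.1) + (t.1 - q.1) + ((q.2 - t.2) + (t.2 - q.2))

/-- `x` lies in the rectangle spanned by `q` and `t`. -/
def InBox (q t x : ℕ × ℕ) : Prop :=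
  min q.1 t.1 ≤ x.1 ∧ x.1 ≤ max q.1 t.1 ∧ min q.2 t.2 ≤ x.2 ∧ x.2 ≤ max q.2 t.2

def Straight (q t : ℕ × ℕ) : Prop := q.1 = t.1 ∨ q.2 = t.2

def Adjacent (q r : ℕ × ℕ) : Prop :=
  (q.1 = r.1 ∧ (q.2 + 1 = r.2 ∨ r.2 + 1 = q.2)) ∨ (q.2 = r.2 ∧ (q.1 + 1 = r.1 ∨ r.1 + 1 = q.1))

theorem toward_eq (a b : ℕ) :
    toward a b = if a < b then a + 1 else if b < a then a - 1 else a := by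
  simp only [toward, Bool.cond_decide]

theorem walk_succ (f : ℕ) (q t : ℕ × ℕ) : walk (f + 1) q t =
    (if q = t then [] else [stepTo t q]) ++ walk f (stepTo t q) t := by
  rw [walk, List.replicate_succ, scan]
  congr 1
  by_cases h : q = t
  · subst h; simp
  · have : (q.1 == t.1 && q.2 == t.2) = false := by
      rw [Bool.eq_false_iff]
      simpa [Prod.ext_iff] using h
    rw [if_neg h, this]
    rfl

theorem walk_self (f : ℕ) (t : ℕ × ℕ) : walk f t t = [] := by
  induction f with
  | zero => rfl
  | succ f ih =>
    have : stepTo t t = t := by simp [stepTo, toward]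
    rw [walk_succ, this, ih]
    simp

theorem length_walk_le (f : ℕ) (q t : ℕ × ℕ) : (walk f q t).length ≤ f := by
  induction f generalizing q with
  | zero => simp [walk, scan]
  | succ f ih =>
    have := ih (stepTo t q)
    rw [walk_succ, List.length_append]
    split_ifs <;> simp <;> omega

/-- On a straight segment only one coordinate changes; otherwise `stepTo` would move diagonally and
adjacency would fail. -/
theorem stepTo_spec {q t : ℕ × ℕ} (hs : Straight q t) (h : q ≠ t) :
    Straight (stepTo t q) t ∧ dist (stepTo t q) t + 1 = dist q t ∧ Adjacent q (stepTo t q) ∧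
      ∀ x, InBox (stepTo t q) t x → InBox q t x := by
  obtain ⟨a, b⟩ := q
  obtain ⟨c, d⟩ := t
  simp only [Straight, dist, Adjacent, InBox, stepTo, toward_eq, ne_eq, Prod.mk.injEq] at *
  rcases hs with rfl | rfl
  · rcases lt_trichotomy b d with h' | h' | h'
    · simp only [h', lt_irrefl, not_lt.2 h'.le, if_true, if_false]
      refine ⟨?_, ?_, ?_, fun x => ?_⟩ <;> first | omega | simp
    · omega
    · simp only [h', lt_irrefl, not_lt.2 h'.le, if_true, if_false]
      refine ⟨?_, ?_, ?_, fun x => ?_⟩ <;> first | omega | (simp; done) | (simp; omega)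
  · rcases lt_trichotomy a c with h' | h' | h'
    · simp only [h', lt_irrefl, not_lt.2 h'.le, if_true, if_false]
      refine ⟨?_, ?_, ?_, fun x => ?_⟩ <;> first | omega | simp
    · omega
    · simp only [h', lt_irrefl, not_lt.2 h'.le, if_true, if_false]
      refine ⟨?_, ?_, ?_, fun x => ?_⟩ <;> first | omega | (simp; done) | (simp; omega)

theorem inBox_left (q t : ℕ × ℕ) : InBox q t q := by
  simp only [InBox]; omega

/-- The distance to `t` drops strictly at each step, so the walk repeats no point and `dist q t`
steps suffice to arrive. -/
theorem walk_spec {f : ℕ} {q t : ℕ × ℕ} (hs : Straight q t) (hd : dist q t ≤ f) :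
    (∀ x ∈ walk f q t, InBox q t x ∧ dist x t < dist q t) ∧
      (q :: walk f q t).IsChain Adjacent ∧ (q :: walk f q t).Nodup ∧
      (walk f q t).getLastD q = t := by
  induction f generalizing q with
  | zero =>
    have h : q = t := by
      simp only [dist] at hd
      ext <;> omega
    subst h
    simp [walk, scan]
  | succ f ih =>
    by_cases h : q = t
    · subst h
      simp [walk_self]
    · obtain ⟨h₁, h₂, h₃, h₄⟩ := stepTo_spec hs h
      obtain ⟨i₁, i₂, i₃, i₄⟩ := ih h₁ (by omega)
      rw [walk_succ, if_neg h, List.singleton_append]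
      have hmem : ∀ x ∈ stepTo t q :: walk f (stepTo t q) t,
          InBox q t x ∧ dist x t < dist q t := by
        intro x hx
        rcases List.mem_cons.1 hx with rfl | hx
        · exact ⟨h₄ _ (inBox_left _ _), by omega⟩
        · exact ⟨h₄ _ (i₁ x hx).1, (i₁ x hx).2.trans (by omega)⟩
      refine ⟨hmem, List.isChain_cons_cons.2 ⟨h₃, i₂⟩, List.nodup_cons.2 ⟨fun hq => ?_, i₃⟩, ?_⟩
      · exact lt_irrefl _ (hmem q hq).2
      · rw [List.getLastD_cons, i₄]

/-! ### The places of the data qubits -/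

/-- The place after `t` of the four moves to column `b` of the data qubit of row `j`, which is the
`r`-th one to leave the first column. -/
def stage (j r b : ℕ) : ℕ → ℕ × ℕ
  | 0 => (0, j)
  | 1 => (r / 2 + 1, j)
  | 2 => (r / 2 + 1, (r + 1) / 2)
  | 3 => (b, (r + 1) / 2)
  | _ + 4 => (b, 0)

/-- The data qubit with target column `o` leaves the first column. -/
def leaves (o : Option ℕ) : Bool := !(o.getD 0 == 0)

/-- The place of the data qubit of row `j` before route `k`, if its target column is `o`, and `r`
data qubits below it leave the first column. Those with even `r` move in the first four routes,
those with odd `r` in the last four. -/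
def place (k j r : ℕ) (o : Option ℕ) : ℕ × ℕ :=
  bif leaves o then
    bif decide (r % 2 = 1) then stage j r (o.getD 0) (k - 4) else stage j r (o.getD 0) k
  else bif o.isSome && decide (8 ≤ k) then (0, 0) else (0, j)

theorem place_none (k j r : ℕ) : place k j r none = (0, j) := rfl

theorem place_zero (k j r : ℕ) : place k j r (some 0) = if 8 ≤ k then (0, 0) else (0, j) := by
  simp [place, leaves, Bool.cond_decide]

theorem place_ne_zero (k j r : ℕ) {b : ℕ} (hb : b ≠ 0) :
    place k j r (some b) = stage j r b (if r % 2 = 1 then k - 4 else k) := by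
  have h : (b == 0) = false := by simpa using hb
  simp only [place, leaves, Option.getD_some, Bool.cond_decide, h]
  split_ifs <;> rfl

theorem stage_straight (j r b t : ℕ) : Straight (stage j r b t) (stage j r b (t + 1)) := by
  match t with
  | 0 => right; rfl
  | 1 => left; rfl
  | 2 => right; rfl
  | 3 => left; rfl
  | _ + 4 => left; rfl

theorem place_straight (k j r : ℕ) (o : Option ℕ) :
    Straight (place k j r o) (place (k + 1) j r o) := by
  match o with
  | none => left; rfl
  | some 0 =>
    rw [place_zero, place_zero]
    left
    split_ifs <;> rfl
  | some (b + 1) =>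
    rw [place_ne_zero _ _ _ b.succ_ne_zero, place_ne_zero _ _ _ b.succ_ne_zero]
    split_ifs
    · by_cases h : 4 ≤ k
      · rw [Nat.sub_add_comm h]
        exact stage_straight _ _ _ _
      · rw [show k - 4 = 0 by omega, show k + 1 - 4 = 0 by omega]
        left; rfl
    · exact stage_straight _ _ _ _

/-- The moves of two data qubits do not meet. -/
theorem place_disjoint {k i j r s : ℕ} {a b : Option ℕ} (hk : k < 8) (hij : i < j) (hr : r ≤ i)
    (hs : s ≤ j) (hrs : leaves a = true → r < s) (hab : ∀ c, a = some c → b ≠ some c)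
    (hbelow : b = some 0 → a ≠ none) {x : ℕ × ℕ}
    (h₁ : InBox (place k i r a) (place (k + 1) i r a) x)
    (h₂ : InBox (place k j s b) (place (k + 1) j s b) x) : False := by
  match a, b with
  | none, none => simp only [place_none, InBox] at h₁ h₂; omega
  -- A resting qubit would block the descent in column 0; the condition on `π` rules it out.
  | none, some 0 => exact hbelow rfl rfl
  | some 0, some 0 => exact hab 0 rfl rfl
  | some 0, none =>
    simp only [place_none, place_zero, InBox] at h₁ h₂
    split_ifs at h₁ <;> simp only at h₁ <;> omega
  | none, some (b + 1) =>
    rw [place_ne_zero _ _ _ b.succ_ne_zero, place_ne_zero _ _ _ b.succ_ne_zero] at h₂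
    simp only [place_none] at h₁
    interval_cases k <;> split_ifs at h₂ <;> simp only [InBox, stage, Nat.reduceAdd, Nat.reduceSub] at h₁ h₂ <;>
      omega
  | some 0, some (b + 1) =>
    rw [place_ne_zero _ _ _ b.succ_ne_zero, place_ne_zero _ _ _ b.succ_ne_zero] at h₂
    simp only [place_zero] at h₁
    interval_cases k <;> split_ifs at h₁ h₂ <;>
      simp only [InBox, stage, Nat.reduceAdd, Nat.reduceSub] at h₁ h₂ <;> omega
  | some (a + 1), none =>
    rw [place_ne_zero _ _ _ a.succ_ne_zero, place_ne_zero _ _ _ a.succ_ne_zero] at h₁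
    simp only [place_none] at h₂
    interval_cases k <;> split_ifs at h₁ <;> simp only [InBox, stage, Nat.reduceAdd, Nat.reduceSub] at h₁ h₂ <;>
      omega
  | some (a + 1), some 0 =>
    rw [place_ne_zero _ _ _ a.succ_ne_zero, place_ne_zero _ _ _ a.succ_ne_zero] at h₁
    simp only [place_zero] at h₂
    interval_cases k <;> split_ifs at h₁ h₂ <;>
      simp only [InBox, stage, Nat.reduceAdd, Nat.reduceSub] at h₁ h₂ <;> omega
  | some (a + 1), some (b + 1) =>
    have hab' : a ≠ b := fun h => hab (a + 1) rfl (by rw [h])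
    have hrs' := hrs rfl
    rw [place_ne_zero _ _ _ a.succ_ne_zero, place_ne_zero _ _ _ a.succ_ne_zero] at h₁
    rw [place_ne_zero _ _ _ b.succ_ne_zero, place_ne_zero _ _ _ b.succ_ne_zero] at h₂
    clear hab hbelow hrs
    interval_cases k <;> split_ifs at h₁ h₂ <;>
      simp only [InBox, stage, Nat.reduceAdd, Nat.reduceSub] at h₁ h₂ <;> omega

/-- All places lie in the grid. -/
theorem place_lt {n k j r : ℕ} {o : Option ℕ} (hj : j < n) (hr : r ≤ j)
    (ho : ∀ b, o = some b → b < n) : (place k j r o).1 < n ∧ (place k j r o).2 < n := by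
  match o with
  | none => simp only [place_none]; omega
  | some 0 => rw [place_zero]; split_ifs <;> omega
  | some (b + 1) =>
    rw [place_ne_zero _ _ _ b.succ_ne_zero]
    have := ho _ rfl
    match (if r % 2 = 1 then k - 4 else k) with
    | 0 => simp only [stage]; omega
    | 1 => simp only [stage]; omega
    | 2 => simp only [stage]; omega
    | 3 => simp only [stage]; omega
    | _ + 4 => simp only [stage]; omega

/-- The qubits acted on when a data qubit moves. -/
theorem place_cover {m k j r : ℕ} {o : Option ℕ} (hk : k < 8) (hr : leaves o = true → r < m)
    {x : ℕ × ℕ} (hne : place k j r o ≠ place (k + 1) j r o)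
    (h : InBox (place k j r o) (place (k + 1) j r o) x) :
    (x.1 = 0 ∧ (x.2 = j ∨ o = some 0 ∧ x.2 ≤ j)) ∨ (1 ≤ x.1 ∧ x.1 ≤ (m + 1) / 2) ∨
      (m + 1) / 2 < x.1 ∧ x.2 ≤ m / 2 := by
  match o with
  | none => exact absurd rfl hne
  | some 0 =>
    left
    simp only [place_zero, InBox, true_and] at h ⊢
    split_ifs at h <;> simp only at h <;> omega
  | some (b + 1) =>
    have hr := hr rfl
    rw [place_ne_zero _ _ _ b.succ_ne_zero, place_ne_zero _ _ _ b.succ_ne_zero] at h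
    clear hne
    interval_cases k <;> split_ifs at h <;>
      simp only [InBox, stage, Nat.reduceAdd, Nat.reduceSub] at h <;> omega

end CCNTC

namespace CCNTC

/-! ### Ranks -/

/-- The rows with their numbers, the numbers of leaving data qubits below, and their entries. -/
def ranked (j r : ℕ) (l : List (Option ℕ)) : List (ℕ × ℕ × Option ℕ) :=
  scan (fun (s : ℕ × ℕ) o => (s.1 + 1, bif leaves o then s.2 + 1 else s.2))
    (fun s o => [(s.1, s.2, o)]) (j, r) l

def rankIn (l : List (Option ℕ)) (j : ℕ) : ℕ := (l.take j).countP leaves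

theorem ranked_ofFn {n : ℕ} (j r : ℕ) (f : Fin n → Option ℕ) : ranked j r (List.ofFn f) =
    (List.finRange n).map fun i : Fin n => (j + i, r + rankIn (List.ofFn f) i, f i) := by
  induction n generalizing j r with
  | zero => simp [ranked, scan]
  | succ n ih =>
    have := ih (j + 1) (bif leaves (f 0) then r + 1 else r) (fun i => f i.succ)
    rw [ranked] at this
    rw [ranked, List.ofFn_succ, scan, this, List.finRange_succ, List.map_cons, List.map_map,
      List.singleton_append]
    congr 1
    refine List.map_congr_left fun i _ => ?_
    simp only [Function.comp_apply, Fin.val_succ, rankIn, List.take_succ_cons, List.countP_cons,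
      Prod.mk.injEq, and_true]
    refine ⟨by omega, ?_⟩
    cases leaves (f 0)
    · simp
    · simp; omega

theorem rankIn_le (l : List (Option ℕ)) (j : ℕ) : rankIn l j ≤ j :=
  List.countP_le_length.trans (List.length_take_le _ _)

theorem rankIn_mono (l : List (Option ℕ)) {i j : ℕ} (h : i ≤ j) : rankIn l i ≤ rankIn l j := by
  rw [rankIn, rankIn, ← Nat.min_eq_left h, ← List.take_take]
  exact (List.take_sublist _ _).countP_le

theorem rankIn_succ {l : List (Option ℕ)} {i : ℕ} {o : Option ℕ} (h : l[i]? = some o)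
    (ho : leaves o = true) : rankIn l (i + 1) = rankIn l i + 1 := by
  rw [rankIn, rankIn, List.take_add_one, h, List.countP_append]
  simp [ho]

theorem rankIn_lt_countP {l : List (Option ℕ)} {i : ℕ} {o : Option ℕ} (h : l[i]? = some o)
    (ho : leaves o = true) : rankIn l i < l.countP leaves := by
  rw [← Nat.succ_le_iff, Nat.succ_eq_add_one, ← rankIn_succ h ho]
  exact (List.take_sublist _ _).countP_le

/-! ### Targets and ranks of a reordering -/

namespace Reordering

variable {n : ℕ} (R : Reordering n)

/-- The target column of row `j`. -/
def target (j : Fin n) : Option ℕ := if h : j ∈ R.T then some (R.π ⟨j, h⟩ : ℕ) else none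

def targets : List (Option ℕ) := List.ofFn R.target

def rank (j : Fin n) : ℕ := rankIn R.targets j

theorem target_eq_some {j : Fin n} {b : ℕ} :
    R.target j = some b ↔ ∃ h : j ∈ R.T, (R.π ⟨j, h⟩ : ℕ) = b := by
  rw [target]
  split_ifs with h <;> simp [h]

theorem target_eq_none {j : Fin n} : R.target j = none ↔ j ∉ R.T := by
  rw [target]
  split_ifs with h <;> simp [h]

theorem target_lt {j : Fin n} {b : ℕ} (h : R.target j = some b) : b < n := by
  obtain ⟨_, rfl⟩ := R.target_eq_some.1 h
  exact Fin.is_lt _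

theorem target_injective {i j : Fin n} {b : ℕ} (hi : R.target i = some b)
    (hj : R.target j = some b) : i = j := by
  obtain ⟨h₁, e₁⟩ := R.target_eq_some.1 hi
  obtain ⟨h₂, e₂⟩ := R.target_eq_some.1 hj
  exact congrArg Subtype.val (R.injective (Fin.ext (e₁.trans e₂.symm)))

theorem target_below {i j : Fin n} (hj : R.target j = some 0) (hij : i < j) : i ∈ R.T := by
  obtain ⟨h, e⟩ := R.target_eq_some.1 hj
  exact R.below ⟨j, h⟩ e i hij

theorem leaves_target {j : Fin n} :
    leaves (R.target j) = true ↔ ∃ h : j ∈ R.T, (R.π ⟨j, h⟩ : ℕ) ≠ 0 := by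
  rw [target]
  split_ifs with h <;> simp [leaves, h]

theorem targets_getElem? (j : Fin n) : R.targets[(j : ℕ)]? = some (R.target j) := by
  simp [targets]

theorem countP_targets : R.targets.countP leaves = R.m := by
  have h : R.targets.countP leaves =
      (Finset.univ.filter fun j => leaves (R.target j) = true).card := by
    rw [targets, List.ofFn_eq_map, List.countP_map, List.countP_eq_length_filter]
    simp [Fin.univ_def, Finset.filter, Finset.card]
    rfl
  rw [h, m]
  symm
  refine Finset.card_bij (fun j _ => j.1) ?_ (fun _ _ _ _ h => Subtype.ext h) ?_
  · intro j hj
    simp only [Finset.mem_filter, Finset.mem_univ, true_and] at hj ⊢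
    exact R.leaves_target.2 ⟨j.2, hj⟩
  · intro j hj
    simp only [Finset.mem_filter, Finset.mem_univ, true_and] at hj
    obtain ⟨h₁, h₂⟩ := R.leaves_target.1 hj
    exact ⟨⟨j, h₁⟩, by simpa using h₂, rfl⟩

theorem rank_le (j : Fin n) : R.rank j ≤ j := rankIn_le _ _

theorem rank_lt_rank {i j : Fin n} (h : leaves (R.target i) = true) (hij : i < j) :
    R.rank i < R.rank j := by
  have := rankIn_succ (R.targets_getElem? i) h
  have h' : rankIn R.targets (i + 1) ≤ rankIn R.targets j := rankIn_mono _ hij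
  rw [rank, rank]
  omega

theorem rank_lt {j : Fin n} (h : leaves (R.target j) = true) : R.rank j < R.m :=
  R.countP_targets ▸ rankIn_lt_countP (R.targets_getElem? j) h

theorem card_le : R.T.card ≤ R.m + 1 := by
  have h₁ : R.T.card = (Finset.univ : Finset {j // j ∈ R.T}).card := by simp
  have h₂ := Finset.card_filter_add_card_filter_not (s := (Finset.univ : Finset {j // j ∈ R.T}))
    (fun j => (R.π j : ℕ) ≠ 0)
  have h₃ : (Finset.univ.filter fun j => ¬ (R.π j : ℕ) ≠ 0).card ≤ 1 := by
    refine Finset.card_le_one.2 fun i hi j hj => R.injective (Fin.ext ?_)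
    simp only [Finset.mem_filter, Finset.mem_univ, true_and, not_not] at hi hj
    rw [hi, hj]
  rw [m, h₁, ← h₂]
  omega

/-- The counted rows are injected by `π` into the n − 1 columns other than column 0. -/
theorem m_lt (hn : 0 < n) : R.m < n := by
  have h : R.m ≤ ((Finset.univ : Finset (Fin n)).erase ⟨0, hn⟩).card := by
    refine Finset.card_le_card_of_injOn R.π (fun j hj => ?_) R.injective.injOn
    simpa [Fin.ext_iff] using hj
  rw [Finset.card_erase_of_mem (Finset.mem_univ _), Finset.card_univ, Fintype.card_fin] at h
  omega

/-- If every row in `T` goes to column 0, a row j > 0 in `T` would force row 0 into `T` with the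
same target, against injectivity. Then no qubit moves, as the size bound 0 for m = 0 demands. -/
theorem target_of_m_eq_zero (hm : R.m = 0) {j : Fin n} {b : ℕ} (h : R.target j = some b) :
    b = 0 ∧ (j : ℕ) = 0 := by
  have hπ : ∀ i : {j // j ∈ R.T}, (R.π i : ℕ) = 0 := fun i => by
    simpa using (Finset.filter_eq_empty_iff.1 (Finset.card_eq_zero.1 hm)) (Finset.mem_univ i)
  obtain ⟨hj, e⟩ := R.target_eq_some.1 h
  rw [hπ] at e
  refine ⟨e.symm, by_contra fun h0 => ?_⟩
  subst e
  have hlt : (⟨0, j.pos⟩ : Fin n) < j := Fin.lt_def.2 (Nat.pos_of_ne_zero h0)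
  have := R.target_below h hlt
  have := R.injective (Fin.ext ((hπ ⟨_, this⟩).trans (hπ ⟨j, hj⟩).symm))
  exact hlt.ne (congrArg Subtype.val this)

end Reordering

end CCNTC

namespace CCNTC

/-! ### The routes of a reordering -/

theorem walk_eq_nil {f : ℕ} {q t : ℕ × ℕ} (h : q = t) : walk f q t = [] := h ▸ walk_self f t

theorem getLastD_map {α β : Type} (f : α → β) (l : List α) (a : α) :
    (l.map f).getLastD (f a) = f (l.getLastD a) := by
  induction l generalizing a with
  | nil => rfl
  | cons b l ih => rw [List.map_cons, List.getLastD_cons, List.getLastD_cons, ih]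

namespace Qubit

variable {n : ℕ}

def val (q : Qubit n) : ℕ × ℕ := (q.1, q.2)

/-- The reduction modulo n only makes the map total; by `spot_lt` all places that occur lie in the
grid. -/
def ofNat (hn : 0 < n) (x : ℕ × ℕ) : Qubit n :=
  (⟨x.1 % n, Nat.mod_lt _ hn⟩, ⟨x.2 % n, Nat.mod_lt _ hn⟩)

theorem val_injective : Function.Injective (val (n := n)) := by
  intro q r h
  simp only [val, Prod.mk.injEq, Fin.val_inj] at h
  exact Prod.ext h.1 h.2

theorem val_ofNat (hn : 0 < n) {x : ℕ × ℕ} (h₁ : x.1 < n) (h₂ : x.2 < n) :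
    val (ofNat hn x) = x := by
  rw [val, ofNat]
  exact Prod.ext (Nat.mod_eq_of_lt h₁) (Nat.mod_eq_of_lt h₂)

theorem ofNat_val (hn : 0 < n) (q : Qubit n) : ofNat hn q.val = q :=
  val_injective (val_ofNat hn q.1.2 q.2.2)

theorem neighbors_of_adjacent {q r : Qubit n} (h : Adjacent q.val r.val) : Neighbors q r := by
  simpa [Neighbors, Adjacent, val, Fin.ext_iff] using h

end Qubit

namespace Reordering

variable {n : ℕ} (R : Reordering n)

/-- The place of row `j` before route `k`, as a pair of numbers. -/
def spot (k : ℕ) (j : Fin n) : ℕ × ℕ := place k j (R.rank j) (R.target j)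

def pos (k : ℕ) (j : Fin n) : Qubit n := Qubit.ofNat j.pos (R.spot k j)

def tail (k : ℕ) (j : Fin n) : List (Qubit n) :=
  (walk n (R.spot k j) (R.spot (k + 1) j)).map (Qubit.ofNat j.pos)

theorem spot_lt (k : ℕ) (j : Fin n) : (R.spot k j).1 < n ∧ (R.spot k j).2 < n :=
  place_lt j.2 (R.rank_le j) fun _ => R.target_lt

theorem walk_spot (k : ℕ) (j : Fin n) :
    (∀ x ∈ R.spot k j :: walk n (R.spot k j) (R.spot (k + 1) j),
      InBox (R.spot k j) (R.spot (k + 1) j) x) ∧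
    (R.spot k j :: walk n (R.spot k j) (R.spot (k + 1) j)).IsChain Adjacent ∧
    (R.spot k j :: walk n (R.spot k j) (R.spot (k + 1) j)).Nodup ∧
    (walk n (R.spot k j) (R.spot (k + 1) j)).getLastD (R.spot k j) = R.spot (k + 1) j := by
  have hs : Straight (R.spot k j) (R.spot (k + 1) j) := place_straight _ _ _ _
  have h₁ := R.spot_lt k j
  have h₂ := R.spot_lt (k + 1) j
  -- A straight segment inside the grid has fewer than n steps.
  obtain ⟨s₁, s₂, s₃, s₄⟩ := walk_spec (f := n) hs (by
    simp only [Straight, dist] at hs ⊢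
    omega)
  refine ⟨fun x hx => ?_, s₂, s₃, s₄⟩
  rcases List.mem_cons.1 hx with rfl | hx
  · exact inBox_left _ _
  · exact (s₁ x hx).1

theorem path_eq (k : ℕ) (j : Fin n) : R.pos k j :: R.tail k j =
    (R.spot k j :: walk n (R.spot k j) (R.spot (k + 1) j)).map (Qubit.ofNat j.pos) := rfl

theorem map_val_path (k : ℕ) (j : Fin n) : (R.pos k j :: R.tail k j).map Qubit.val =
    R.spot k j :: walk n (R.spot k j) (R.spot (k + 1) j) := by
  rw [path_eq, List.map_map]
  refine (List.map_congr_left fun x hx => ?_).trans (List.map_id _)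
  have h := (R.walk_spot k j).1 x hx
  have h₁ := R.spot_lt k j
  have h₂ := R.spot_lt (k + 1) j
  simp only [InBox] at h
  exact Qubit.val_ofNat _ (by omega) (by omega)

theorem inBox_of_mem_path {k : ℕ} {j : Fin n} {q : Qubit n} (hq : q ∈ R.pos k j :: R.tail k j) :
    InBox (R.spot k j) (R.spot (k + 1) j) q.val :=
  (R.walk_spot k j).1 _ (R.map_val_path k j ▸ List.mem_map_of_mem hq)

theorem disjoint_path {k : ℕ} (hk : k < 8) {i j : Fin n} (hij : i < j) {q : Qubit n}
    (hi : q ∈ R.pos k i :: R.tail k i) (hj : q ∈ R.pos k j :: R.tail k j) : False :=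
  place_disjoint hk hij (R.rank_le i) (R.rank_le j) (fun h => R.rank_lt_rank h hij)
    (fun _ ha hb => hij.ne (R.target_injective ha hb))
    (fun hb ha => R.target_eq_none.1 ha (R.target_below hb hij))
    (R.inBox_of_mem_path hi) (R.inBox_of_mem_path hj)

theorem routes : Routes 8 R.pos R.tail where
  chain k _ j := by
    have h := (R.walk_spot k j).2.1
    rw [← map_val_path, List.isChain_map] at h
    exact h.imp fun _ _ => Qubit.neighbors_of_adjacent
  nodup k _ j := by
    have h := (R.walk_spot k j).2.2.1
    rw [← map_val_path] at h
    exact h.of_map _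
  last k _ j := by
    rw [tail, pos, getLastD_map, (R.walk_spot k j).2.2.2, pos]
  disjoint k hk i j hij q hi hj := by
    rcases lt_or_gt_of_ne hij with h | h
    · exact R.disjoint_path hk h hi hj
    · exact R.disjoint_path hk h hj hi

theorem pos_zero (j : Fin n) : R.pos 0 j = (⟨0, j.pos⟩, j) := by
  have h : R.spot 0 j = (0, (j : ℕ)) := by
    rw [spot]
    match h : R.target j with
    | none => rfl
    | some 0 => rfl
    | some (b + 1) => rw [place_ne_zero _ _ _ b.succ_ne_zero]; split_ifs <;> rfl
  rw [pos, h]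
  exact Qubit.ofNat_val j.pos (⟨0, j.pos⟩, j)

theorem pos_eight (j : Fin n) : R.pos 8 j = R.dest j := by
  rw [← Qubit.ofNat_val j.pos (R.dest j), pos]
  congr 1
  rw [spot, dest]
  split_ifs with h
  · have ht : R.target j = some (R.π ⟨j, h⟩ : ℕ) := R.target_eq_some.2 ⟨h, rfl⟩
    rw [ht, Qubit.val]
    by_cases h0 : (R.π ⟨j, h⟩ : ℕ) = 0
    · rw [h0, place_zero]; rfl
    · rw [place_ne_zero _ _ _ h0]; split_ifs <;> rfl
  · rw [R.target_eq_none.2 h]; rfl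

theorem tail_eq_nil {k : ℕ} {j : Fin n} (h : R.spot k j = R.spot (k + 1) j) :
    R.tail k j = [] := by
  rw [tail, walk_eq_nil h, List.map_nil]

theorem mem_of_tail_ne {k : ℕ} {j : Fin n} (h : R.tail k j ≠ []) : j ∈ R.T := by
  by_contra hj
  exact h (R.tail_eq_nil (by rw [spot, spot, R.target_eq_none.2 hj]; rfl))

theorem tail_of_m_eq_zero (hm : R.m = 0) (k : ℕ) (j : Fin n) : R.tail k j = [] := by
  refine R.tail_eq_nil ?_
  rw [spot, spot]
  match h : R.target j with
  | none => rfl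
  | some b =>
    obtain ⟨rfl, hj⟩ := R.target_of_m_eq_zero hm h
    rw [place_zero, place_zero, hj, ite_self, ite_self]

/-- For m > 0, at most m + 1 ≤ 2m rows move, along paths of at most n + 1 ≤ 2n qubits. For m = 0
nothing moves. -/
theorem sum_length_tail_le (k : ℕ) :
    ∑ j : Fin n, (if R.tail k j = [] then 0 else (R.tail k j).length + 1) ≤ 4 * (R.m * n) := by
  rcases Nat.eq_zero_or_pos R.m with hm | hm
  · simp [R.tail_of_m_eq_zero hm]
  · have h : ∀ j : Fin n, (if R.tail k j = [] then 0 else (R.tail k j).length + 1) ≤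
        if j ∈ R.T then n + 1 else 0 := by
      intro j
      by_cases hj : R.tail k j = []
      · simp [hj]
      · rw [if_neg hj, if_pos (R.mem_of_tail_ne hj), tail, List.length_map]
        exact Nat.succ_le_succ (length_walk_le _ _ _)
    refine (Finset.sum_le_sum fun j _ => h j).trans ?_
    rw [Finset.sum_ite_mem, Finset.univ_inter, Finset.sum_const, smul_eq_mul]
    have hn : 0 < n := by
      by_contra h0
      obtain rfl : n = 0 := by omega
      simp [m, Finset.eq_empty_of_isEmpty] at hm
    calc R.T.card * (n + 1) ≤ (2 * R.m) * (2 * n) :=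
          Nat.mul_le_mul (by have := R.card_le; omega) (by omega)
      _ = 4 * (R.m * n) := by ring

theorem mul_le_sq : (R.m + 1) * n ≤ n ^ 2 := by
  rcases Nat.eq_zero_or_pos n with h | h
  · simp [h]
  · rw [sq]
    exact Nat.mul_le_mul_right _ (R.m_lt h)

/-- The qubits acted on. -/
theorem path_cover {k : ℕ} (hk : k < 8) {j : Fin n} (hne : R.tail k j ≠ []) {q : Qubit n}
    (hq : q ∈ R.pos k j :: R.tail k j) :
    (q.1 : ℕ) = 0 ∧ q.2 ∈ R.T ∨ (1 ≤ (q.1 : ℕ) ∧ (q.1 : ℕ) ≤ (R.m + 1) / 2) ∨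
      (R.m + 1) / 2 < q.1 ∧ (q.2 : ℕ) ≤ R.m / 2 := by
  rcases place_cover hk R.rank_lt (fun h => hne (R.tail_eq_nil h)) (R.inBox_of_mem_path hq) with
    ⟨h₁, h₂ | ⟨h₂, h₃⟩⟩ | h | h
  · have : q.2 = j := Fin.ext h₂
    exact Or.inl ⟨h₁, this ▸ R.mem_of_tail_ne hne⟩
  · refine Or.inl ⟨h₁, ?_⟩
    rcases (show q.2 ≤ j from h₃).lt_or_eq with h | h
    · exact R.target_below h₂ h
    · exact h ▸ R.mem_of_tail_ne hne
  · exact Or.inr (Or.inl h)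
  · exact Or.inr (Or.inr h)

/-- With a = ⌈m/2⌉ and b = ⌊m/2⌋, the qubits acted on lie among at most m + 1 places of column 0,
the columns 1, …, a in full, and the rows 0, …, b of the columns beyond a. -/
theorem encard_le {S : Set (Qubit n)}
    (h : ∀ q ∈ S, ∃ k < 8, ∃ j, R.tail k j ≠ [] ∧ q ∈ R.pos k j :: R.tail k j) :
    S.encard ≤ (((R.m + 1) * n : ℕ) : ℕ∞) := by
  rcases Nat.eq_zero_or_pos n with rfl | hn
  · rw [Set.eq_empty_of_isEmpty S]; simp
  have hm := R.m_lt hn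
  set a := (R.m + 1) / 2 with ha
  set b := R.m / 2 with hb
  let A : Finset (ℕ × ℕ) := R.T.image fun j : Fin n => (0, (j : ℕ))
  let X : Finset (ℕ × ℕ) := Finset.Icc 1 a ×ˢ Finset.range n
  let Y : Finset (ℕ × ℕ) := Finset.Ioo a n ×ˢ Finset.range (b + 1)
  have hsub : Qubit.val '' S ⊆ ((A ∪ (X ∪ Y) : Finset (ℕ × ℕ)) : Set (ℕ × ℕ)) := by
    rintro _ ⟨q, hq, rfl⟩
    obtain ⟨k, hk, j, hne, hmem⟩ := h q hq
    have h₁ := q.1.2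
    have h₂ := q.2.2
    rw [Finset.mem_coe, Finset.mem_union, Finset.mem_union]
    rcases R.path_cover hk hne hmem with ⟨h₃, h₄⟩ | h₃ | h₃
    · exact Or.inl (Finset.mem_image.2 ⟨q.2, h₄, by rw [Qubit.val, h₃]⟩)
    · refine Or.inr (Or.inl (Finset.mem_product.2 ⟨?_, ?_⟩))
      · exact Finset.mem_Icc.2 h₃
      · exact Finset.mem_range.2 h₂
    · refine Or.inr (Or.inr (Finset.mem_product.2 ⟨?_, ?_⟩))
      · exact Finset.mem_Ioo.2 ⟨h₃.1, h₁⟩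
      · exact Finset.mem_range.2 (Nat.lt_succ_of_le h₃.2)
  rw [← Qubit.val_injective.encard_image]
  refine (Set.encard_le_encard hsub).trans ?_
  rw [Set.encard_coe_eq_coe_finsetCard]
  refine Nat.cast_le.2 ((Finset.card_union_le _ _).trans ?_)
  have hA : A.card ≤ R.m + 1 := Finset.card_image_le.trans R.card_le
  have hX : X.card = a * n := by simp [X]
  have hY : Y.card = (n - a - 1) * (b + 1) := by simp [Y]
  have hXY := Finset.card_union_le X Y
  obtain ⟨e, he⟩ : ∃ e, n = a + b + 1 + e := ⟨n - (a + b + 1), by omega⟩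
  have hab : R.m = a + b := by omega
  have hsub : n - a - 1 = b + e := by omega
  rw [hsub] at hY
  rw [hX, hY] at hXY
  rw [hab] at hA ⊢
  -- With n = a + b + 1 + e the right side exceeds the left by exactly ab.
  have : a + b + 1 + (a * n + (b + e) * (b + 1)) ≤ (a + b + 1) * n := by
    rw [he]; nlinarith
  omega

end Reordering

/-! ### The controller of a reordering -/

theorem initial_eq_std {n : ℕ} (φ : State (Fin n)) :
    initial φ = std (fun j : Fin n => ((⟨0, j.pos⟩, j) : Qubit n)) φ := by
  classical
  ext x
  rw [initial, std_apply_of_iff (C := ∀ q : Qubit n, (q.1 : ℕ) ≠ 0 → x q = false)]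
  refine forall_congr' fun q => ?_
  have : q ∉ Set.range (fun j : Fin n => ((⟨0, j.pos⟩, j) : Qubit n)) ↔ (q.1 : ℕ) ≠ 0 := by
    refine not_congr ⟨?_, fun h => ⟨q.2, Prod.ext (Fin.ext h.symm) rfl⟩⟩
    rintro ⟨j, rfl⟩
    rfl
  rw [this]

/-- All remaining qubits are back in state |0⟩, so χ is the scalar `c` times |0…0⟩. The scalar
depends on the outcomes only. -/
theorem smul_std_dest {n : ℕ} (R : Reordering n) (c : ℂ) : ∃ χ, ∀ φ : State (Fin n),
    c • std R.dest φ = relocated R φ χ := by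
  classical
  refine ⟨fun y => if ∀ q, y q = false then c else 0, fun φ => ?_⟩
  ext x
  rw [Pi.smul_apply, std_apply_of_iff (C := ∀ q : {q : Qubit n // q ∉ Set.range R.dest},
    x q.1 = false) ⟨fun h q => h q.1 q.2, fun h q hq => h ⟨q, hq⟩⟩, relocated]
  split_ifs <;> simp [mul_comm]

theorem squareWidth_le {B : GateSet} {P : Palette B} {n : ℕ} (C : Controller P n) :
    C.squareWidth ≤ n ^ 2 :=
  Nat.sInf_le ⟨n, 0, 0, rfl, fun q _ => by have := q.1.2; have := q.2.2; omega⟩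

namespace Compiled

variable {B : GateSet} {P : Palette B} (W : Compiled P) {n : ℕ} (R : Reordering n)

/-- The controller that performs a reordering. -/
def reorder : Controller P n := W.control 8 (pathsOf R.pos R.tail)

theorem moves_reorder : Moves (W.reorder R) R := by
  intro h s hc
  obtain ⟨c, hc⟩ := R.routes.evolve_eq W hc
  obtain ⟨χ, hχ⟩ := smul_std_dest R c
  refine ⟨χ, fun φ => ?_⟩
  rw [← hχ, ← funext R.pos_eight, ← hc, initial_eq_std]
  congr 2
  exact (funext R.pos_zero).symm

theorem width_reorder : (W.reorder R).width ≤ (((R.m + 1) * n : ℕ) : ℕ∞) :=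
  R.encard_le fun _ hq => Routes.acted_subset W hq

/-- The constant 32 is 8 routes times the factor 4 of `sum_length_tail_le`, which bounds a single
timestep. -/
theorem size_reorder :
    (W.reorder R).size ≤ ((32 * W.period * (R.m * n) : ℕ) : ℕ∞) := by
  refine (Routes.size_le W fun k _ => R.sum_length_tail_le k).trans (le_of_eq ?_)
  congr 1
  ring

end Compiled

end CCNTC

namespace CCNTC

/-! ### Compiling the gates of a wire -/

theorem exists_map_eq {α β : Type} {f : α → β} {l : List β} (h : ∀ b ∈ l, ∃ a, f a = b) :
    ∃ l' : List α, l'.map f = l := by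
  have : l ∈ Set.range (List.map f) := by rw [Set.range_list_map]; exact h
  exact this

theorem tprod_reverse {M : Type*} [Monoid M] (l : List M) : tprod l.reverse = l.prod := by
  induction l with
  | nil => rfl
  | cons a l ih => rw [List.reverse_cons, tprod_append, ih, List.prod_cons]; simp [tprod]

theorem eq_inv_smul_of_norm_eq_one {M : Type*} [AddCommGroup M] [Module ℂ M] {c : ℂ} {a b : M}
    (hc : ‖c‖ = 1) (h : a = c • b) : b = c⁻¹ • a := by
  have : c ≠ 0 := by
    rintro rfl
    simp at hc
  rw [h, smul_smul, inv_mul_cancel₀ this, one_smul]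

theorem GateSet.onPair_mono {B B' : GateSet} (h₁ : B.one ⊆ B'.one) (h₂ : B.two ⊆ B'.two) :
    B.onPair ⊆ B'.onPair := by
  rintro M (⟨U, hU, e⟩ | ⟨U, hU, e⟩ | ⟨U, hU, e⟩ | ⟨U, hU, e⟩)
  · exact Or.inl ⟨U, h₁ hU, e⟩
  · exact Or.inr (Or.inl ⟨U, h₁ hU, e⟩)
  · exact Or.inr (Or.inr (Or.inl ⟨U, h₂ hU, e⟩))
  · exact Or.inr (Or.inr (Or.inr ⟨U, h₂ hU, e⟩))

/-- Finitely many operations on a pair of qubits use finitely many basic gates. -/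
theorem GateSet.exists_finite {B : GateSet} {l : List (Matrix (Bool × Bool) (Bool × Bool) ℂ)}
    (h : ∀ M ∈ l, M ∈ B.onPair) : ∃ S₁ ⊆ B.one, ∃ S₂ ⊆ B.two, S₁.Finite ∧ S₂.Finite ∧
      ∀ M ∈ l, M ∈ GateSet.onPair ⟨S₁, S₂⟩ := by
  induction l with
  | nil => exact ⟨∅, Set.empty_subset _, ∅, Set.empty_subset _, Set.finite_empty,
      Set.finite_empty, by simp⟩
  | cons M l ih =>
    obtain ⟨S₁, hS₁, S₂, hS₂, f₁, f₂, hl⟩ := ih fun N hN => h N (List.mem_cons_of_mem _ hN)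
    obtain ⟨T₁, hT₁, T₂, hT₂, g₁, g₂, hM⟩ : ∃ S₁ ⊆ B.one, ∃ S₂ ⊆ B.two, S₁.Finite ∧ S₂.Finite ∧
        M ∈ GateSet.onPair ⟨S₁, S₂⟩ := by
      rcases h M List.mem_cons_self with ⟨U, hU, e⟩ | ⟨U, hU, e⟩ | ⟨U, hU, e⟩ | ⟨U, hU, e⟩
      · exact ⟨{U}, by simpa using hU, ∅, by simp, by simp, by simp, Or.inl ⟨U, rfl, e⟩⟩
      · exact ⟨{U}, by simpa using hU, ∅, by simp, by simp, by simp,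
          Or.inr (Or.inl ⟨U, rfl, e⟩)⟩
      · exact ⟨∅, by simp, {U}, by simpa using hU, by simp, by simp,
          Or.inr (Or.inr (Or.inl ⟨U, rfl, e⟩))⟩
      · exact ⟨∅, by simp, {U}, by simpa using hU, by simp, by simp,
          Or.inr (Or.inr (Or.inr ⟨U, rfl, e⟩))⟩
    refine ⟨S₁ ∪ T₁, Set.union_subset hS₁ hT₁, S₂ ∪ T₂, Set.union_subset hS₂ hT₂, f₁.union g₁,
      f₂.union g₂, fun N hN => ?_⟩
    rcases List.mem_cons.1 hN with rfl | hN
    · exact GateSet.onPair_mono Set.subset_union_right Set.subset_union_right hM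
    · exact GateSet.onPair_mono Set.subset_union_left Set.subset_union_left (hl N hN)

/-- Every finite set of basic gates is contained in a palette. -/
theorem Palette.exists_of_finite {B : GateSet} {S₁ : Set Unitary₁} {S₂ : Set Unitary₂}
    (hS₁ : S₁ ⊆ B.one) (hS₂ : S₂ ⊆ B.two) (f₁ : S₁.Finite) (f₂ : S₂.Finite) :
    ∃ P : Palette B, (∀ U ∈ S₁, ∃ g, (P.one g : Unitary₁) = U) ∧
      ∀ U ∈ S₂, ∃ g, (P.two g : Unitary₂) = U := by
  obtain ⟨k₁, u₁, -, e₁⟩ := f₁.fin_param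
  obtain ⟨k₂, u₂, -, e₂⟩ := f₂.fin_param
  refine ⟨⟨k₁, k₂, fun g => ⟨u₁ g, hS₁ (e₁ ▸ Set.mem_range_self g)⟩,
    fun g => ⟨u₂ g, hS₂ (e₂ ▸ Set.mem_range_self g)⟩⟩, fun U hU => ?_, fun U hU => ?_⟩
  · rw [← e₁] at hU; exact hU
  · rw [← e₂] at hU; exact hU

theorem Gen.exists_mat_eq {B : GateSet} {P : Palette B} {S₁ : Set Unitary₁} {S₂ : Set Unitary₂}
    (h₁ : ∀ U ∈ S₁, ∃ g, (P.one g : Unitary₁) = U) (h₂ : ∀ U ∈ S₂, ∃ g, (P.two g : Unitary₂) = U)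
    {M : Matrix (Bool × Bool) (Bool × Bool) ℂ} (hM : M ∈ GateSet.onPair ⟨S₁, S₂⟩) :
    ∃ g : {g : Gen P // g ≠ Gen.measure}, g.1.mat = M := by
  rcases hM with ⟨U, hU, e⟩ | ⟨U, hU, e⟩ | ⟨U, hU, e⟩ | ⟨U, hU, e⟩
  · obtain ⟨g, rfl⟩ := h₁ U hU
    exact ⟨⟨Gen.fst g, by simp⟩, e.symm⟩
  · obtain ⟨g, rfl⟩ := h₁ U hU
    exact ⟨⟨Gen.snd g, by simp⟩, e.symm⟩
  · obtain ⟨g, rfl⟩ := h₂ U hU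
    exact ⟨⟨Gen.both g, by simp⟩, e.symm⟩
  · obtain ⟨g, rfl⟩ := h₂ U hU
    exact ⟨⟨Gen.swap g, by simp⟩, e.symm⟩

/-- A product of gates of a palette, up to a scalar. -/
theorem Palette.exists_word {B : GateSet} {P : Palette B} {c : ℂ} {U : Matrix Bool Bool ℂ}
    {l : List Unitary₁} (hc : ‖c‖ = 1) (hU : U = c • ((l.prod : Unitary₁) : Matrix Bool Bool ℂ))
    (h : ∀ V ∈ l, ∃ g, (P.one g : Unitary₁) = V) : ∃ (w : List (Fin P.k₁)) (d : ℂ),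
      tprod (w.map fun g => ((P.one g : Unitary₁) : Matrix Bool Bool ℂ)) = d • U := by
  obtain ⟨w, rfl⟩ := exists_map_eq h
  refine ⟨w.reverse, c⁻¹, ?_⟩
  rw [← eq_inv_smul_of_norm_eq_one hc hU, List.map_reverse, tprod_reverse]
  clear hU h
  induction w with
  | nil => rfl
  | cons a w ih => rw [List.map_cons, List.prod_cons, ih]; rfl

/-- Only H, X, Z and CZ are needed. Universality writes each as a finite word, and the finitely many
basic gates in the four words form the palette. Words are reversed because a matrix product lists
the last operation first; phases go into the scalars. -/
theorem GateSet.Universal.compiled {B : GateSet} (hB : B.Universal) :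
    ∃ P : Palette B, Nonempty (Compiled P) := by
  obtain ⟨a, la, ha, ma, ea⟩ := hB.one ⟨hMat, hMat_mem⟩
  obtain ⟨b, lb, hb, mb, eb⟩ := hB.one ⟨xPow true, xPow_mem _⟩
  obtain ⟨c, lc, hc, mc, ec⟩ := hB.one ⟨zPow true, zPow_mem _⟩
  obtain ⟨d, ld, hd, md, ed⟩ := hB.two ⟨czMat, czMat_mem⟩
  obtain ⟨S₁, hS₁, S₂, hS₂, f₁, f₂, hl⟩ := GateSet.exists_finite md
  obtain ⟨P, h₁, h₂⟩ := Palette.exists_of_finite (S₁ := {U | U ∈ la ++ lb ++ lc} ∪ S₁)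
    (Set.union_subset (fun U hU => by
      simp only [Set.mem_ofPred_eq, List.mem_append] at hU
      rcases hU with (h | h) | h
      exacts [ma U h, mb U h, mc U h]) hS₁) hS₂ ((List.finite_toSet _).union f₁) f₂
  obtain ⟨x, hx⟩ := exists_map_eq fun M hM =>
    Gen.exists_mat_eq (fun U hU => h₁ U (Or.inr hU)) h₂ (hl M hM)
  obtain ⟨wa, sa⟩ := Palette.exists_word ha ea fun V hV => h₁ V (Or.inl (by simp [hV]))
  obtain ⟨wb, sb⟩ := Palette.exists_word hb eb fun V hV => h₁ V (Or.inl (by simp [hV]))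
  obtain ⟨wc, sc⟩ := Palette.exists_word hc ec fun V hV => h₁ V (Or.inl (by simp [hV]))
  refine ⟨P, ⟨⟨wa, wb, wc, (x.map Subtype.val).reverse, sa, sb, sc, ⟨d⁻¹, ?_⟩, ?_⟩⟩⟩
  · rw [List.map_reverse, tprod_reverse, List.map_map]
    refine (congrArg List.prod hx).trans (eq_inv_smul_of_norm_eq_one hd ed)
  · intro g hg
    rw [List.mem_reverse, List.mem_map] at hg
    obtain ⟨y, -, rfl⟩ := hg
    exact y.2

end CCNTC

namespace CCNTC

/-! ### The classical machine -/

open Enc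

namespace PF

variable {α β γ : Type} [Enc α] [Enc β] [Enc γ]

theorem of_bool (φ : Bool → β) : PF φ :=
  ofBool (fun b _ => φ b) id (const _) (const _)

theorem of_bool_prod {φ : Bool × γ → β} (h : ∀ b, PF fun y => φ (b, y)) : PF φ :=
  ofBool (fun b (x : Bool × γ) => φ (b, x.2)) id.fst ((h true).comp id.snd)
    ((h false).comp id.snd)

/-- Flags take finitely many values, so any function of them is a decision tree of depth five. This
covers the predicates of all layers at once. -/
theorem of_flags (φ : Flags → β) : PF φ :=
  of_bool_prod fun _ => of_bool_prod fun _ => of_bool_prod fun _ => of_bool_prod fun _ => of_bool _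

theorem map {ι ω : Type} [Enc ι] [Enc ω] {f : α → ι → ω} {l : α → List ι}
    (hf : PF (fun x : α × ι => f x.1 x.2)) (hl : PF l) : PF (fun a => (l a).map (f a)) := by
  have := flatMap (f := fun a i => [f a i]) (hf.cons (const [])) hl
  convert this using 2 with a
  exact (List.flatMap_pure_eq_map _ _).symm

theorem toward {f g : α → ℕ} (hf : PF f) (hg : PF g) : PF (fun a => toward (f a) (g a)) :=
  (hf.lt hg).cond hf.succ ((hg.lt hf).cond hf.pred hf)

theorem stepTo {f g : α → ℕ × ℕ} (hf : PF f) (hg : PF g) : PF (fun a => stepTo (f a) (g a)) :=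
  (toward hg.fst hf.fst).pair (toward hg.snd hf.snd)

end PF

theorem sz_toward_le (a b : ℕ) : sz (toward a b) ≤ sz a + 2 := by
  rw [toward_eq]
  split_ifs
  · rw [sz_succ]
  · cases a
    · simp
    · rw [sz_succ, Nat.add_sub_cancel]; omega
  · omega

namespace PF

variable {α β γ : Type} [Enc α] [Enc β] [Enc γ]

theorem walk {f : α → ℕ} {g h : α → ℕ × ℕ} (hf : PF f) (hg : PF g) (hh : PF h) :
    PF (fun a => walk (f a) (g a) (h a)) := by
  have hs : PF (fun x : α × (ℕ × ℕ) × Unit => CCNTC.stepTo (h x.1) x.2.1) :=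
    stepTo (hh.comp id.fst) id.snd.fst
  have ht : PF (fun x : α × (ℕ × ℕ) × Unit => h x.1) := hh.comp id.fst
  refine scan 4 hs ((PF.and (beq id.snd.fst.fst ht.fst) (beq id.snd.fst.snd ht.snd)).cond
    (const []) (hs.cons (const []))) hg hf.replicate fun a s i => ?_
  have h₁ := sz_toward_le s.1 (h a).1
  have h₂ := sz_toward_le s.2 (h a).2
  have h₃ : sz s = sz s.1 + sz s.2 + 1 := rfl
  rw [CCNTC.stepTo, sz_prod]
  omega

theorem leaves {f : α → Option ℕ} (hf : PF f) : PF (fun a => leaves (f a)) :=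
  (hf.getD (d := 0) rfl).ne_zero

theorem stage {j r b : α → ℕ} (hj : PF j) (hr : PF r) (hb : PF b) (t : ℕ) :
    PF (fun a => stage (j a) (r a) (b a) t) :=
  match t with
  | 0 => (const 0).pair hj
  | 1 => hr.half.succ.pair hj
  | 2 => hr.half.succ.pair hr.succ.half
  | 3 => hb.pair hr.succ.half
  | _ + 4 => hb.pair (const 0)

theorem place {j r : α → ℕ} {o : α → Option ℕ} (k : ℕ) (hj : PF j) (hr : PF r) (ho : PF o) :
    PF (fun a => place k (j a) (r a) (o a)) :=
  (leaves ho).cond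
    (hr.odd.cond (stage hj hr (ho.getD rfl) _) (stage hj hr (ho.getD rfl) _))
    ((ho.isSome.and (const _)).cond (const _) ((const 0).pair hj))

theorem ranked {f : α → List (Option ℕ)} (hf : PF f) : PF (fun a => ranked 0 0 (f a)) := by
  refine scan (d := fun _ (s : ℕ × ℕ) o => (s.1 + 1, bif CCNTC.leaves o then s.2 + 1 else s.2))
    (e := fun _ (s : ℕ × ℕ) o => [(s.1, s.2, o)]) (init := fun _ => ((0 : ℕ), (0 : ℕ))) 4 ?_ ?_
    (const (0, 0)) hf fun a s i => ?_
  · exact id.snd.fst.fst.succ.pair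
      ((leaves id.snd.snd).cond id.snd.fst.snd.succ id.snd.fst.snd)
  · exact (id.snd.fst.fst.pair (id.snd.fst.snd.pair id.snd.snd)).cons (const [])
  · have h₃ : sz s = sz s.1 + sz s.2 + 1 := rfl
    rw [sz_prod, sz_succ]
    cases CCNTC.leaves i
    · rw [cond_false]; omega
    · rw [cond_true, sz_succ]; omega

end PF

/-- Presents the recursion as a transducer whose state is the preceding qubit, the form required by
`PF.scan`. -/
theorem wireItems_eq {V : Type} (p : V) (l : List V) : wireItems p l =
    scan (fun _ q => q) (fun p q => [(true, p, q)]) p l ++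
      [(false, l.foldl (fun _ q => q) p, l.foldl (fun _ q => q) p)] := by
  induction l generalizing p with
  | nil => rfl
  | cons q l ih => rw [wireItems, ih]; rfl

namespace PF

variable {α V : Type} [Enc α] [Enc V]

theorem wireItems {p : α → V} {l : α → List V} (hp : PF p) (hl : PF l) :
    PF (fun a => wireItems (p a) (l a)) := by
  have hlast : PF (fun a => (l a).foldl (fun _ q => q) (p a)) :=
    foldl_of_le (step := fun _ _ q => q) 0 id.snd.snd hp hl fun a s i => by omega
  have := (scan (d := fun (_ : α) (_ q : V) => q) (e := fun _ p q => [(true, p, q)]) 0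
    id.snd.snd (((const true).pair (id.snd.fst.pair id.snd.snd)).cons (const [])) hp hl
    fun a s i => by omega).append (((const false).pair (hlast.pair hlast)).cons (const []))
  convert this using 2 with a
  exact wireItems_eq _ _

theorem pathItems {l : α → List (V × List V)} (hl : PF l) : PF (fun a => pathItems (l a)) :=
  flatMap (f := fun (_ : α) (x : V × List V) => CCNTC.wireItems x.1 x.2) (wireItems id.snd.fst id.snd.snd) hl

theorem annotate {s : α → Track} {l : α → List (Item V)} (hs : PF s) (hl : PF l) :
    PF (fun a => annotate (s a) (l a)) := by
  have hu : PF (fun x : α × Track × Item V => x.2.1) := id.snd.fst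
  have hi : PF (fun x : α × Track × Item V => x.2.2) := id.snd.snd
  have ho := hu.fst.headD (d := false) rfl
  refine scan 16 (d := fun _ => Track.next) (e := fun _ => Track.flag) ?_ ?_ hs hl
    fun a s i => ?_
  · exact hi.fst.cond (hu.fst.tail.pair ((hu.snd.snd.fst.xor ho).pair
      (hu.snd.fst.pair hu.snd.snd.snd.not)))
      (hu.fst.pair ((const false).pair ((const false).pair (const false))))
  · exact ((hi.fst.pair (ho.pair hu.snd)).pair hi.snd).cons (const [])
  · have h₁ : sz s.1.tail ≤ sz s.1 := by
      cases s.1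
      · rfl
      · rw [List.tail_cons, sz_cons]; omega
    have h₂ : sz s = sz s.1 + sz s.2 + 1 := rfl
    have h₃ : ∀ u v w : Bool, sz (u, v, w) ≤ 11 := by decide
    rw [Track.next]
    cases i.1
    · rw [cond_false, sz_prod]
      have := h₃ false false false
      omega
    · rw [cond_true, sz_prod]
      have := h₃ (Bool.xor s.2.2.1 (s.1.headD false)) s.2.1 (!s.2.2.2)
      omega

end PF

/-! ### The controller on numbers -/

section Naturality

variable {V V' : Type} (f : V → V')

/-- Annotation never inspects the places, so it commutes with relabelling them. This transfers
results from pairs of numbers, on which the machine works, to grid points, on which the controller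
is defined. -/
theorem annotate_map (s : Track) (l : List (Item V)) :
    annotate s (l.map (Prod.map id (Prod.map f f))) =
      (annotate s l).map (Prod.map id (Prod.map f f)) := by
  induction l generalizing s with
  | nil => rfl
  | cons i l ih =>
    have h := ih (s.next i)
    rw [annotate] at h ⊢
    rw [annotate, List.map_cons, scan, scan, List.map_append]
    exact congrArg₂ _ rfl h

theorem wireItems_map (p : V) (l : List V) :
    wireItems (f p) (l.map f) = (wireItems p l).map (Prod.map id (Prod.map f f)) := by
  induction l generalizing p with
  | nil => rfl
  | cons q l ih => rw [List.map_cons, wireItems, ih]; rfl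

theorem pathItems_map (l : List (V × List V)) :
    pathItems (l.map (Prod.map f (List.map f))) =
      (pathItems l).map (Prod.map id (Prod.map f f)) := by
  rw [pathItems, pathItems, List.flatMap_map, List.map_flatMap]
  exact congrArg (l.flatMap ·) (funext fun x => wireItems_map f x.1 x.2)

end Naturality

/-- The paths of a reordering as pairs of numbers, from the list of its target columns. -/
def numberPaths (k : ℕ) (l : List (Option ℕ)) : List ((ℕ × ℕ) × List (ℕ × ℕ)) :=
  (ranked 0 0 l).map fun x => (place k x.1 x.2.1 x.2.2,
    walk l.length (place k x.1 x.2.1 x.2.2) (place (k + 1) x.1 x.2.1 x.2.2))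

theorem PF.numberPaths (k : ℕ) : PF (numberPaths k) := by
  have hj : PF (fun x : List (Option ℕ) × ℕ × ℕ × Option ℕ => x.2.1) := PF.id.snd.fst
  have hr : PF (fun x : List (Option ℕ) × ℕ × ℕ × Option ℕ => x.2.2.1) := PF.id.snd.snd.fst
  have ho : PF (fun x : List (Option ℕ) × ℕ × ℕ × Option ℕ => x.2.2.2) := PF.id.snd.snd.snd
  exact PF.map (f := fun l (x : ℕ × ℕ × Option ℕ) => (CCNTC.place k x.1 x.2.1 x.2.2,
    CCNTC.walk l.length (CCNTC.place k x.1 x.2.1 x.2.2) (CCNTC.place (k + 1) x.1 x.2.1 x.2.2)))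
    ((place k hj hr ho).pair
      (walk (length id.fst) (place k hj hr ho) (place (k + 1) hj hr ho))) (ranked id)

theorem Reordering.numberPaths_targets {n : ℕ} (R : Reordering n) (k : ℕ) :
    numberPaths k R.targets =
      (pathsOf R.pos R.tail k).map (Prod.map Qubit.val (List.map Qubit.val)) := by
  rw [numberPaths, targets, ranked_ofFn, pathsOf, List.map_map, List.map_map]
  refine List.map_congr_left fun j _ => ?_
  have h := R.map_val_path k j
  rw [List.map_cons, List.cons.injEq] at h
  simp only [Function.comp_apply, Prod.map_apply, h.1, h.2, zero_add, List.length_ofFn]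
  rfl

namespace Gen

variable {B : GateSet} {P : Palette B}

/-- The code of an operation at a step given by numbers. -/
def code (p q : ℕ × ℕ) : Gen P → Data
  | fst g => Data.pair (Data.ofNat 1) (Data.pair (Data.ofNat g) (enc p))
  | snd g => Data.pair (Data.ofNat 1) (Data.pair (Data.ofNat g) (enc q))
  | both g => Data.pair (Data.ofNat 2) (Data.pair (Data.ofNat g) (Data.pair (enc p) (enc q)))
  | swap g => Data.pair (Data.ofNat 2) (Data.pair (Data.ofNat g) (Data.pair (enc q) (enc p)))
  | measure => Data.pair (Data.ofNat 0) (enc p)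

theorem encode_op {n : ℕ} (p q : Qubit n) (g : Gen P) :
    (g.op p q).encode = g.code p.val q.val := by
  cases g <;> rfl

theorem polyTime_code {α : Type} [Enc α] {p q : α → ℕ × ℕ} (hp : PF p) (hq : PF q) (g : Gen P) :
    PF (fun a => g.code (p a) (q a)) :=
  match g with
  | fst _ => PolyTime.pair (PolyTime.const _) (PolyTime.pair (PolyTime.const _) hp)
  | snd _ => PolyTime.pair (PolyTime.const _) (PolyTime.pair (PolyTime.const _) hq)
  | both _ => PolyTime.pair (PolyTime.const _)
      (PolyTime.pair (PolyTime.const _) (PolyTime.pair hp hq))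
  | swap _ => PolyTime.pair (PolyTime.const _)
      (PolyTime.pair (PolyTime.const _) (PolyTime.pair hq hp))
  | measure => PolyTime.pair (PolyTime.const _) hp

end Gen

/-! ### The controller runs in polynomial time -/

theorem Data.ofList_eq {α : Type} (e : α → Data) (l : List α) :
    Data.ofList e l = enc (l.map e) := by
  induction l with
  | nil => rfl
  | cons a l ih => rw [Data.ofList, ih]; rfl

namespace Compiled

variable {B : GateSet} {P : Palette B} (W : Compiled P)

/-- The codes of the operations of timestep `t`. -/
def codes (t : ℕ) (x : List (Option ℕ) × History) : List Data :=
  (annotate (start (x.2.getD (W.measureTime (t / W.period)) []))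
    (pathItems (numberPaths (t / W.period) x.1))).flatMap fun a =>
      bif (W.round t).1 a.1 then [(W.round t).2.code a.2.1 a.2.2] else []

theorem polyTime_codes (t : ℕ) : PF (W.codes t) := by
  have hs : PF (fun x : List (Option ℕ) × History =>
      start (x.2.getD (W.measureTime (t / W.period)) [])) :=
    (PF.list_getD PF.id.snd _).pair (PF.const (false, false, false))
  refine PF.flatMap (f := fun _ a =>
      bif (W.round t).1 a.1 then [(W.round t).2.code a.2.1 a.2.2] else []) ?_
    (PF.annotate hs (PF.pathItems ((PF.numberPaths _).comp PF.id.fst)))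
  exact ((PF.of_flags (W.round t).1).comp PF.id.snd.fst).cond
    ((Gen.polyTime_code PF.id.snd.snd.fst PF.id.snd.snd.snd _).cons (PF.const [])) (PF.const [])

theorem codes_targets {n : ℕ} (R : Reordering n) (t : ℕ) (h : History) :
    W.codes t (R.targets, h) =
      (W.timestep (pathsOf R.pos R.tail) t h).map Op.encode := by
  rw [codes, timestep, opsOf, R.numberPaths_targets, pathItems_map, annotate_map, List.map_map,
    List.flatMap_map]
  induction annotate (start (h.getD (W.measureTime (t / W.period)) []))
    (pathItems (pathsOf R.pos R.tail (t / W.period))) with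
  | nil => rfl
  | cons a l ih =>
    rw [List.flatMap_cons, ih, List.filter_cons]
    cases hp : (W.round t).1 a.1 <;> simp [hp, Gen.encode_op]

/-- The number `8 * W.period` of timesteps does not depend on the input, so the machine selects one
of finitely many programs by the length of the history; running off the list is the stop symbol. -/
theorem polyTime_reorder : PolyTime
    (fun a : (Σ n : ℕ, Reordering n) × History => Data.pair a.1.2.encode (History.encode a.2))
    (fun a => Data.ofOption (Data.ofList Op.encode) (W.reorder a.1.2 a.2)) := by
  have h := PF.getElem?_length (α := List (Option ℕ) × History) PF.id.snd W.codes
    (List.range (8 * W.period)) fun t _ => W.polyTime_codes t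
  refine (h.reindex fun a : (Σ n : ℕ, Reordering n) × History => (a.1.2.targets, a.2)).congr
    fun a => ?_
  simp only [reorder, control]
  cases (List.range (8 * W.period))[a.2.length]? with
  | none => rfl
  | some t =>
    rw [Option.map_some, Option.map_some, codes_targets, Data.ofOption, Data.ofList_eq]
    rfl

/-- The circuit that performs all reorderings. -/
def circuit : Circuit B (Σ n : ℕ, Reordering n) (fun i => i.1) (fun i => i.2.encode) where
  palette := P
  controller i := W.reorder i.2
  admissible i := i.2.routes.admissible W
  polyTime := W.polyTime_reorder

end Compiled

end CCNTC

theorem mainTheorem3 (B : CCNTC.GateSet) (hB : B.Universal) :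
    ∃ (C : CCNTC.Circuit B (Σ n : ℕ, CCNTC.Reordering n) (fun i => i.1) (fun i => i.2.encode))
      (c d : ℕ), ∀ (n : ℕ) (R : CCNTC.Reordering n),
        CCNTC.Moves (C.controller ⟨n, R⟩) R ∧
        (C.controller ⟨n, R⟩).depth ≤ (d : ℕ∞) ∧
        (C.controller ⟨n, R⟩).size ≤ ((c * (R.m * n) : ℕ) : ℕ∞) ∧
        (C.controller ⟨n, R⟩).width ≤ (((R.m + 1) * n : ℕ) : ℕ∞) ∧
        (R.m + 1) * n ≤ n ^ 2 ∧
        (C.controller ⟨n, R⟩).squareWidth ≤ n ^ 2 := by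
  obtain ⟨P, ⟨W⟩⟩ := hB.compiled
  exact ⟨W.circuit, 32 * W.period, 8 * W.period, fun n R =>
    ⟨W.moves_reorder R, CCNTC.Routes.depth_le W, W.size_reorder R, W.width_reorder R, R.mul_le_sq,
      CCNTC.squareWidth_le _⟩⟩
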